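/- **Lemma.** Let $T$ be a tree on a vertex set $V$ of size $n$, let $\mathcal C_1\subseteq E(T)$ be a set of edges of $T$ and let $\mathcal C_2\subseteq E(T)^{(2)}$ be a set of unordered pairs of distinct edges of $T$. For $S\subseteq V$ let $\Delta_T(S)$ be the set of edges of $T$ with exactly one endpoint in $S$. Each $e\in\mathcal C_1$ (a 1-respecting cut) induces the bipartition $\{S,V\setminus S\}$ of $V$ with $\Delta_T(S)=\{e\}$, and each $\{e,f\}\in\mathcal C_2$ (a 2-respecting cut) induces the bipartition $\{S,V\setminus S\}$ with $\Delta_T(S)=\{e,f\}$. The meet of these bipartitions is the coarsest partition of $V$ that refines all of them (it is $\{V\}$ if there are none). There is a deterministic algorithm that, given $T$, $\mathcal C_1$ and $\mathcal C_2$, returns the meet of the induced bipartitions in time $$\mathcal O\big((n+|\mathcal C_1|+|\mathcal C_2|)\,\log^2 n\,\log^* n\big),$$ where for $n=1$ the factor $\log^2 n\,\log^* n=0$ is read as $1$, $\log$ is the binary logarithm, and $\log^* n$ is the number of times it has to be applied, starting from $n$, until the result is at most $1$. Here $V=\{0,\dots,n-1\}$, and the model is the word RAM: a single program runs on machines with $w$-bit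 words for every $w\ge k(\lfloor\log n\rfloor+1)$, where $k$ is a constant, with one time unit for each arithmetic operation ($+,-,\times$, integer division, comparison), memory access and control step, and with all registers and all memory outside the input initially $0$. The input is the numbers $n,|\mathcal C_1|,|\mathcal C_2|$ followed by the lists of the edges of $T$, of the members of $\mathcal C_1$ and of the members of $\mathcal C_2$, each edge given by its two endpoints, in any order; the output is the explicit list of the blocks of the meet, each block given by its size and the list of its elements. -/

import Mathlib

/-! ### A word RAM

Words are the natural numbers below `2 ^ w`, where `w` is the word size.  A program uses finitely many
registers and a memory addressed by words; both hold words.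
A program is a fixed finite text, the same for
all inputs and all word sizes, and running it involves neither randomness nor nondeterminism. -/

namespace WordRAM

/-- The binary machine operations. -/
inductive Op where
  | add | sub | mul | div | lt | eq

/-- Addition and multiplication wrap around modulo `2 ^ w`, subtraction is cut off at `0`, division
rounds down (with `x / 0 = 0`), and comparisons return `1` or `0`. -/
def Op.eval (w : ℕ) : Op → ℕ → ℕ → ℕ
  | .add, a, b => (a + b) % 2 ^ w
  | .sub, a, b => a - b
  | .mul, a, b => (a * b) % 2 ^ w
  | .div, a, b => a / b
  | .lt, a, b => if a < b then 1 else 0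
  | .eq, a, b => if a = b then 1 else 0

/-- Expressions: constants, registers, the memory cell at a computed address, operations. -/
inductive Expr where
  | const (c : ℕ)
  | reg (r : ℕ)
  | load (addr : Expr)
  | op (o : Op) (a b : Expr)

/-- A configuration: the contents of the registers and of the memory. -/
structure State where
  reg : ℕ → ℕ
  mem : ℕ → ℕ

/-- The value of an expression. -/
def Expr.eval (w : ℕ) (s : State) : Expr → ℕ
  | .const c => c % 2 ^ w
  | .reg r => s.reg r
  | .load a => s.mem (a.eval w s)
  | .op o a b => o.eval w (a.eval w s) (b.eval w s)

/-- The time to evaluate an expression: one unit for each constant, each register access, each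
memory access and each operation. -/
def Expr.cost : Expr → ℕ
  | .const _ => 1
  | .reg _ => 1
  | .load a => a.cost + 1
  | .op _ a b => a.cost + b.cost + 1

/-- Programs. -/
inductive Prog where
  | skip
  | assign (r : ℕ) (e : Expr)
  | store (addr val : Expr)
  | seq (p q : Prog)
  | cond (e : Expr) (p q : Prog)
  | loop (e : Expr) (p : Prog)

/-- `Exec w p s t s'`: on a machine with `w`-bit words, the program `p` started in the configuration
`s` halts after exactly `t` time units in the configuration `s'`. -/
inductive Exec (w : ℕ) : Prog → State → ℕ → State → Prop where
  | skip (s : State) : Exec w .skip s 1 s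
  | assign (s : State) (r : ℕ) (e : Expr) :
      Exec w (.assign r e) s (e.cost + 1) ⟨Function.update s.reg r (e.eval w s), s.mem⟩
  | store (s : State) (a e : Expr) :
      Exec w (.store a e) s (a.cost + e.cost + 1)
        ⟨s.reg, Function.update s.mem (a.eval w s) (e.eval w s)⟩
  | seq {p q : Prog} {s s₁ s₂ : State} {t₁ t₂ : ℕ} :
      Exec w p s t₁ s₁ → Exec w q s₁ t₂ s₂ → Exec w (.seq p q) s (t₁ + t₂) s₂
  | cond_true {e : Expr} {p q : Prog} {s s₁ : State} {t : ℕ} :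
      e.eval w s ≠ 0 → Exec w p s t s₁ → Exec w (.cond e p q) s (e.cost + 1 + t) s₁
  | cond_false {e : Expr} {p q : Prog} {s s₁ : State} {t : ℕ} :
      e.eval w s = 0 → Exec w q s t s₁ → Exec w (.cond e p q) s (e.cost + 1 + t) s₁
  | loop_done {e : Expr} {p : Prog} {s : State} :
      e.eval w s = 0 → Exec w (.loop e p) s (e.cost + 1) s
  | loop_step {e : Expr} {p : Prog} {s s₁ s₂ : State} {t₁ t₂ : ℕ} :
      e.eval w s ≠ 0 → Exec w p s t₁ s₁ → Exec w (.loop e p) s₁ t₂ s₂ →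
        Exec w (.loop e p) s (e.cost + 1 + t₁ + t₂) s₂

/-- The machine is deterministic: the running time and the final configuration are determined by the
program and the initial configuration. -/
theorem Exec.deterministic {w : ℕ} {p : Prog} {s s₁ s₂ : State} {t₁ t₂ : ℕ}
    (h₁ : Exec w p s t₁ s₁) (h₂ : Exec w p s t₂ s₂) : t₁ = t₂ ∧ s₁ = s₂ := by
  induction h₁ generalizing t₂ s₂ with
  | skip | assign | store => cases h₂; exact ⟨rfl, rfl⟩
  | seq _ _ ih₁ ih₂ =>
    cases h₂ with
    | seq a b =>
      obtain ⟨rfl, rfl⟩ := ih₁ a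
      obtain ⟨rfl, rfl⟩ := ih₂ b
      exact ⟨rfl, rfl⟩
  | cond_true h _ ih =>
    cases h₂ with
    | cond_true _ a => obtain ⟨rfl, rfl⟩ := ih a; exact ⟨rfl, rfl⟩
    | cond_false h' _ => exact absurd h' h
  | cond_false h _ ih =>
    cases h₂ with
    | cond_true h' _ => exact absurd h h'
    | cond_false _ a => obtain ⟨rfl, rfl⟩ := ih a; exact ⟨rfl, rfl⟩
  | loop_done h =>
    cases h₂ with
    | loop_done _ => exact ⟨rfl, rfl⟩
    | loop_step h' _ _ => exact absurd h h'
  | loop_step h _ _ ih₁ ih₂ =>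
    cases h₂ with
    | loop_done h' => exact absurd h' h
    | loop_step _ a b =>
      obtain ⟨rfl, rfl⟩ := ih₁ a
      obtain ⟨rfl, rfl⟩ := ih₂ b
      exact ⟨rfl, rfl⟩

/-- The initial configuration: the input stands at the addresses `0, 1, 2, …`, and all registers and
all other memory cells are `0`. -/
def initState (input : List ℕ) : State := ⟨fun _ => 0, fun i => input.getD i 0⟩

/-- The memory of `s` holds the list `output` at the addresses `0, 1, 2, …`. -/
def HasOutput (s : State) (output : List ℕ) : Prop :=
  ∀ (i : ℕ) (h : i < output.length), s.mem i = output[i]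

end WordRAM

/-! ### Cuts of a tree and the meet of bipartitions -/

namespace TreeCuts

/-- `Δ_T(S)`: the set of edges of `T` with exactly one endpoint in `S`. -/
def boundary {V : Type*} (T : SimpleGraph V) (S : Set V) : Set (Sym2 V) :=
  {e | ∃ u v : V, T.Adj u v ∧ u ∈ S ∧ v ∉ S ∧ e = s(u, v)}

/-- The bipartition `{S, V ∖ S}`, as an equivalence relation. -/
def bipartition {V : Type*} (S : Set V) : Setoid V :=
  Setoid.ker (fun v => v ∈ S)

/-- The bipartitions induced by the edge singletons in `C₁` and the edge pairs in `C₂`: an edge set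
`F` of one or two edges of the tree `T` induces the bipartition `{S, V ∖ S}` with `Δ_T(S) = F`. -/
def inducedBipartitions {V : Type*} (T : SimpleGraph V) (C₁ : Finset (Sym2 V))
    (C₂ : Finset (Sym2 (Sym2 V))) : Set (Setoid V) :=
  {r | ∃ S : Set V, r = bipartition S ∧
    ((∃ e ∈ C₁, boundary T S = {e}) ∨ (∃ q ∈ C₂, boundary T S = {e | e ∈ q}))}

/-- The meet of the induced bipartitions, i.e. their greatest lower bound under refinement: in the
order on `Setoid V`, `r ≤ r'` iff the partition `r` is a refinement of the partition `r'`. -/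
def meet {V : Type*} (T : SimpleGraph V) (C₁ : Finset (Sym2 V))
    (C₂ : Finset (Sym2 (Sym2 V))) : Setoid V :=
  sInf (inducedBipartitions T C₁ C₂)

/-! ### Input and output format -/

/-- The list `L` lists the set `A` without repetition and in an arbitrary order, where an entry `x`
of `L` stands for the object `f x`. -/
def Lists {α β : Type*} (f : α → β) (L : List α) (A : Set β) : Prop :=
  (L.map f).Nodup ∧ ∀ b, b ∈ L.map f ↔ b ∈ A

/-- The undirected edge given by its two endpoints. -/
def edgeOf {n : ℕ} (p : Fin n × Fin n) : Sym2 (Fin n) := s(p.1, p.2)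

/-- The unordered pair of edges given by the endpoints of the two edges. -/
def edgePairOf {n : ℕ} (q : (Fin n × Fin n) × (Fin n × Fin n)) : Sym2 (Sym2 (Fin n)) :=
  s(edgeOf q.1, edgeOf q.2)

/-- An edge occupies two words, its endpoints. -/
def encodeEdge {n : ℕ} (p : Fin n × Fin n) : List ℕ := [(p.1 : ℕ), (p.2 : ℕ)]

/-- The input: the number of vertices, of edge singletons and of edge pairs, then the edges of the
tree, the edge singletons, and the edge pairs. -/
def encodeInput {n : ℕ} (E L₁ : List (Fin n × Fin n))
    (L₂ : List ((Fin n × Fin n) × (Fin n × Fin n))) : List ℕ :=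
  [n, L₁.length, L₂.length] ++ E.flatMap encodeEdge ++ L₁.flatMap encodeEdge ++
    L₂.flatMap (fun q => encodeEdge q.1 ++ encodeEdge q.2)

/-- `B` is an explicit listing of the partition `r`: a list of its blocks, each block being given by
a list of its elements, all without repetition. -/
def ListsPartition {n : ℕ} (B : List (List (Fin n))) (r : Setoid (Fin n)) : Prop :=
  (∀ b ∈ B, b.Nodup) ∧ Lists (fun b : List (Fin n) => {v | v ∈ b}) B r.classes

/-- The output: the number of blocks, then for each block its size followed by its elements. -/
def encodeOutput {n : ℕ} (B : List (List (Fin n))) : List ℕ :=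
  B.length :: B.flatMap (fun b => b.length :: b.map (fun v => (v : ℕ)))

/-- The iterated logarithm `log* x`: how often the binary logarithm has to be applied, starting from
`x`, until the result is at most `1`. -/
noncomputable def logStar (x : ℝ) : ℕ := sInf {i : ℕ | (Real.logb 2)^[i] x ≤ 1}

end TreeCuts

/-! Compare every vertex with the vertex 0: give `x` the bit vector whose entry for a cut tells
whether that cut separates `x` from 0. Two vertices lie in one block of the meet iff their vectors
agree. This uses that each cut induces a bipartition (tree edges are bridges, and boundaries of
symmetric differences add modulo 2: `exists_boundary_eq_singleton`, `exists_boundary_eq_pair`) and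
that the boundary determines it (`mem_iff_of_boundary_eq`), which gives `meet_rel`.

Crossing a tree edge changes exactly the bits of the cuts that contain it (`markedTree`). So a
depth-first walk can carry a single vector along, and since each edge is crossed once down and once
up, the number of bit flips is linear in the total size of the cuts, at most |C₁| + 2|C₂| edges
(`sum_markList_le`).

To compare vectors in constant time, the current bits are kept at the leaves of a heap-shaped binary
tree. An inner node carries a name of the pair of names of its children: a fresh positive number
when the pair occurs for the first time, the old number afterwards, and 0 for the pair (0, 0). Names
are never withdrawn, so root names recorded at different moments are equal iff the vectors are
(`Heap.root_eq_iff`). A flip only renames the ancestors of one leaf (`flip_ends`), which is O(log n)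
work because there are at most n² leaves. The root name at the moment the walk stands at a vertex is
the label of that vertex (`walk_ends`); using labels as array indices, `group_ends` collects the
blocks.

The table of names is a directly addressed two-dimensional array. It needs no initialisation: an
entry 0 means "no name yet", and zero memory already represents the zero vector of the vertex 0. All
addresses are polynomial in n, so they fit into words of O(log n) bits.

The total time is O((n + |C₁| + |C₂|)(log n + 1)) (`meetProg_ends`), and log n + 1 is at most twice
the factor in the claim (`natLog_add_one_le`). -/

namespace WordRAM

/-! ### Timed correctness of programs -/

/-- Started in `s`, the program `p` halts within `b` time units in a configuration satisfying `Q`. -/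
def Ends (w : ℕ) (p : Prog) (s : State) (b : ℕ) (Q : State → Prop) : Prop :=
  ∃ t s', Exec w p s t s' ∧ t ≤ b ∧ Q s'

section
variable {w : ℕ} {p q : Prog} {e : Expr} {s : State} {b b' : ℕ} {Q Q' : State → Prop}

theorem Ends.mono (h : Ends w p s b Q) (hb : b ≤ b') (hQ : ∀ s', Q s' → Q' s') :
    Ends w p s b' Q' := by
  obtain ⟨t, s', h1, h2, h3⟩ := h
  exact ⟨t, s', h1, h2.trans hb, hQ _ h3⟩

theorem Ends.seq {b₁ b₂ : ℕ} (h : Ends w p s b₁ fun s₁ => Ends w q s₁ b₂ Q)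
    (hb : b₁ + b₂ ≤ b) : Ends w (p.seq q) s b Q := by
  obtain ⟨t, s', h1, h2, t', s'', h3, h4, h5⟩ := h
  exact ⟨_, _, .seq h1 h3, by omega, h5⟩

theorem Ends.skip (hb : 1 ≤ b) (hQ : Q s) : Ends w .skip s b Q :=
  ⟨_, _, .skip s, hb, hQ⟩

theorem Ends.assign {r v : ℕ} (hv : e.eval w s = v) (hb : e.cost + 1 ≤ b)
    (hQ : Q ⟨Function.update s.reg r v, s.mem⟩) : Ends w (.assign r e) s b Q := by
  subst hv
  exact ⟨_, _, .assign s r e, hb, hQ⟩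

theorem Ends.store {a : Expr} {i v : ℕ} (hi : a.eval w s = i) (hv : e.eval w s = v)
    (hb : a.cost + e.cost + 1 ≤ b)
    (hQ : Q ⟨s.reg, Function.update s.mem i v⟩) : Ends w (.store a e) s b Q := by
  subst hv hi
  exact ⟨_, _, .store s a e, hb, hQ⟩

theorem Ends.cond {c : ℕ} (hp : e.eval w s ≠ 0 → Ends w p s c Q)
    (hq : e.eval w s = 0 → Ends w q s c Q) (hb : e.cost + 1 + c ≤ b) :
    Ends w (.cond e p q) s b Q := by
  by_cases h : e.eval w s = 0
  · obtain ⟨t, s', h1, h2, h3⟩ := hq h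
    exact ⟨_, _, .cond_false h h1, by omega, h3⟩
  · obtain ⟨t, s', h1, h2, h3⟩ := hp h
    exact ⟨_, _, .cond_true h h1, by omega, h3⟩

theorem Ends.loop_done (he : e.eval w s = 0) (hb : e.cost + 1 ≤ b) (hQ : Q s) :
    Ends w (.loop e p) s b Q :=
  ⟨_, _, .loop_done he, hb, hQ⟩

theorem Ends.loop_step {b₁ b₂ : ℕ} (he : e.eval w s ≠ 0)
    (h : Ends w p s b₁ fun s₁ => Ends w (.loop e p) s₁ b₂ Q)
    (hb : e.cost + 1 + b₁ + b₂ ≤ b) : Ends w (.loop e p) s b Q := by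
  obtain ⟨t, s', h1, h2, t', s'', h3, h4, h5⟩ := h
  exact ⟨_, _, .loop_step he h1 h3, by omega, h5⟩

/-- A loop whose running time is bounded by a potential. -/
theorem Ends.loop (I : State → ℕ → Prop)
    (done : ∀ s b, I s b → e.eval w s = 0 → e.cost + 1 ≤ b ∧ Q s)
    (step : ∀ s b, I s b → e.eval w s ≠ 0 →
      ∃ c, Ends w p s c fun s' => ∃ b', I s' b' ∧ e.cost + 1 + c + b' ≤ b)
    (h : I s b) : Ends w (.loop e p) s b Q := by
  induction b using Nat.strong_induction_on generalizing s with
  | _ b ih =>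
    by_cases he : e.eval w s = 0
    · obtain ⟨h1, h2⟩ := done s b h he
      exact Ends.loop_done he h1 h2
    · obtain ⟨c, t, s', h1, h2, b', h3, h4⟩ := step s b h he
      -- The loop test alone costs a unit, so the potential drops strictly; termination and the time
      -- bound come from the same induction.
      obtain ⟨t', s'', h5, h6, h7⟩ := ih b' (by omega) h3
      exact ⟨_, _, .loop_step he h1 h5, by omega, h7⟩

end

/-- Sequential execution of a list of programs. -/
def block : List Prog → Prog
  | [] => .skip
  | p :: l => .seq p (block l)

section
variable {w : ℕ} {p : Prog} {l : List Prog} {e : Expr} {s : State} {b : ℕ} {Q : State → Prop}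

theorem Ends.block_nil (hb : 1 ≤ b) (hQ : Q s) : Ends w (block []) s b Q := Ends.skip hb hQ

theorem Ends.block_cons {b₁ b₂ : ℕ} (h : Ends w p s b₁ fun s₁ => Ends w (block l) s₁ b₂ Q)
    (hb : b₁ + b₂ ≤ b) : Ends w (block (p :: l)) s b Q := Ends.seq h hb

theorem Ends.block_assign {r : ℕ} (v : ℕ) (hv : e.eval w s = v) {b₂ : ℕ}
    (h : Ends w (block l) ⟨Function.update s.reg r v, s.mem⟩ b₂ Q)
    (hb : e.cost + 1 + b₂ ≤ b) : Ends w (block (.assign r e :: l)) s b Q :=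
  Ends.block_cons (Ends.assign hv le_rfl h) hb

theorem Ends.block_store {a : Expr} (i v : ℕ) (hi : a.eval w s = i) (hv : e.eval w s = v) {b₂ : ℕ}
    (h : Ends w (block l) ⟨s.reg, Function.update s.mem i v⟩ b₂ Q)
    (hb : a.cost + e.cost + 1 + b₂ ≤ b) : Ends w (block (.store a e :: l)) s b Q :=
  Ends.block_cons (Ends.store hi hv le_rfl h) hb

end

section
variable {w : ℕ} {s : State} {x y : Expr} {a b : ℕ}

theorem eval_add (hx : x.eval w s = a) (hy : y.eval w s = b) (h : a + b < 2 ^ w) :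
    (Expr.op .add x y).eval w s = a + b := by
  simp [Expr.eval, Op.eval, hx, hy, Nat.mod_eq_of_lt h]

theorem eval_mul (hx : x.eval w s = a) (hy : y.eval w s = b) (h : a * b < 2 ^ w) :
    (Expr.op .mul x y).eval w s = a * b := by
  simp [Expr.eval, Op.eval, hx, hy, Nat.mod_eq_of_lt h]

theorem eval_lt (hx : x.eval w s = a) (hy : y.eval w s = b) :
    (Expr.op .lt x y).eval w s = if a < b then 1 else 0 := by
  subst hx hy
  rfl

theorem eval_sub (hx : x.eval w s = a) (hy : y.eval w s = b) :
    (Expr.op .sub x y).eval w s = a - b := by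
  subst hx hy
  rfl

theorem eval_reg {r : ℕ} (h : s.reg r = a) : (Expr.reg r).eval w s = a := h

theorem eval_const (h : a < 2 ^ w) : (Expr.const a).eval w s = a := Nat.mod_eq_of_lt h

end

/-! ### Arrays with two indices -/

/-- An injective pairing that the machine can compute. -/
def pr (x y : ℕ) : ℕ := (x + y) * (x + y) + x

/-- The value lies between (x + y)² and (x + y)² + (x + y), below the next square, so it determines
x + y and then x. -/
theorem pr_inj {x y x' y' : ℕ} : pr x y = pr x' y' ↔ x = x' ∧ y = y' := by
  refine ⟨fun h => ?_, fun h => by rw [h.1, h.2]⟩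
  unfold pr at h
  have key : x + y = x' + y' := by
    rcases lt_trichotomy (x + y) (x' + y') with hl | hl | hl
    · nlinarith
    · exact hl
    · nlinarith
  rw [key] at h
  omega

/-- The address of the entry `(x, y)` of the array number `t`. -/
def addr (β t x y : ℕ) : ℕ := β + (8 * pr x y + t)

/-- Eight arrays are interleaved: the offset modulo 8 is the array number, the quotient is the
paired index. -/
theorem addr_inj {β t x y t' x' y' : ℕ} (ht : t < 8) (ht' : t' < 8) :
    addr β t x y = addr β t' x' y' ↔ t = t' ∧ x = x' ∧ y = y' := by
  rw [← pr_inj (x := x)]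
  unfold addr
  omega

theorem le_addr (β t x y : ℕ) : β ≤ addr β t x y := Nat.le_add_right _ _

/-- Numbers up to `X` can be used as array indices on a machine with `w`-bit words. -/
def Roomy (w X : ℕ) : Prop := 512 * X ^ 4 ≤ 2 ^ w ∧ 8 ≤ X

theorem Roomy.lt {w X a : ℕ} (h : Roomy w X) (ha : a ≤ 64 * X) : a < 2 ^ w := by
  obtain ⟨h1, h2⟩ := h
  have : X * 1 ≤ X * X ^ 3 := Nat.mul_le_mul_left _ (Nat.one_le_pow _ _ (by omega))
  have h4 : X * X ^ 3 = X ^ 4 := by ring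
  omega

theorem pr_le {X x y : ℕ} (hx : x ≤ X) (hy : y ≤ X) : pr x y ≤ 4 * X ^ 2 + X := by
  have : (x + y) * (x + y) ≤ (X + X) * (X + X) := Nat.mul_le_mul (by omega) (by omega)
  unfold pr
  nlinarith

/-- The first index may itself be a value of `pr`, when rows are indexed by edges; hence the bound
4X² + X. The second pairing is then 25X⁴ plus lower terms, and eight times this stays below 512X⁴.
-/
theorem Roomy.addr_lt {w X β t x y : ℕ} (h : Roomy w X) (hβ : β ≤ X) (ht : t < 8)
    (hx : x ≤ 4 * X ^ 2 + X) (hy : y ≤ X) : addr β t x y < 2 ^ w := by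
  obtain ⟨h1, h2⟩ := h
  have e1 : x + y ≤ 5 * X ^ 2 := by nlinarith
  have e2 : (x + y) * (x + y) ≤ 5 * X ^ 2 * (5 * X ^ 2) := Nat.mul_le_mul e1 e1
  have e3 : 64 * X ^ 2 ≤ X ^ 4 := by
    have h4 : X ^ 4 = X ^ 2 * X ^ 2 := by ring
    rw [h4]
    exact Nat.mul_le_mul_right _ (by nlinarith)
  have e4 : 5 * X ^ 2 * (5 * X ^ 2) = 25 * X ^ 4 := by ring
  have e5 : 8 * X ≤ X ^ 2 := by nlinarith
  unfold addr pr
  omega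

/-- The expression for `pr`. -/
def pairE (x y : Expr) : Expr := .op .add (.op .mul (.op .add x y) (.op .add x y)) x

/-- The expression for `addr`; the base address is in register `0`. -/
def addrE (t : ℕ) (x y : Expr) : Expr :=
  .op .add (.reg 0) (.op .add (.op .mul (.const 8) (pairE x y)) (.const t))

/-- The contents of an array entry. -/
def cellE (t : ℕ) (x y : Expr) : Expr := .load (addrE t x y)

section
variable {w X β t a b : ℕ} {s : State} {x y : Expr}

theorem eval_pairE (hx : x.eval w s = a) (hy : y.eval w s = b) (h : pr a b < 2 ^ w) :
    (pairE x y).eval w s = pr a b := by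
  have h1 : a + b ≤ (a + b) * (a + b) := Nat.le_mul_self _
  unfold pr at h ⊢
  have h2 : (Expr.op .add x y).eval w s = a + b := eval_add hx hy (by omega)
  exact eval_add (eval_mul h2 h2 (by omega)) hx h

theorem Roomy.eval_pairE (hX : Roomy w X) (hx : x.eval w s = a) (hy : y.eval w s = b)
    (ha : a ≤ X) (hb : b ≤ X) : (pairE x y).eval w s = pr a b := by
  refine WordRAM.eval_pairE hx hy ?_
  have h1 := hX.addr_lt (β := 0) (t := 0) (x := a) (y := b) (by omega) (by omega) (by omega) hb
  unfold addr at h1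
  omega

theorem Roomy.eval_addrE (hX : Roomy w X) (hβ : β ≤ X) (h0 : s.reg 0 = β) (ht : t < 8)
    (hx : x.eval w s = a) (hy : y.eval w s = b) (ha : a ≤ 4 * X ^ 2 + X) (hb : b ≤ X) :
    (addrE t x y).eval w s = addr β t a b := by
  have h := hX.addr_lt hβ ht ha hb
  have h8 : 8 ≤ X := hX.2
  have h1 : pr a b < 2 ^ w := lt_of_le_of_lt (by unfold addr; omega) h
  unfold addr at h ⊢
  exact eval_add h0 (eval_add (eval_mul (eval_const (hX.lt (by omega)))
    (WordRAM.eval_pairE hx hy h1) (by omega)) (eval_const (hX.lt (by omega))) (by omega)) h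

theorem Roomy.eval_cellE (hX : Roomy w X) (hβ : β ≤ X) (h0 : s.reg 0 = β) (ht : t < 8)
    (hx : x.eval w s = a) (hy : y.eval w s = b) (ha : a ≤ 4 * X ^ 2 + X) (hb : b ≤ X) :
    (cellE t x y).eval w s = s.mem (addr β t a b) := by
  simp [cellE, Expr.eval, hX.eval_addrE hβ h0 ht hx hy ha hb]

end

/-! ### Lists in memory -/

/-- The row `x` of the array `t` holds the list `l`, preceded by its length. -/
def Row (β : ℕ) (m : ℕ → ℕ) (t x : ℕ) (l : List ℕ) : Prop :=
  m (addr β t x 0) = l.length ∧ ∀ k (h : k < l.length), m (addr β t x (k + 1)) = l[k]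

/-- The memory after appending `v` to the row `x` of the array `t`. -/
def pushMem (β : ℕ) (m : ℕ → ℕ) (t x v : ℕ) : ℕ → ℕ :=
  Function.update (Function.update m (addr β t x (m (addr β t x 0) + 1)) v) (addr β t x 0)
    (m (addr β t x 0) + 1)

theorem pushMem_of_lt {β t x v i : ℕ} {m : ℕ → ℕ} (h : i < β) : pushMem β m t x v i = m i := by
  unfold pushMem
  rw [Function.update_of_ne, Function.update_of_ne]
  · have := le_addr β t x (m (addr β t x 0) + 1); omega
  · have := le_addr β t x 0; omega

theorem pushMem_addr_of_ne {β t x v t' x' y : ℕ} {m : ℕ → ℕ} (ht : t < 8) (ht' : t' < 8)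
    (h : ¬ (t' = t ∧ x' = x)) : pushMem β m t x v (addr β t' x' y) = m (addr β t' x' y) := by
  unfold pushMem
  rw [Function.update_of_ne, Function.update_of_ne]
  all_goals
    rw [Ne, addr_inj ht' ht]
    tauto

theorem pushMem_addr_zero {β t x v t' x' : ℕ} {m : ℕ → ℕ} (ht : t < 8) (ht' : t' < 8) :
    pushMem β m t x v (addr β t' x' 0) =
      if t' = t ∧ x' = x then m (addr β t' x' 0) + 1 else m (addr β t' x' 0) := by
  split_ifs with h
  · rw [h.1, h.2]; simp [pushMem]
  · exact pushMem_addr_of_ne ht ht' h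

theorem Row.push {β t x v t' x' : ℕ} {m : ℕ → ℕ} {l : List ℕ} (h : Row β m t' x' l) (ht : t < 8)
    (ht' : t' < 8) :
    Row β (pushMem β m t x v) t' x' (if t' = t ∧ x' = x then l ++ [v] else l) := by
  split_ifs with hc
  · obtain ⟨rfl, rfl⟩ := hc
    obtain ⟨h1, h2⟩ := h
    constructor
    · simp [pushMem, h1]
    · intro k hk
      simp only [List.length_append, List.length_singleton] at hk
      have : addr β t' x' (k + 1) ≠ addr β t' x' 0 := by rw [Ne, addr_inj ht ht]; omega
      unfold pushMem
      rw [Function.update_of_ne this, h1]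
      rcases Nat.lt_or_ge k l.length with hk' | hk'
      · rw [Function.update_of_ne, h2 k hk', List.getElem_append_left hk']
        rw [Ne, addr_inj ht ht]; omega
      · obtain rfl : k = l.length := by omega
        simp
  · refine ⟨?_, fun k hk => ?_⟩
    · rw [pushMem_addr_of_ne ht ht' hc, h.1]
    · rw [pushMem_addr_of_ne ht ht' hc, h.2]

theorem Row.congr {β t x : ℕ} {m m' : ℕ → ℕ} {l : List ℕ} (h : Row β m t x l)
    (hm : ∀ y, m' (addr β t x y) = m (addr β t x y)) : Row β m' t x l :=
  ⟨by rw [hm, h.1], fun k hk => by rw [hm, h.2]⟩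

/-- Append the contents of register `12` to the row of the array `t` given by register `11`. -/
def push (t : ℕ) : Prog := block
  [.assign 10 (.op .add (cellE t (.reg 11) (.const 0)) (.const 1)),
   .store (addrE t (.reg 11) (.reg 10)) (.reg 12),
   .store (addrE t (.reg 11) (.const 0)) (.reg 10)]

theorem push_ends {w X β t : ℕ} {s : State} (hX : Roomy w X) (hβ : β ≤ X) (ht : t < 8)
    (h0 : s.reg 0 = β) (hx : s.reg 11 ≤ 4 * X ^ 2 + X)
    (hc : s.mem (addr β t (s.reg 11) 0) < X) :
    Ends w (push t) s 60 fun s' =>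
      s' = ⟨Function.update s.reg 10 (s.mem (addr β t (s.reg 11) 0) + 1),
        pushMem β s.mem t (s.reg 11) (s.reg 12)⟩ := by
  refine Ends.block_assign (s.mem (addr β t (s.reg 11) 0) + 1)
    (eval_add (hX.eval_cellE hβ h0 ht rfl (eval_const (hX.lt (by omega))) hx (by omega))
      (eval_const (hX.lt (by have := hX.2; omega))) (hX.lt (by omega))) (b₂ := 36) ?_ (by simp [Expr.cost, cellE, addrE, pairE])
  refine Ends.block_store _ _ (hX.eval_addrE hβ (by simpa using h0) ht rfl rfl
    (by simpa [Expr.eval] using hx) (by simpa [Expr.eval] using hc)) rfl (b₂ := 18) ?_ (by simp [Expr.cost, addrE, pairE])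
  refine Ends.block_store _ _ (hX.eval_addrE hβ (by simpa using h0) ht rfl
    (eval_const (hX.lt (a := 0) (by omega)))
    (by simpa [Expr.eval] using hx) (by omega)) rfl (b₂ := 1) ?_ (by simp [Expr.cost, addrE, pairE])
  refine Ends.block_nil le_rfl ?_
  simp [pushMem, Expr.eval]

end WordRAM

namespace TreeCuts

/-! ### Cuts of trees -/

section
variable {V : Type*} {T : SimpleGraph V}

theorem mk_mem_boundary {S : Set V} {u v : V} :
    s(u, v) ∈ boundary T S ↔ T.Adj u v ∧ ¬ (u ∈ S ↔ v ∈ S) := by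
  constructor
  · rintro ⟨a, b, hab, ha, hb, he⟩
    rcases Sym2.eq_iff.1 he with ⟨rfl, rfl⟩ | ⟨rfl, rfl⟩
    · exact ⟨hab, by tauto⟩
    · exact ⟨hab.symm, by tauto⟩
  · rintro ⟨hab, h⟩
    by_cases hu : u ∈ S
    · exact ⟨u, v, hab, hu, by tauto, rfl⟩
    · exact ⟨v, u, hab.symm, by tauto, hu, Sym2.eq_swap⟩

/-- Every tree edge is a bridge. The side of `a` is its component after deletion of the edge; any
other edge survives the deletion and stays within one side. -/
theorem exists_boundary_eq_singleton (hT : T.IsTree) {e : Sym2 V} (he : e ∈ T.edgeSet) :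
    ∃ S : Set V, boundary T S = {e} := by
  induction e using Sym2.ind with
  | _ a b =>
    have hb := SimpleGraph.isAcyclic_iff_forall_adj_isBridge.1 hT.isAcyclic (by simpa using he)
    rw [SimpleGraph.isBridge_iff] at hb
    refine ⟨{x | (T \ SimpleGraph.fromEdgeSet {s(a, b)}).Reachable a x}, ?_⟩
    have hb' : ¬ (T \ SimpleGraph.fromEdgeSet {s(a, b)}).Reachable a b := by
      first | exact hb.2 | exact hb
    ext e
    induction e using Sym2.ind with
    | _ u v =>
      rw [mk_mem_boundary]
      constructor
      · rintro ⟨huv, h⟩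
        by_contra hne
        refine h ?_
        have hadj : (T \ SimpleGraph.fromEdgeSet {s(a, b)}).Adj u v := by
          rw [SimpleGraph.sdiff_adj]
          refine ⟨huv, fun h' => hne ?_⟩
          simpa using ((SimpleGraph.fromEdgeSet_adj _).1 h').1
        exact ⟨fun h1 => h1.trans hadj.reachable, fun h1 => h1.trans hadj.symm.reachable⟩
      · intro h
        have hab : T.Adj a b := by simpa using he
        have haa : (T \ SimpleGraph.fromEdgeSet {s(a, b)}).Reachable a a := SimpleGraph.Reachable.refl _
        rcases Sym2.eq_iff.1 h with ⟨rfl, rfl⟩ | ⟨rfl, rfl⟩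
        · exact ⟨hab, fun h2 => hb' (h2.1 haa)⟩
        · exact ⟨hab.symm, fun h2 => hb' (h2.2 haa)⟩

/-- Boundaries add modulo 2 under symmetric difference, and `e ≠ f` prevents cancellation. -/
theorem exists_boundary_eq_pair (hT : T.IsTree) {e f : Sym2 V} (he : e ∈ T.edgeSet)
    (hf : f ∈ T.edgeSet) (hef : e ≠ f) : ∃ S : Set V, boundary T S = {e, f} := by
  obtain ⟨A, hA⟩ := exists_boundary_eq_singleton hT he
  obtain ⟨B, hB⟩ := exists_boundary_eq_singleton hT hf
  refine ⟨{x | ¬ (x ∈ A ↔ x ∈ B)}, ?_⟩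
  ext d
  have h1 : d ∈ boundary T A ↔ d = e := by rw [hA]; rfl
  have h2 : d ∈ boundary T B ↔ d = f := by rw [hB]; rfl
  have h3 : d ∈ ({e, f} : Set (Sym2 V)) ↔ ¬ (d = e ↔ d = f) := by
    simp only [Set.mem_insert_iff, Set.mem_singleton_iff]
    constructor
    · rintro (rfl | rfl) <;> simp [hef, hef.symm]
    · tauto
  rw [h3, ← h1, ← h2]
  induction d using Sym2.ind with
  | _ u v =>
    have h4 : ∀ x, x ∈ {x | ¬ (x ∈ A ↔ x ∈ B)} ↔ ¬ (x ∈ A ↔ x ∈ B) := fun x => Iff.rfl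
    simp only [mk_mem_boundary, h4]
    by_cases T.Adj u v <;> by_cases u ∈ A <;> by_cases v ∈ A <;> by_cases u ∈ B <;>
      by_cases v ∈ B <;> simp [*]

/-- Along a walk, the steps that change sides are those over boundary edges. So sets with equal
boundaries agree up to complement, and the bipartition induced by a cut is unique. -/
theorem mem_iff_of_boundary_eq (hT : T.Connected) {S S' : Set V}
    (h : boundary T S = boundary T S') (u v : V) : (u ∈ S ↔ v ∈ S) ↔ (u ∈ S' ↔ v ∈ S') := by
  have key : ∀ {x y : V}, T.Walk x y → ((x ∈ S ↔ y ∈ S) ↔ (x ∈ S' ↔ y ∈ S')) := by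
    intro x y p
    induction p with
    | nil => simp
    | @cons x z y hxz _ ih =>
      have h1 : s(x, z) ∈ boundary T S ↔ s(x, z) ∈ boundary T S' := by rw [h]
      simp only [mk_mem_boundary, hxz, true_and] at h1
      tauto
  obtain ⟨p⟩ := hT.preconnected u v
  exact key p

/-- By uniqueness of the induced bipartition, one arbitrarily chosen side per cut suffices. The
index type is free so that it can be the positions in the input list. -/
theorem meet_rel (hT : T.IsTree) {C₁ : Finset (Sym2 V)} {C₂ : Finset (Sym2 (Sym2 V))} {ι : Type*}
    (F : ι → Set (Sym2 V)) (S : ι → Set V) (hS : ∀ i, boundary T (S i) = F i)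
    (hF : ∀ A, (∃ i, A = F i) ↔ (∃ e ∈ C₁, A = {e}) ∨ (∃ q ∈ C₂, A = {e | e ∈ q})) (u v : V) :
    meet T C₁ C₂ u v ↔ ∀ i, (u ∈ S i ↔ v ∈ S i) := by
  have hrel : ∀ (A : Set V), bipartition A u v ↔ (u ∈ A ↔ v ∈ A) := by
    intro A
    exact Setoid.ker_def.trans eq_iff_iff
  constructor
  · intro h i
    rw [← hrel]
    refine h _ ⟨S i, rfl, ?_⟩
    rw [hS i]
    exact (hF _).1 ⟨i, rfl⟩
  · rintro h r ⟨A, rfl, hA⟩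
    obtain ⟨i, hi⟩ := (hF (boundary T A)).2 hA
    exact (hrel A).2 ((mem_iff_of_boundary_eq hT.connected (hi.trans (hS i).symm) u v).2 (h i))

end

/-! ### Lists describing the tree and the cuts -/

section
variable {n : ℕ}

/-- The neighbours of `x` in the graph with the edges `E`. -/
def adjList (E : List (Fin n × Fin n)) (x : ℕ) : List ℕ :=
  E.flatMap fun p => (if x = (p.1 : ℕ) then [(p.2 : ℕ)] else []) ++
    (if x = (p.2 : ℕ) then [(p.1 : ℕ)] else [])

/-- The marks of the edge `{x, y}`, where `I` lists edges with marks. -/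
def markList (I : List ((Fin n × Fin n) × ℕ)) (x y : ℕ) : List ℕ :=
  I.flatMap fun p => (if x = (p.1.1 : ℕ) ∧ y = (p.1.2 : ℕ) then [p.2] else []) ++
    (if x = (p.1.2 : ℕ) ∧ y = (p.1.1 : ℕ) then [p.2] else [])

/-- The edges of the cuts in the list, marked with the consecutive numbers of the cuts. -/
def cutItems : ℕ → List (List (Fin n × Fin n)) → List ((Fin n × Fin n) × ℕ)
  | _, [] => []
  | j, F :: l => F.map (fun p => (p, j + 1)) ++ cutItems (j + 1) l

theorem mem_adjList {T : SimpleGraph (Fin n)} {E : List (Fin n × Fin n)}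
    (hE : Lists edgeOf E T.edgeSet) {x y : ℕ} :
    y ∈ adjList E x ↔ ∃ (hx : x < n) (hy : y < n), T.Adj ⟨x, hx⟩ ⟨y, hy⟩ := by
  have h2 := hE.2
  constructor
  · intro h
    obtain ⟨p, hp, hy⟩ := List.mem_flatMap.1 h
    clear h
    have hadj : T.Adj p.1 p.2 := (h2 (edgeOf p)).1 (List.mem_map_of_mem hp)
    rw [List.mem_append] at hy
    rcases hy with hy | hy
    · split_ifs at hy with hx
      · simp only [List.mem_singleton] at hy
        subst hx hy
        exact ⟨p.1.2, p.2.2, hadj⟩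
      · simp at hy
    · split_ifs at hy with hx
      · simp only [List.mem_singleton] at hy
        subst hx hy
        exact ⟨p.2.2, p.1.2, hadj.symm⟩
      · simp at hy
  · rintro ⟨hx, hy, h⟩
    obtain ⟨p, hp, he⟩ := List.mem_map.1 ((h2 s(⟨x, hx⟩, ⟨y, hy⟩)).2 h)
    refine List.mem_flatMap.2 ⟨p, hp, ?_⟩
    rcases Sym2.eq_iff.1 he with ⟨h3, h4⟩ | ⟨h3, h4⟩ <;> simp [h3, h4]

theorem length_markList_comm (I : List ((Fin n × Fin n) × ℕ)) (x y : ℕ) :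
    (markList I x y).length = (markList I y x).length := by
  induction I with
  | nil => rfl
  | cons p I ih =>
    simp only [markList, List.flatMap_cons, List.length_append] at ih ⊢
    rw [ih]
    have h1 : (y = (p.1.1 : ℕ) ∧ x = (p.1.2 : ℕ)) ↔ (x = (p.1.2 : ℕ) ∧ y = (p.1.1 : ℕ)) := and_comm
    have h2 : (y = (p.1.2 : ℕ) ∧ x = (p.1.1 : ℕ)) ↔ (x = (p.1.1 : ℕ) ∧ y = (p.1.2 : ℕ)) := and_comm
    simp only [h1, h2]
    omega

/-- An item could be counted twice only if both orientation tests succeed for it, and this would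
force `x = y`. -/
theorem count_markList (I : List ((Fin n × Fin n) × ℕ)) {x y : Fin n} (hxy : x ≠ y) (j : ℕ) :
    (markList I x y).count j = I.countP fun p => p.2 = j ∧ edgeOf p.1 = s(x, y) := by
  induction I with
  | nil => rfl
  | cons p I ih =>
    simp only [markList, List.flatMap_cons, List.count_append] at ih ⊢
    rw [ih, List.countP_cons, add_comm]
    congr 1
    have h1 : edgeOf p.1 = s(x, y) ↔ (x = p.1.1 ∧ y = p.1.2) ∨ (x = p.1.2 ∧ y = p.1.1) := by
      unfold edgeOf
      rw [Sym2.eq_iff]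
      constructor
      · rintro (⟨rfl, rfl⟩ | ⟨rfl, rfl⟩) <;> simp
      · rintro (⟨rfl, rfl⟩ | ⟨rfl, rfl⟩) <;> simp
    simp only [h1, Fin.val_inj]
    by_cases ha : x = p.1.1 ∧ y = p.1.2
    · have hb : ¬ (x = p.1.2 ∧ y = p.1.1) := by
        rintro ⟨h3, h4⟩
        exact hxy (ha.1.trans h4.symm)
      by_cases hj : p.2 = j <;> simp [ha, hj]
      all_goals
        rw [← ha.1, ← ha.2]
        simp [hxy, hxy.symm]
    · by_cases hb : x = p.1.2 ∧ y = p.1.1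
      · by_cases hj : p.2 = j <;> simp [hb, hj]
        all_goals
          rw [← hb.1, ← hb.2]
          simp [hxy, hxy.symm]
      · simp [ha, hb]

theorem mark_mem_cutItems {j : ℕ} {l : List (List (Fin n × Fin n))} {p : (Fin n × Fin n) × ℕ}
    (h : p ∈ cutItems j l) : j < p.2 ∧ p.2 ≤ j + l.length := by
  induction l generalizing j with
  | nil => simp [cutItems] at h
  | cons F l ih =>
    simp only [cutItems, List.mem_append, List.mem_map] at h
    rcases h with ⟨q, -, rfl⟩ | h
    · simp
    · have := ih h
      simp only [List.length_cons]
      omega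

/-- Marks are consecutive, one per cut, so all cuts other than the one at position `i` contribute
nothing. -/
theorem countP_cutItems (j i : ℕ) (l : List (List (Fin n × Fin n))) (hi : i < l.length)
    (e : Sym2 (Fin n)) :
    (cutItems j l).countP (fun p => p.2 = j + 1 + i ∧ edgeOf p.1 = e) =
      (l[i].map edgeOf).count e := by
  induction l generalizing j i with
  | nil => simp at hi
  | cons F l ih =>
    simp only [cutItems, List.countP_append]
    cases i with
    | zero =>
      have : (cutItems (j + 1) l).countP (fun p => p.2 = j + 1 + 0 ∧ edgeOf p.1 = e) = 0 := by
        rw [List.countP_eq_zero]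
        intro p hp
        have := mark_mem_cutItems hp
        simp
        omega
      rw [this]
      simp only [add_zero, List.count, List.countP_map, Function.comp_def, true_and, List.getElem_cons_zero]
      exact List.countP_congr fun x _ => by simp
    | succ i =>
      have : (F.map fun p => (p, j + 1)).countP (fun p => p.2 = j + 1 + (i + 1) ∧ edgeOf p.1 = e) = 0 := by
        rw [List.countP_eq_zero]
        intro p hp
        obtain ⟨q, -, rfl⟩ := List.mem_map.1 hp
        simp
      rw [this, zero_add]
      have h := ih (j + 1) i (by simpa using hi)
      simp only [List.getElem_cons_succ]
      rw [← h]
      congr 1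
      funext p
      have : j + 1 + (i + 1) = j + 1 + 1 + i := by omega
      rw [this]

/-- Each tree edge is listed once, so an item is charged to at most one entry of `E`. This is what
bounds the total number of bit flips. -/
theorem sum_markList_le {T : SimpleGraph (Fin n)} {E : List (Fin n × Fin n)}
    (hE : Lists edgeOf E T.edgeSet) (I : List ((Fin n × Fin n) × ℕ)) :
    (E.map fun p => (markList I p.1 p.2).length).sum ≤ I.length := by
  induction I with
  | nil => simp [markList]
  | cons q I ih =>
    have hle : (E.map fun p => if edgeOf p = edgeOf q.1 then 1 else 0).sum ≤ 1 := by
      have h1 : (E.map fun p => if edgeOf p = edgeOf q.1 then 1 else 0).sum =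
          (E.map edgeOf).count (edgeOf q.1) := by
        clear hE ih
        induction E with
        | nil => rfl
        | cons p E ih => 
          simp only [List.map_cons, List.sum_cons, ih, List.count_cons, beq_iff_eq]
          omega
      rw [h1]
      exact List.nodup_iff_count_le_one.1 hE.1 _
    have hs : (E.map fun p => (markList (q :: I) p.1 p.2).length).sum =
        (E.map fun p => if edgeOf p = edgeOf q.1 then 1 else 0).sum +
        (E.map fun p => (markList I p.1 p.2).length).sum := by
      rw [← List.sum_map_add]
      congr 1
      refine List.map_congr_left fun p hp => ?_
      simp only [markList, List.flatMap_cons, List.length_append]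
      congr 1
      have hne : p.1 ≠ p.2 := ((hE.2 (edgeOf p)).1 (List.mem_map_of_mem hp) : T.Adj p.1 p.2).ne
      have h1 : edgeOf p = edgeOf q.1 ↔ (p.1 = q.1.1 ∧ p.2 = q.1.2) ∨ (p.1 = q.1.2 ∧ p.2 = q.1.1) := by
        unfold edgeOf
        rw [Sym2.eq_iff]
      simp only [h1, Fin.val_inj]
      by_cases ha : p.1 = q.1.1 ∧ p.2 = q.1.2
      · have hb : ¬ (p.1 = q.1.2 ∧ p.2 = q.1.1) := by
          rintro ⟨h3, h4⟩
          exact hne (ha.1.trans h4.symm)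
        simp [ha]
        rintro h3 h4
        exact hb ⟨ha.1.trans h3, ha.2.trans h4⟩
      · by_cases hb : p.1 = q.1.2 ∧ p.2 = q.1.1 <;> simp [ha, hb]
        rintro h3 h4
        exact ha ⟨hb.1.trans h3, hb.2.trans h4⟩
    rw [hs, List.length_cons]
    omega

/-- The handshake argument: an edge appears in the neighbour lists of both its endpoints. -/
theorem sum_adjList (E : List (Fin n × Fin n)) (W : ℕ → ℕ → ℕ) :
    ∑ x ∈ Finset.range n, ((adjList E x).map (W x)).sum =
      (E.map fun p => W p.1 p.2 + W p.2 p.1).sum := by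
  induction E with
  | nil => simp [adjList]
  | cons p E ih =>
    simp only [adjList, List.flatMap_cons, List.map_append, List.sum_append, List.map_cons,
      List.sum_cons] at ih ⊢
    rw [Finset.sum_add_distrib, ih, Finset.sum_add_distrib]
    congr 1
    have h : ∀ a b : Fin n, ∑ x ∈ Finset.range n,
        ((if x = (a : ℕ) then [(b : ℕ)] else []).map (W x)).sum = W a b := by
      intro a b
      rw [Finset.sum_eq_single (a : ℕ)]
      · simp
      · intro c _ hc; simp [hc]
      · intro hc; exact absurd (Finset.mem_range.2 a.2) hc
    rw [h, h]

end

end TreeCuts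

namespace WordRAM

/-! ### Canonical names for vectors of bits -/

/-- The name of the inner node `k` of a heap-ordered binary tree is the name of the pair of the names
of its children; `0` names a tree all of whose names are `0`. -/
def Node (T : ℕ → ℕ → ℕ) (c : ℕ → ℕ) (k : ℕ) : Prop :=
  c k = T (c (2 * k)) (c (2 * k + 1)) ∧ (c k = 0 → c (2 * k) = 0 ∧ c (2 * k + 1) = 0)

/-- `T` is a partial injective naming of pairs by positive numbers up to `N`. -/
structure Table (T : ℕ → ℕ → ℕ) (N : ℕ) : Prop where
  zero : T 0 0 = 0
  le : ∀ p q, T p q ≤ N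
  inj : ∀ {p q p' q'}, T p q = T p' q' → T p q ≠ 0 → p = p' ∧ q = q'

/-- The names of `c` represent the vector `f` at the leaves `M, …, 2 * M - 1`. -/
structure Heap (T : ℕ → ℕ → ℕ) (M : ℕ) (c f : ℕ → ℕ) : Prop where
  node : ∀ k, 1 ≤ k → k < M → Node T c k
  leaf : ∀ j, j < M → c (M + j) = f j

/-- `T'` has all names of `T`. -/
def Extends (T T' : ℕ → ℕ → ℕ) : Prop := ∀ p q, T p q ≠ 0 → T' p q = T p q

theorem Extends.refl (T : ℕ → ℕ → ℕ) : Extends T T := fun _ _ _ => rfl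

theorem Extends.trans {T T' T'' : ℕ → ℕ → ℕ} (h : Extends T T') (h' : Extends T' T'') :
    Extends T T'' := fun p q hp => by
  rw [h' p q (by rwa [h p q hp]), h p q hp]

/-- `Extends` says nothing about pairs with entry 0; for a node named 0 both children are 0, and
every table gives 0 to the pair (0, 0). -/
theorem Node.mono {T T' : ℕ → ℕ → ℕ} {N k : ℕ} {c : ℕ → ℕ} (h : Node T c k) (hT : Extends T T')
    (hT' : Table T' N) : Node T' c k := by
  refine ⟨?_, h.2⟩
  by_cases h0 : c k = 0
  · rw [(h.2 h0).1, (h.2 h0).2, hT'.zero, h0]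
  · rw [hT _ _ (by rw [← h.1]; exact h0)]
    exact h.1

theorem Heap.mono {T T' : ℕ → ℕ → ℕ} {M N : ℕ} {c f : ℕ → ℕ} (h : Heap T M c f)
    (hT : Extends T T') (hT' : Table T' N) : Heap T' M c f :=
  ⟨fun k h1 h2 => (h.node k h1 h2).mono hT hT', h.leaf⟩

/-- From the root downwards, injectivity of the table turns equal names into equal names of the
children, and a zero name forces zero children. From the leaves upwards, a name is a function of the
names below it. Only nodes at the same position are ever compared, so `M` need not be a power of
two, and names of different levels may coincide. -/
theorem Heap.root_eq_iff {T : ℕ → ℕ → ℕ} {M N : ℕ} {c f c' f' : ℕ → ℕ} (hM : 1 ≤ M)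
    (hT : Table T N) (h : Heap T M c f) (h' : Heap T M c' f') :
    c 1 = c' 1 ↔ ∀ j, j < M → f j = f' j := by
  constructor
  · intro h1
    have key : ∀ k, 1 ≤ k → k < 2 * M → c k = c' k := by
      intro k
      induction k using Nat.strong_induction_on with
      | _ k ih =>
        intro hk hk'
        rcases Nat.lt_or_ge k 2 with hk2 | hk2
        · obtain rfl : k = 1 := by omega
          exact h1
        · have e := ih (k / 2) (by omega) (by omega) (by omega)
          have n1 := h.node (k / 2) (by omega) (by omega)
          have n2 := h'.node (k / 2) (by omega) (by omega)
          have both : c (2 * (k / 2)) = c' (2 * (k / 2)) ∧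
              c (2 * (k / 2) + 1) = c' (2 * (k / 2) + 1) := by
            by_cases h0 : c (k / 2) = 0
            · have a := n1.2 h0
              have b := n2.2 (e ▸ h0)
              exact ⟨a.1.trans b.1.symm, a.2.trans b.2.symm⟩
            · exact hT.inj (by rw [← n1.1, ← n2.1, e]) (by rw [← n1.1]; exact h0)
          rcases Nat.mod_two_eq_zero_or_one k with hm | hm
          · have : 2 * (k / 2) = k := by omega
            rw [this] at both
            exact both.1
          · have : 2 * (k / 2) + 1 = k := by omega
            rw [this] at both
            exact both.2
    intro j hj
    rw [← h.leaf j hj, ← h'.leaf j hj]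
    exact key _ (by omega) (by omega)
  · intro hf
    -- Induction on the distance to the last node, so that the children come before their parent.
    have key : ∀ d k, 1 ≤ k → k + d = 2 * M - 1 → c k = c' k := by
      intro d
      induction d using Nat.strong_induction_on with
      | _ d ih =>
        intro k hk hd
        rcases Nat.lt_or_ge k M with hkM | hkM
        · rw [(h.node k hk hkM).1, (h'.node k hk hkM).1,
            ih (2 * M - 1 - 2 * k) (by omega) (2 * k) (by omega) (by omega),
            ih (2 * M - 1 - (2 * k + 1)) (by omega) (2 * k + 1) (by omega) (by omega)]
        · obtain ⟨j, rfl⟩ := Nat.exists_eq_add_of_le hkM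
          rw [h.leaf j (by omega), h'.leaf j (by omega), hf j (by omega)]
    exact key (2 * M - 2) 1 le_rfl (by omega)

/-! ### Unchanged parts of configurations -/

/-- Between `s` and `s'` only registers in `rs` and array entries of the arrays in `ts` change. -/
structure Same (β : ℕ) (ts rs : List ℕ) (s s' : State) : Prop where
  reg : ∀ r, r ∉ rs → s'.reg r = s.reg r
  low : ∀ i, i < β → s'.mem i = s.mem i
  arr : ∀ t, t < 8 → t ∉ ts → ∀ x y, s'.mem (addr β t x y) = s.mem (addr β t x y)

section
variable {β : ℕ} {ts rs : List ℕ} {s s' s'' : State}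

theorem Same.refl : Same β ts rs s s := ⟨fun _ _ => rfl, fun _ _ => rfl, fun _ _ _ _ _ => rfl⟩

theorem Same.trans (h : Same β ts rs s s') (h' : Same β ts rs s' s'') : Same β ts rs s s'' :=
  ⟨fun r hr => (h'.reg r hr).trans (h.reg r hr), fun i hi => (h'.low i hi).trans (h.low i hi),
    fun t ht ht' x y => (h'.arr t ht ht' x y).trans (h.arr t ht ht' x y)⟩

theorem Same.assign (h : Same β ts rs s s') {r v : ℕ} (hr : r ∈ rs) :
    Same β ts rs s ⟨Function.update s'.reg r v, s'.mem⟩ := by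
  refine h.trans ⟨fun r' hr' => ?_, fun _ _ => rfl, fun _ _ _ _ _ => rfl⟩
  have : r' ≠ r := by rintro rfl; exact hr' hr
  simp [this]

theorem Same.store (h : Same β ts rs s s') {t x y v : ℕ} (ht8 : t < 8) (ht : t ∈ ts) :
    Same β ts rs s ⟨s'.reg, Function.update s'.mem (addr β t x y) v⟩ := by
  refine h.trans ⟨fun _ _ => rfl, fun i hi => ?_, fun t' ht' ht'' x y => ?_⟩
  · have : i ≠ addr β t x y := by have := le_addr β t x y; omega
    simp [this]
  · refine Function.update_of_ne ?_ _ _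
    rw [Ne, addr_inj ht' ht8]
    rintro ⟨rfl, -, -⟩
    exact ht'' ht

theorem Same.weaken {ts' rs' : List ℕ} (h : Same β ts rs s s') (ht : ts ⊆ ts') (hr : rs ⊆ rs') :
    Same β ts' rs' s s' :=
  ⟨fun r h1 => h.reg r fun h2 => h1 (hr h2), h.low, fun t h8 h1 => h.arr t h8 fun h2 => h1 (ht h2)⟩

theorem Same.row (h : Same β ts rs s s') {t x : ℕ} {l : List ℕ} (hl : Row β s.mem t x l)
    (h8 : t < 8) (ht : t ∉ ts) : Row β s'.mem t x l :=
  hl.congr fun y => h.arr t h8 ht x y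

end

theorem update_addr {β t x y t' x' y' v : ℕ} {m : ℕ → ℕ} (ht : t < 8) (ht' : t' < 8) :
    Function.update m (addr β t x y) v (addr β t' x' y') =
      if t' = t ∧ x' = x ∧ y' = y then v else m (addr β t' x' y') := by
  rw [Function.update_apply]
  simp only [addr_inj ht' ht]

/-! ### Flipping a bit -/

/-- The current names of the nodes. -/
def cur (β : ℕ) (m : ℕ → ℕ) (k : ℕ) : ℕ := m (addr β 3 k 0)

/-- The current table of names. -/
def tab (β : ℕ) (m : ℕ → ℕ) (p q : ℕ) : ℕ := m (addr β 4 p q)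

/-- Recompute the name of the parent of the node in register `8`. -/
def climbStep : Prog := block
  [.assign 8 (.op .div (.reg 8) (.const 2)),
   .assign 13 (cellE 3 (.op .mul (.const 2) (.reg 8)) (.const 0)),
   .assign 14 (cellE 3 (.op .add (.op .mul (.const 2) (.reg 8)) (.const 1)) (.const 0)),
   .cond (.op .lt (cellE 4 (.reg 13) (.reg 14))
       (.op .lt (.const 0) (.op .add (.reg 13) (.reg 14))))
     (block [.assign 9 (.op .add (.reg 9) (.const 1)),
       .store (addrE 4 (.reg 13) (.reg 14)) (.reg 9)]) .skip,
   .store (addrE 3 (.reg 8) (.const 0)) (cellE 4 (.reg 13) (.reg 14))]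

/-- The parts of the heap that are intact when only the parent of `i` may have a wrong name. -/
structure Climb (β M i : ℕ) (f : ℕ → ℕ) (s : State) : Prop where
  base : s.reg 0 = β
  idx : s.reg 8 = i
  table : Table (tab β s.mem) (s.reg 9)
  bound : ∀ k, cur β s.mem k ≤ s.reg 9 + 1
  node : ∀ k, 1 ≤ k → k < M → k ≠ i / 2 → Node (tab β s.mem) (cur β s.mem) k
  leaf : ∀ j, j < M → cur β s.mem (M + j) = f j

/-- Once the parent of `i` has been renamed, it agrees with its children, and the only node that may
disagree with its children is the grandparent. At most one new name is spent. -/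
theorem climbStep_ends {w X β M i : ℕ} {f : ℕ → ℕ} {s : State} (hX : Roomy w X) (hβ : β ≤ X)
    (h : Climb β M i f s) (hi : 1 < i) (hiM : i < 2 * M) (hM : 2 * M ≤ X) (hc : s.reg 9 + 2 ≤ X) :
    Ends w climbStep s 200 fun s' => Climb β M (i / 2) f s' ∧ s'.reg 9 ≤ s.reg 9 + 1 ∧
      Extends (tab β s.mem) (tab β s'.mem) ∧ Same β [3, 4] [8, 9, 13, 14] s s' := by
  have hc2 : 2 < 2 ^ w := hX.lt (by have := hX.2; omega)
  have hc1 : 1 < 2 ^ w := by omega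
  have hc0 : 0 < 2 ^ w := by omega
  have hX2 : X ≤ 4 * X ^ 2 + X := by omega
  obtain ⟨a, ha⟩ : ∃ a, i / 2 = a := ⟨_, rfl⟩
  have ha1 : 1 ≤ a := by omega
  have haM : a < M := by omega
  obtain ⟨p, hp⟩ : ∃ p, cur β s.mem (2 * a) = p := ⟨_, rfl⟩
  obtain ⟨q, hq⟩ : ∃ q, cur β s.mem (2 * a + 1) = q := ⟨_, rfl⟩
  have hpX : p ≤ X := by have := h.bound (2 * a); omega
  have hqX : q ≤ X := by have := h.bound (2 * a + 1); omega
  refine Ends.block_assign a ?_ (b₂ := 195) ?_ (by simp [Expr.cost])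
  · simp [Expr.eval, Op.eval, h.idx, Nat.mod_eq_of_lt hc2, ha]
  have e2 : ∀ m (g : ℕ → ℕ), g 8 = a → (Expr.op .mul (.const 2) (.reg 8)).eval w ⟨g, m⟩ = 2 * a :=
    fun m g hg => eval_mul (eval_const hc2) hg (hX.lt (by omega))
  refine Ends.block_assign p ?_ (b₂ := 165) ?_ (by simp [Expr.cost, cellE, addrE, pairE])
  · rw [hX.eval_cellE hβ (by simpa using h.base) (by omega) (e2 _ _ (by simp)) (eval_const hc0)
      (by omega) (by omega)]
    exact hp
  refine Ends.block_assign q ?_ (b₂ := 125) ?_ (by simp [Expr.cost, cellE, addrE, pairE])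
  · rw [hX.eval_cellE hβ (by simpa using h.base) (by omega)
      (eval_add (e2 _ _ (by simp)) (eval_const hc1) (hX.lt (by omega))) (eval_const hc0)
      (by omega) (by omega)]
    exact hq
  simp only
  set s₁ : State := ⟨Function.update (Function.update (Function.update s.reg 8 a) 13 p) 14 q, s.mem⟩
    with hs₁
  have hsame : Same β [3, 4] [8, 9, 13, 14] s s₁ := by
    have h0 : Same β [3, 4] [8, 9, 13, 14] s ⟨s.reg, s.mem⟩ := Same.refl
    exact ((h0.assign (by simp)).assign (by simp)).assign (by simp)
  have r0 : s₁.reg 0 = β := by simpa [hs₁] using h.base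
  have r8 : s₁.reg 8 = a := by simp [hs₁]
  have r9 : s₁.reg 9 = s.reg 9 := by simp [hs₁]
  have r13 : s₁.reg 13 = p := by simp [hs₁]
  have r14 : s₁.reg 14 = q := by simp [hs₁]
  have m1 : s₁.mem = s.mem := rfl
  clear_value s₁
  have hcell : (cellE 4 (.reg 13) (.reg 14)).eval w s₁ = tab β s.mem p q := by
    rw [hX.eval_cellE hβ r0 (by omega) (eval_reg r13) (eval_reg r14) (by omega) (by omega), m1]
    rfl
  -- The table entry is compared with the truth value of 0 < p + q. The test succeeds iff the entry
  -- is 0 and the pair is not (0, 0), so that (0, 0) keeps the name 0.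
  have hcond : (Expr.op .lt (cellE 4 (.reg 13) (.reg 14))
      (.op .lt (.const 0) (.op .add (.reg 13) (.reg 14)))).eval w s₁ =
      if tab β s.mem p q = 0 ∧ 0 < p + q then 1 else 0 := by
    rw [eval_lt hcell (eval_lt (eval_const hc0)
      (eval_add (eval_reg r13) (eval_reg r14) (hX.lt (by omega))))]
    by_cases hpq : 0 < p + q <;> by_cases ht : tab β s.mem p q = 0 <;> simp only [hpq, ht] <;> simp
    omega
  rw [ha]
  -- the state after the allocation of a name
  refine Ends.block_cons (b₁ := 65) (b₂ := 60) (Q := _) ?_ (by omega)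
  -- Shared by both branches of the conditional: in `s₂` the pair has just been named, or nothing
  -- needed to be done.
  have alloc : ∀ s₂ : State, s₂.reg 0 = β → s₂.reg 8 = a → s₂.reg 13 = p → s₂.reg 14 = q →
      Same β [3, 4] [8, 9, 13, 14] s s₂ → s.reg 9 ≤ s₂.reg 9 → s₂.reg 9 ≤ s.reg 9 + 1 →
      Table (tab β s₂.mem) (s₂.reg 9) → Extends (tab β s.mem) (tab β s₂.mem) →
      cur β s₂.mem = cur β s.mem →
      (tab β s₂.mem p q = 0 → p = 0 ∧ q = 0) → 
      Ends w (block [.store (addrE 3 (.reg 8) (.const 0)) (cellE 4 (.reg 13) (.reg 14))]) s₂ 60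
        fun s' => Climb β M a f s' ∧ s'.reg 9 ≤ s.reg 9 + 1 ∧
          Extends (tab β s.mem) (tab β s'.mem) ∧ Same β [3, 4] [8, 9, 13, 14] s s' := by
    intro s₂ r0 r8 r13 r14 hsame hle hle' htab hext hcur hz
    refine Ends.block_store _ _ (hX.eval_addrE hβ r0 (by omega) (eval_reg r8) (eval_const hc0) (by omega)
      (by omega)) (hX.eval_cellE hβ r0 (by omega) (eval_reg r13) (eval_reg r14) (by omega) (by omega)) (b₂ := 1) ?_
      (by simp [Expr.cost, cellE, addrE, pairE])
    refine Ends.block_nil le_rfl ?_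
    simp only
    have htab' : tab β (Function.update s₂.mem (addr β 3 a 0) (s₂.mem (addr β 4 p q))) =
        tab β s₂.mem := by
      funext x y
      simp [tab, update_addr]
    have hcur' : ∀ k, cur β (Function.update s₂.mem (addr β 3 a 0) (s₂.mem (addr β 4 p q))) k =
        if k = a then tab β s₂.mem p q else cur β s.mem k := by
      intro k
      rw [← hcur]
      simp [cur, tab, update_addr]
    refine ⟨⟨r0, r8, ?_, ?_, ?_, ?_⟩, hle', ?_, hsame.store (by omega) (by simp)⟩
    · rw [htab']; exact htab
    · intro k
      rw [hcur']
      simp only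
      split_ifs
      · have := htab.le p q; omega
      · have := h.bound k; omega
    · intro k hk hkM hka
      simp only
      rw [htab']
      unfold Node
      rw [hcur', hcur', hcur', if_neg (show ¬ 2 * k = a by omega),
        if_neg (show ¬ 2 * k + 1 = a by omega)]
      split_ifs with hk2
      · subst hk2
        rw [hp, hq]
        exact ⟨rfl, hz⟩
      · exact (h.node k hk hkM (by omega)).mono hext htab
    · intro j hj
      simp only
      rw [hcur', if_neg (by omega)]
      exact h.leaf j hj
    · rw [htab']; exact hext
  refine Ends.cond (c := 33) ?_ ?_ (by simp [Expr.cost, cellE, addrE, pairE])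
  · intro hne
    rw [hcond] at hne
    have hc' : tab β s.mem p q = 0 ∧ 0 < p + q := by
      by_contra hcon
      exact hne (if_neg hcon)
    refine Ends.block_assign (s.reg 9 + 1) (eval_add r9 (eval_const hc1) (hX.lt (by omega)))
      (b₂ := 29) ?_ (by simp [Expr.cost])
    refine Ends.block_store _ _ (hX.eval_addrE hβ (by simpa using r0) (by omega)
      (show _ = p by simp [Expr.eval, r13]) (show _ = q by simp [Expr.eval, r14]) (by omega)
      (by omega)) rfl (b₂ := 1) ?_ (by simp [Expr.cost, addrE, pairE])
    refine Ends.block_nil le_rfl ?_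
    simp only [m1]
    have htab' : ∀ x y, tab β (Function.update s.mem (addr β 4 p q) (s.reg 9 + 1)) x y =
        if x = p ∧ y = q then s.reg 9 + 1 else tab β s.mem x y := by
      intro x y
      simp [tab, update_addr]
    have ev9 : (Expr.reg 9).eval w ⟨Function.update s₁.reg 9 (s.reg 9 + 1), s.mem⟩ = s.reg 9 + 1 := by
      simp [Expr.eval]
    rw [ev9]
    refine alloc _ (by simpa using r0) (by simpa using r8) (by simpa using r13)
      (by simpa using r14) ?_ (by simp only [Function.update_self]; omega) (by simp only [Function.update_self]; omega) ?_ ?_ ?_ ?_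
    · have := (hsame.assign (r := 9) (v := s.reg 9 + 1) (by simp)).store (t := 4) (x := p) (y := q)
        (v := s.reg 9 + 1) (by omega) (by simp)
      simpa only [m1] using this
    · simp only [Function.update_self]
      refine ⟨?_, ?_, ?_⟩
      · rw [htab', if_neg (by omega)]; exact h.table.zero
      · intro x y
        rw [htab']
        have := h.table.le x y
        split_ifs <;> omega
      -- The counter bounds all earlier names, so the fresh number cannot collide with any of them.
      · intro x y x' y' hxy hne
        rw [htab', htab'] at hxy
        rw [htab'] at hne
        have b1 := h.table.le x y
        have b2 := h.table.le x' y'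
        split_ifs at hxy hne with c1 c2 c2
        · omega
        · omega
        · omega
        · exact h.table.inj hxy hne
    · intro x y hxy
      simp only
      rw [htab', if_neg]
      rintro ⟨rfl, rfl⟩
      exact hxy hc'.1
    · funext k
      simp [cur, update_addr]
    · simp [htab']
  · intro he
    rw [hcond] at he
    refine Ends.skip (by omega) ?_
    refine alloc s₁ r0 r8 r13 r14 hsame (by omega) (by omega) ?_ ?_ ?_ ?_
    · rw [m1, r9]; exact h.table
    · rw [m1]; exact Extends.refl _
    · rw [m1]
    · rw [m1]
      intro h0
      simp only [h0, true_and] at he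
      split_ifs at he
      omega

/-- The invariant exempts the node `i / 2`. On arrival at `i = 1` this is 0, so no node is exempt
any more. Per level, 200 units go to the step and 4 to the loop test. -/
theorem climb_ends {w X β M : ℕ} {f : ℕ → ℕ} (hX : Roomy w X) (hβ : β ≤ X) (hM : 2 * M ≤ X) (i : ℕ) :
    ∀ (s : State), Climb β M i f s → 1 ≤ i → i < 2 * M → s.reg 9 + Nat.log 2 i + 1 ≤ X →
    Ends w (.loop (.op .lt (.const 1) (.reg 8)) climbStep) s (204 * Nat.log 2 i + 4) fun s' =>
      Climb β M 1 f s' ∧ s'.reg 9 ≤ s.reg 9 + Nat.log 2 i ∧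
      Extends (tab β s.mem) (tab β s'.mem) ∧ Same β [3, 4] [8, 9, 13, 14] s s' := by
  induction i using Nat.strong_induction_on with
  | _ i ih =>
    intro s h hi hiM hc
    have hc1 : 1 % 2 ^ w = 1 := Nat.mod_eq_of_lt (hX.lt (by have := hX.2; omega))
    rcases Nat.lt_or_ge 1 i with hi1 | hi1
    · have hlog : Nat.log 2 i = Nat.log 2 (i / 2) + 1 := by
        rw [Nat.log_div_base]
        have := Nat.log_pos (b := 2) (n := i) (by omega) (by omega)
        omega
      refine Ends.loop_step (b₁ := 200) (b₂ := 204 * Nat.log 2 (i / 2) + 4) ?_ ?_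
        (by simp [Expr.cost]; omega)
      · simp [Expr.eval, Op.eval, h.idx, hi1, hc1]
      refine (climbStep_ends hX hβ h hi1 hiM hM (by omega)).mono le_rfl ?_
      rintro s₁ ⟨h1, h2, h3, h4⟩
      refine (ih (i / 2) (by omega) s₁ h1 (by omega) (by omega) (by omega)).mono le_rfl ?_
      rintro s₂ ⟨h5, h6, h7, h8⟩
      exact ⟨h5, by omega, h3.trans h7, h4.trans h8⟩
    · obtain rfl : i = 1 := by omega
      refine Ends.loop_done ?_ (by simp [Expr.cost]) ⟨h, by omega, Extends.refl _, Same.refl⟩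
      simp [Expr.eval, Op.eval, h.idx, hc1]

/-- Flip the bit at the leaf in register `8`. -/
def flip : Prog := block
  [.store (addrE 3 (.reg 8) (.const 0))
     (.op .sub (.const 1) (cellE 3 (.reg 8) (.const 0))),
   .loop (.op .lt (.const 1) (.reg 8)) climbStep]

/-- The heap with the names in memory is intact and represents `f`. -/
structure Intact (β M : ℕ) (f : ℕ → ℕ) (s : State) : Prop where
  base : s.reg 0 = β
  table : Table (tab β s.mem) (s.reg 9)
  bound : ∀ k, cur β s.mem k ≤ s.reg 9 + 1
  heap : Heap (tab β s.mem) M (cur β s.mem) f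

/-- A changed leaf affects only the names of its ancestors. The table merely grows, so labels
recorded before the flip keep their meaning. -/
theorem flip_ends {w X β M j : ℕ} {f : ℕ → ℕ} {s : State} (hX : Roomy w X) (hβ : β ≤ X)
    (hM : 2 * M ≤ X) (h : Intact β M f s) (hj : j < M) (h8 : s.reg 8 = M + j)
    (hc : s.reg 9 + Nat.log 2 (2 * M) + 1 ≤ X) :
    Ends w flip s (204 * Nat.log 2 (2 * M) + 50) fun s' =>
      Intact β M (Function.update f j (1 - f j)) s' ∧ s'.reg 9 ≤ s.reg 9 + Nat.log 2 (2 * M) ∧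
      Extends (tab β s.mem) (tab β s'.mem) ∧ Same β [3, 4] [8, 9, 13, 14] s s' := by
  have hc1 : 1 < 2 ^ w := hX.lt (by have := hX.2; omega)
  have hlog : Nat.log 2 (M + j) ≤ Nat.log 2 (2 * M) := Nat.log_mono_right (by omega)
  have hcell : (cellE 3 (.reg 8) (.const 0)).eval w s = f j := by
    rw [hX.eval_cellE hβ h.base (by omega) (eval_reg h8) (eval_const (by omega)) (by omega) (by omega)]
    exact h.heap.leaf j hj
  refine Ends.block_store _ (1 - f j) (hX.eval_addrE hβ h.base (by omega) (eval_reg h8) (eval_const (by omega))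
    (by omega) (by omega)) ?_ (b₂ := 204 * Nat.log 2 (2 * M) + 6) ?_
    (by simp [Expr.cost, cellE, addrE, pairE]; omega)
  · simp only [Expr.eval, Op.eval, Nat.mod_eq_of_lt hc1] at hcell ⊢
    rw [hcell]
  have htab : tab β (Function.update s.mem (addr β 3 (M + j) 0) (1 - f j)) = tab β s.mem := by
    funext x y
    simp [tab, update_addr]
  have hcur : ∀ k, cur β (Function.update s.mem (addr β 3 (M + j) 0) (1 - f j)) k =
      if k = M + j then 1 - f j else cur β s.mem k := by
    intro k
    simp [cur, update_addr]
  refine Ends.block_cons (b₁ := 204 * Nat.log 2 (2 * M) + 4) (b₂ := 1) ?_ (by omega)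
  refine (climb_ends (f := Function.update f j (1 - f j)) hX hβ hM (M + j)
    ⟨s.reg, Function.update s.mem (addr β 3 (M + j) 0) (1 - f j)⟩ ⟨h.base, h8, ?_, ?_, ?_, ?_⟩
    (by omega) (by omega) (show s.reg 9 + _ + 1 ≤ X by omega)).mono
    (b' := 204 * Nat.log 2 (2 * M) + 4) (by omega) ?_
  · simp only; rw [htab]; exact h.table
  -- A leaf may hold 1 while the counter of names is still 0; this is why the bound is the counter
  -- plus 1.
  · intro k
    simp only [hcur]
    split_ifs
    · omega
    · exact h.bound k
  · intro k hk hkM hne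
    simp only
    rw [htab]
    unfold Node
    rw [hcur, hcur, hcur, if_neg (by omega), if_neg (by omega), if_neg (by omega)]
    exact h.heap.node k hk hkM
  · intro k hk
    simp only [hcur, Function.update_apply]
    by_cases hkj : k = j
    · simp [hkj]
    · rw [if_neg (by omega), if_neg hkj]
      exact h.heap.leaf k hk
  · rintro s' ⟨h1, h2, h3, h4⟩
    refine Ends.block_nil le_rfl ⟨⟨h1.base, h1.table, h1.bound, fun k hk hkM =>
      h1.node k hk hkM (by omega), h1.leaf⟩, h2.trans (show s.reg 9 + _ ≤ _ by omega), ?_, ?_⟩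
    · simp only at h3
      rwa [htab] at h3
    · exact ((Same.refl (s := ⟨s.reg, s.mem⟩)).store (by omega) (by simp)).trans h4

/-! ### Walking through the tree -/

/-- Flip the bits of all cuts that contain the edge between the vertices in registers `5` and `6`. -/
def flipAll : Prog := block
  [.assign 7 (cellE 1 (pairE (.reg 5) (.reg 6)) (.const 0)),
   .loop (.reg 7) (block
     [.assign 8 (.op .add (.reg 2) (cellE 1 (pairE (.reg 5) (.reg 6)) (.reg 7))),
      flip,
      .assign 7 (.op .sub (.reg 7) (.const 1))])]

theorem Intact.congr {β M : ℕ} {f g : ℕ → ℕ} {s : State} (h : Intact β M f s)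
    (hfg : ∀ j, j < M → f j = g j) : Intact β M g s :=
  ⟨h.base, h.table, h.bound, h.heap.node, fun j hj => (h.heap.leaf j hj).trans (hfg j hj)⟩

theorem Intact.same {β M : ℕ} {f : ℕ → ℕ} {s s' : State} {ts rs : List ℕ} (h : Intact β M f s)
    (hs : Same β ts rs s s') (h3 : 3 ∉ ts) (h4 : 4 ∉ ts) (h0 : 0 ∉ rs) (h9 : 9 ∉ rs) :
    Intact β M f s' := by
  have e1 : tab β s'.mem = tab β s.mem := by
    funext x y
    exact hs.arr 4 (by omega) h4 x y
  have e2 : cur β s'.mem = cur β s.mem := by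
    funext x
    exact hs.arr 3 (by omega) h3 x 0
  refine ⟨(hs.reg 0 h0).trans h.base, ?_, ?_, ?_⟩
  · rw [e1, hs.reg 9 h9]; exact h.table
  · rw [e2, hs.reg 9 h9]; exact h.bound
  · rw [e1, e2]; exact h.heap

/-- The list is processed from its end, so the entries still to be flipped form the prefix `l.take
k`. Each flip adds 1 modulo 2 at its leaf. -/
theorem flipAll_loop_ends {w X β M u v : ℕ} {l : List ℕ} (hX : Roomy w X) (hβ : β ≤ X)
    (hM : 2 * M ≤ X) (hl : ∀ j ∈ l, j < M) (hu : u ≤ X) (hv : v ≤ X) (hlX : l.length ≤ X) (k : ℕ) :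
    ∀ (f : ℕ → ℕ) (s : State), (∀ j, f j ≤ 1) → Intact β M f s → Row β s.mem 1 (pr v u) l →
    s.reg 2 = M → s.reg 5 = v → s.reg 6 = u → s.reg 7 = k → k ≤ l.length →
    s.reg 9 + k * Nat.log 2 (2 * M) + 1 ≤ X →
    Ends w (.loop (.reg 7) (block
     [.assign 8 (.op .add (.reg 2) (cellE 1 (pairE (.reg 5) (.reg 6)) (.reg 7))),
      flip,
      .assign 7 (.op .sub (.reg 7) (.const 1))])) s (k * (204 * Nat.log 2 (2 * M) + 150) + 2) fun s' =>
      Intact β M (fun j => (f j + (l.take k).count j) % 2) s' ∧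
      s'.reg 9 ≤ s.reg 9 + k * Nat.log 2 (2 * M) ∧
      Extends (tab β s.mem) (tab β s'.mem) ∧ Same β [3, 4] [7, 8, 9, 13, 14] s s' := by
  have hc1 : 1 < 2 ^ w := hX.lt (by have := hX.2; omega)
  induction k with
  | zero =>
    intro f s hf hI _ _ _ _ h7 _ _
    refine Ends.loop_done h7 (by simp [Expr.cost]) ⟨hI.congr fun j _ => ?_, by omega,
      Extends.refl _, Same.refl⟩
    have := hf j
    simp only [List.take_zero, List.count_nil]
    omega
  | succ k ih =>
    intro f s hf hI hrow h2 h5 h6 h7 hk hc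
    have hk' : k < l.length := hk
    have hjM : l[k] < M := hl _ (List.getElem_mem _)
    have hmul : (k + 1) * Nat.log 2 (2 * M) = k * Nat.log 2 (2 * M) + Nat.log 2 (2 * M) := by ring
    have hmul' : (k + 1) * (204 * Nat.log 2 (2 * M) + 150) =
      k * (204 * Nat.log 2 (2 * M) + 150) + (204 * Nat.log 2 (2 * M) + 150) := by ring
    refine Ends.loop_step (b₁ := 204 * Nat.log 2 (2 * M) + 148)
      (b₂ := k * (204 * Nat.log 2 (2 * M) + 150) + 2) (by simp [Expr.eval, h7]) ?_
      (by simp [Expr.cost]; omega)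
    refine Ends.block_assign (M + l[k]) ?_ (b₂ := 204 * Nat.log 2 (2 * M) + 60) ?_
      (by simp [Expr.cost, cellE, addrE, pairE]; omega)
    · refine eval_add h2 ?_ (hX.lt (by omega))
      rw [hX.eval_cellE hβ hI.base (by omega) (hX.eval_pairE (eval_reg h5) (eval_reg h6) hv hu)
        (eval_reg h7) (pr_le hv hu) (by omega), hrow.2 k hk']
    have hs₁ : Same β [3, 4] [7, 8, 9, 13, 14] s ⟨Function.update s.reg 8 (M + l[k]), s.mem⟩ :=
      (Same.refl (s := ⟨s.reg, s.mem⟩)).assign (by simp)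
    have hI₁ : Intact β M f ⟨Function.update s.reg 8 (M + l[k]), s.mem⟩ :=
      hI.same (ts := []) (rs := [8]) ((Same.refl (s := ⟨s.reg, s.mem⟩)).assign (by simp))
        (by simp) (by simp) (by simp) (by simp)
    have h9₁ : Function.update s.reg 8 (M + l[k]) 9 = s.reg 9 := by simp
    refine Ends.block_cons ((flip_ends hX hβ hM hI₁ hjM (by simp) (by simp only [h9₁]; omega)).mono
      le_rfl ?_) (b₂ := 6) (by omega)
    rintro s₂ ⟨g1, g2, g3, g4⟩
    simp only [h9₁] at g2 g3
    have hs₂ := hs₁.trans (g4.weaken (ts' := [3, 4]) (rs' := [7, 8, 9, 13, 14]) (by simp) (by simp))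
    refine Ends.block_assign k ?_ (b₂ := 1) ?_ (by simp [Expr.cost])
    · have h7₂ : s₂.reg 7 = k + 1 := by rw [g4.reg 7 (by simp)]; simpa using h7
      rw [eval_sub (eval_reg h7₂) (eval_const hc1)]
      omega
    refine Ends.block_nil le_rfl ?_
    have hs₃ := hs₂.assign (r := 7) (v := k) (by simp)
    have hI₃ := g1.same (ts := []) (rs := [7])
      ((Same.refl (s := ⟨s₂.reg, s₂.mem⟩)).assign (r := 7) (v := k) (by simp))
      (by simp) (by simp) (by simp) (by simp)
    have h9₃ : Function.update s₂.reg 7 k 9 = s₂.reg 9 := by simp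
    refine (ih _ _ ?_ hI₃ (hs₃.row hrow (by omega) (by simp)) ((hs₃.reg 2 (by simp)).trans h2)
      ((hs₃.reg 5 (by simp)).trans h5) ((hs₃.reg 6 (by simp)).trans h6) (by simp) (by omega)
      (by simp only [h9₃]; omega)).mono le_rfl ?_
    · intro j
      have := hf j
      rw [Function.update_apply]
      split_ifs <;> omega
    rintro s₄ ⟨k1, k2, k3, k4⟩
    simp only [h9₃] at k2
    refine ⟨k1.congr fun j _ => ?_, by omega, g3.trans k3, hs₃.trans k4⟩
    rw [List.take_succ_eq_append_getElem hk', List.count_append, List.count_singleton,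
      Function.update_apply]
    have hfj := hf l[k]
    by_cases hj : j = l[k]
    · subst hj
      simp
      omega
    · have : ¬ l[k] = j := fun h => hj h.symm
      simp [hj, this]

theorem flipAll_ends {w X β M u v : ℕ} {l : List ℕ} {f : ℕ → ℕ} {s : State} (hX : Roomy w X)
    (hβ : β ≤ X) (hM : 2 * M ≤ X) (hl : ∀ j ∈ l, j < M) (hu : u ≤ X) (hv : v ≤ X)
    (hlX : l.length ≤ X) (hf : ∀ j, f j ≤ 1) (hI : Intact β M f s) (hrow : Row β s.mem 1 (pr v u) l)
    (h2 : s.reg 2 = M) (h5 : s.reg 5 = v) (h6 : s.reg 6 = u)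
    (hc : s.reg 9 + l.length * Nat.log 2 (2 * M) + 1 ≤ X) :
    Ends w flipAll s (l.length * (204 * Nat.log 2 (2 * M) + 150) + 60) fun s' =>
      Intact β M (fun j => (f j + l.count j) % 2) s' ∧
      s'.reg 9 ≤ s.reg 9 + l.length * Nat.log 2 (2 * M) ∧
      Extends (tab β s.mem) (tab β s'.mem) ∧ Same β [3, 4] [7, 8, 9, 13, 14] s s' := by
  refine Ends.block_assign l.length ?_
    (b₂ := l.length * (204 * Nat.log 2 (2 * M) + 150) + 3) ?_
    (by simp [Expr.cost, cellE, addrE, pairE]; omega)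
  · rw [hX.eval_cellE hβ hI.base (by omega) (hX.eval_pairE (eval_reg h5) (eval_reg h6) hv hu)
      (eval_const (hX.lt (a := 0) (by omega))) (pr_le hv hu) (by omega), hrow.1]
  have hs : Same β [3, 4] [7, 8, 9, 13, 14] s ⟨Function.update s.reg 7 l.length, s.mem⟩ :=
    (Same.refl (s := ⟨s.reg, s.mem⟩)).assign (by simp)
  have hI' := hI.same (ts := []) (rs := [7])
    ((Same.refl (s := ⟨s.reg, s.mem⟩)).assign (r := 7) (v := l.length) (by simp))
    (by simp) (by simp) (by simp) (by simp)
  have h9 : Function.update s.reg 7 l.length 9 = s.reg 9 := by simp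
  refine Ends.block_cons ((flipAll_loop_ends hX hβ hM hl hu hv hlX l.length f _ hf hI' hrow
    (by simpa using h2) (by simpa using h5) (by simpa using h6) (by simp) le_rfl
    (by simp only [h9]; omega)).mono le_rfl ?_) (b₂ := 1) (by omega)
  rintro s' ⟨g1, g2, g3, g4⟩
  refine Ends.block_nil le_rfl ⟨?_, by simpa only [h9] using g2, g3, hs.trans g4⟩
  simpa using g1

/-- Put into register `6` the next neighbour of the vertex in register `5` that has not been visited,
or the predecessor if there is no neighbour left; register `7` holds the number of neighbours left. -/
def choose : Prog := .cond (.reg 7)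
  (block
    [.assign 6 (cellE 0 (.reg 5) (.reg 7)),
     .store (addrE 0 (.reg 5) (.const 0)) (.op .sub (.reg 7) (.const 1)),
     .cond (cellE 2 (.reg 6) (.const 0)) (.assign 6 (.reg 5))
       (.store (addrE 2 (.reg 6) (.const 0)) (.op .add (.reg 5) (.const 1)))])
  (.assign 6 (.op .sub (cellE 2 (.reg 5) (.const 0)) (.const 1)))

/-- One step of the walk. -/
def walkStep : Prog := block
  [.assign 7 (cellE 0 (.reg 5) (.const 0)),
   choose,
   flipAll,
   .assign 5 (.reg 6),
   .store (addrE 5 (.reg 5) (.const 0)) (cellE 3 (.const 1) (.const 0))]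

/-- The walk through the tree from the vertex `0`. -/
def walk : Prog := block
  [.assign 5 (.const 0),
   .store (addrE 2 (.const 0) (.const 0)) (.const 1),
   .loop (.op .add (cellE 0 (.reg 5) (.const 0)) (.reg 5)) walkStep]

/-- A tree with neighbour lists `adj`, lists `mark x y` of bits that differ between the vectors `bit x`
and `bit y` of neighbours `x` and `y`. -/
structure MarkedTree (n M : ℕ) (adj : ℕ → List ℕ) (mark : ℕ → ℕ → List ℕ) (bit : ℕ → ℕ → ℕ) :
    Prop where
  lt : ∀ {x y}, y ∈ adj x → x < n ∧ y < n
  ne : ∀ {x y}, y ∈ adj x → x ≠ y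
  symm : ∀ {x y}, y ∈ adj x → x ∈ adj y
  mark_self : ∀ x, mark x x = []
  mark_lt : ∀ x y, ∀ j ∈ mark x y, j < M
  mark_symm : ∀ x y, (mark x y).length = (mark y x).length
  bit_le : ∀ x j, bit x j ≤ 1
  bit_zero : ∀ j, bit 0 j = 0
  step : ∀ {x y}, y ∈ adj x → ∀ j, j < M → bit y j = (bit x j + (mark x y).count j) % 2

/-- The path from the current vertex back to `0` along the parents. -/
def Path (par : ℕ → ℕ) (adj : ℕ → List ℕ) : List ℕ → Prop
  | [] => False
  | [a] => a = 0 ∧ par 0 = 1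
  | a :: b :: l => par a = b + 1 ∧ b ∈ adj a ∧ Path par adj (b :: l)

/-- The predecessors in the walk. -/
def par (β : ℕ) (m : ℕ → ℕ) (x : ℕ) : ℕ := m (addr β 2 x 0)

/-- The memory during the walk: `rem` are the neighbours still to be considered, `st` is the path to
the current vertex, and the labels of the visited vertices in `L` are known. -/
structure Tour (β n M : ℕ) (adj : ℕ → List ℕ) (mark : ℕ → ℕ → List ℕ) (bit : ℕ → ℕ → ℕ)
    (rem : ℕ → List ℕ) (st : List ℕ) (L : ℕ → Prop) (s : State) : Prop where
  regM : s.reg 2 = M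
  rows : ∀ x, x < n → Row β s.mem 0 x (rem x)
  marks : ∀ x y, x < n → y < n → Row β s.mem 1 (pr x y) (mark x y)
  sub : ∀ x, x < n → ∀ y ∈ rem x, y ∈ adj x
  seen : ∀ x, x < n → ∀ y ∈ adj x, y ∈ rem x ∨ (par β s.mem x ≠ 0 ∧ par β s.mem y ≠ 0)
  path : Path (par β s.mem) adj st
  lt : ∀ x ∈ st, x < n
  onpath : ∀ x, x < n → par β s.mem x ≠ 0 → x ∈ st ∨ rem x = []
  labels : ∀ x, x < n → par β s.mem x ≠ 0 → L x →
    ∃ c, Heap (tab β s.mem) M c (bit x) ∧ s.mem (addr β 5 x 0) = c 1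

theorem Path.par_ne_zero {p : ℕ → ℕ} {adj : ℕ → List ℕ} {st : List ℕ} (h : Path p adj st) :
    ∀ x ∈ st, p x ≠ 0 := by
  induction st with
  | nil => simp
  | cons a l ih =>
    cases l with
    | nil =>
      obtain ⟨rfl, h1⟩ := h
      simp [h1]
    | cons b l =>
      obtain ⟨h1, -, h2⟩ := h
      intro x hx
      rcases List.mem_cons.1 hx with rfl | hx
      · omega
      · exact ih h2 x hx

theorem Path.congr {p p' : ℕ → ℕ} {adj : ℕ → List ℕ} {st : List ℕ} (h : Path p adj st)
    (hp : ∀ x ∈ st, p' x = p x) : Path p' adj st := by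
  induction st with
  | nil => exact h
  | cons a l ih =>
    cases l with
    | nil =>
      obtain ⟨rfl, h1⟩ := h
      exact ⟨rfl, by rw [hp 0 (by simp), h1]⟩
    | cons b l =>
      obtain ⟨h1, h3, h2⟩ := h
      exact ⟨by rw [hp a (by simp), h1], h3, ih h2 fun x hx => hp x (List.mem_cons_of_mem _ hx)⟩

/-- Flipping touches only the current names and the table. Recorded labels survive because each
comes with its own heap over the table, and that heap stays valid when the table grows. -/
theorem Tour.same {β n M N : ℕ} {adj : ℕ → List ℕ} {mark : ℕ → ℕ → List ℕ} {bit : ℕ → ℕ → ℕ}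
    {rem : ℕ → List ℕ} {st : List ℕ} {L : ℕ → Prop} {s s' : State}
    (h : Tour β n M adj mark bit rem st L s) {rs : List ℕ} (hs : Same β [3, 4] rs s s')
    (h2 : 2 ∉ rs) (ht : Extends (tab β s.mem) (tab β s'.mem)) (hN : Table (tab β s'.mem) N) :
    Tour β n M adj mark bit rem st L s' := by
  have hp : par β s'.mem = par β s.mem := by
    funext x
    exact hs.arr 2 (by omega) (by simp) x 0
  refine ⟨(hs.reg 2 h2).trans h.regM, fun x hx => hs.row (h.rows x hx) (by omega) (by simp),
    fun x y hx hy => hs.row (h.marks x y hx hy) (by omega) (by simp), h.sub, ?_, ?_, h.lt, ?_, ?_⟩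
  · rw [hp]; exact h.seen
  · rw [hp]; exact h.path
  · rw [hp]; exact h.onpath
  · rw [hp]
    intro x hx hx' hL
    obtain ⟨c, hc, hc'⟩ := h.labels x hx hx' hL
    exact ⟨c, hc.mono ht hN, (hs.arr 5 (by omega) (by simp) x 0).trans hc'⟩

/-- The second half of a step: go from `v` to `u`. -/
theorem move_ends {w X β n M u v : ℕ} {adj : ℕ → List ℕ} {mark : ℕ → ℕ → List ℕ}
    {bit : ℕ → ℕ → ℕ} {rem : ℕ → List ℕ} {st : List ℕ} {s : State} (hX : Roomy w X) (hβ : β ≤ X)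
    (hM : 2 * M ≤ X) (hM1 : 1 ≤ M) (hn : n ≤ X) (hT : MarkedTree n M adj mark bit)
    (h : Tour β n M adj mark bit rem st (· ≠ u) s) (hI : Intact β M (bit v) s) (hu : u < n)
    (hv : v < n) (h5 : s.reg 5 = v) (h6 : s.reg 6 = u)
    (hvu : ∀ j, j < M → bit u j = (bit v j + (mark v u).count j) % 2)
    (hl : (mark v u).length ≤ X)
    (hc : s.reg 9 + (mark v u).length * Nat.log 2 (2 * M) + 1 ≤ X) :
    Ends w (block [flipAll, .assign 5 (.reg 6),
        .store (addrE 5 (.reg 5) (.const 0)) (cellE 3 (.const 1) (.const 0))]) s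
      ((mark v u).length * (204 * Nat.log 2 (2 * M) + 150) + 120) fun s' =>
      Tour β n M adj mark bit rem st (fun _ => True) s' ∧ Intact β M (bit u) s' ∧ s'.reg 5 = u ∧
      s'.reg 9 ≤ s.reg 9 + (mark v u).length * Nat.log 2 (2 * M) ∧
      Same β [0, 2, 3, 4, 5] [5, 6, 7, 8, 9, 13, 14] s s' := by
  have hc1 : 1 < 2 ^ w := hX.lt (by have := hX.2; omega)
  refine Ends.block_cons ((flipAll_ends hX hβ hM (hT.mark_lt v u) (by omega) (by omega) hl
    (hT.bit_le v) hI (h.marks v u hv hu) h.regM h5 h6 hc).mono le_rfl ?_) (b₂ := 60) (by omega)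
  rintro s₁ ⟨g1, g2, g3, g4⟩
  have h6₁ : s₁.reg 6 = u := (g4.reg 6 (by simp)).trans h6
  have hT₁ := h.same g4 (by simp) g3 g1.table
  refine Ends.block_assign u h6₁ (b₂ := 57) ?_ (by simp [Expr.cost])
  refine Ends.block_store _ _ (hX.eval_addrE hβ (by simpa using g1.base) (by omega)
    (show _ = u by simp [Expr.eval]) (eval_const (hX.lt (a := 0) (by omega))) (by omega) (by omega))
    (hX.eval_cellE hβ (by simpa using g1.base) (by omega) (eval_const hc1)
      (eval_const (hX.lt (a := 0) (by omega))) (by omega) (by omega)) (b₂ := 1) ?_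
    (by simp [Expr.cost, cellE, addrE, pairE])
  refine Ends.block_nil le_rfl ?_
  simp only
  have hs : Same β [5] [5] s₁ ⟨Function.update s₁.reg 5 u,
      Function.update s₁.mem (addr β 5 u 0) (s₁.mem (addr β 3 1 0))⟩ :=
    ((Same.refl (s := ⟨s₁.reg, s₁.mem⟩)).assign (r := 5) (v := u) (by simp)).store (by omega) (by simp)
  have htab : ∀ v, tab β (Function.update s₁.mem (addr β 5 u 0) v) = tab β s₁.mem := by
    intro v; funext x y; simp [tab, update_addr]
  have hpar : ∀ v, par β (Function.update s₁.mem (addr β 5 u 0) v) = par β s₁.mem := by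
    intro v; funext x; simp [par, update_addr]
  refine ⟨⟨(hs.reg 2 (by simp)).trans hT₁.regM, fun x hx => hs.row (hT₁.rows x hx) (by omega) (by simp),
    fun x y hx hy => hs.row (hT₁.marks x y hx hy) (by omega) (by simp), hT₁.sub, ?_, ?_, hT₁.lt, ?_, ?_⟩,
    (g1.congr fun j hj => (hvu j hj).symm).same hs (by simp) (by simp) (by simp) (by simp), by simp,
    by simpa using g2, (g4.weaken (by simp) (by simp)).trans (hs.weaken (by simp) (by simp))⟩
  · simp only [hpar]; exact hT₁.seen
  · simp only [hpar]; exact hT₁.path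
  · simp only [hpar]; exact hT₁.onpath
  · simp only [hpar, htab]
    intro x hx hx' _
    by_cases hxu : x = u
    · subst hxu
      refine ⟨_, (g1.congr fun j hj => (hvu j hj).symm).heap, ?_⟩
      simp [cur]
    · obtain ⟨c, hc, hc'⟩ := hT₁.labels x hx hx' hxu
      refine ⟨c, hc, ?_⟩
      simpa [update_addr, hxu] using hc'

/-! ### Amortised cost of the walk -/

/-- The cost of the way back along a path, where `W x y` pays for a move between `x` and `y`. -/
def pathPot (W : ℕ → ℕ → ℕ) : List ℕ → ℕ
  | [] => 0
  | [_] => 0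
  | a :: b :: l => W a b + pathPot W (b :: l)

/-- The potential of an unfinished walk: the way back and all moves to the remaining neighbours. -/
def pot (n : ℕ) (W : ℕ → ℕ → ℕ) (rem : ℕ → List ℕ) (st : List ℕ) : ℕ :=
  ∑ x ∈ Finset.range n, ((rem x).map fun y => 2 * W x y).sum + pathPot W st

/-- The cost of a step between `x` and `y`. -/
def stepCost (M : ℕ) (mark : ℕ → ℕ → List ℕ) (x y : ℕ) : ℕ :=
  400 + (mark x y).length * (204 * Nat.log 2 (2 * M) + 150)

theorem sum_update_rem {n v u : ℕ} {W : ℕ → ℕ → ℕ} {rem : ℕ → List ℕ} {l : List ℕ} (hv : v < n)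
    (h : rem v = l ++ [u]) :
    ∑ x ∈ Finset.range n, ((rem x).map fun y => 2 * W x y).sum =
      ∑ x ∈ Finset.range n, ((Function.update rem v l x).map fun y => 2 * W x y).sum +
        2 * W v u := by
  have hv' : v ∈ Finset.range n := Finset.mem_range.2 hv
  rw [← Finset.add_sum_erase _ _ hv', ← Finset.add_sum_erase (f := fun x =>
    ((Function.update rem v l x).map fun y => 2 * W x y).sum) _ hv']
  have : ∑ x ∈ (Finset.range n).erase v, ((Function.update rem v l x).map fun y => 2 * W x y).sum =
      ∑ x ∈ (Finset.range n).erase v, ((rem x).map fun y => 2 * W x y).sum := by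
    refine Finset.sum_congr rfl fun x hx => ?_
    rw [Function.update_of_ne (Finset.ne_of_mem_erase hx)]
  rw [this, h]
  simp
  omega

/-- Each remaining neighbour is paid for by the potential, so a bound on the budget also keeps the
list lengths in the addressable range. -/
theorem length_le_pot {n v : ℕ} {W : ℕ → ℕ → ℕ} (hW : ∀ x y, 1 ≤ W x y) {rem : ℕ → List ℕ}
    {st : List ℕ} (hv : v < n) : (rem v).length ≤ pot n W rem st := by
  have h1 : ((rem v).map fun y => 2 * W v y).sum ≤
      ∑ x ∈ Finset.range n, ((rem x).map fun y => 2 * W x y).sum :=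
    Finset.single_le_sum (f := fun x => ((rem x).map fun y => 2 * W x y).sum)
      (fun _ _ => Nat.zero_le _) (Finset.mem_range.2 hv)
  have h2 : ∀ l : List ℕ, l.length ≤ (l.map fun y => 2 * W v y).sum := by
    intro l
    induction l with
    | nil => simp
    | cons a l ih =>
      have := hW v a
      simp only [List.length_cons, List.map_cons, List.sum_cons]
      omega
  have := h2 (rem v)
  unfold pot
  omega

theorem Row.pop {β t x u : ℕ} {m : ℕ → ℕ} {l : List ℕ} (h : Row β m t x (l ++ [u])) (ht : t < 8) :
    Row β (Function.update m (addr β t x 0) l.length) t x l := by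
  refine ⟨by simp, fun k hk => ?_⟩
  rw [Function.update_of_ne, h.2 k (by simp; omega), List.getElem_append_left hk]
  rw [Ne, addr_inj ht ht]
  omega

/-- A remaining neighbour carries twice the price of its edge. If it is new, one half pays for the
move and the other becomes the price of the way back in `pathPot`. If it is already visited, the
walk stands still and the basic 400 units suffice. A return is paid for by `pathPot`. The label of
the target is exempt, since it is only written after the flips. -/
theorem choose_ends {w X β n M v : ℕ} {adj : ℕ → List ℕ} {mark : ℕ → ℕ → List ℕ}
    {bit : ℕ → ℕ → ℕ} {rem : ℕ → List ℕ} {tl : List ℕ} {s : State} (hX : Roomy w X) (hβ : β ≤ X)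
    (hn : n ≤ X) (hT : MarkedTree n M adj mark bit)
    (h : Tour β n M adj mark bit rem (v :: tl) (fun _ => True) s) (hI : Intact β M (bit v) s)
    (h5 : s.reg 5 = v) (h7 : s.reg 7 = (rem v).length) (hrem : (rem v).length ≤ X)
    (hgo : (rem v).length + v ≠ 0) :
    Ends w choose s 150 fun s' => ∃ rem' u tl',
      Tour β n M adj mark bit rem' (u :: tl') (· ≠ u) s' ∧ Intact β M (bit v) s' ∧
      s'.reg 5 = v ∧ s'.reg 6 = u ∧ s'.reg 9 = s.reg 9 ∧
      (∀ j, j < M → bit u j = (bit v j + (mark v u).count j) % 2) ∧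
      pot n (stepCost M mark) rem' (u :: tl') + stepCost M mark v u ≤
        pot n (stepCost M mark) rem (v :: tl) ∧ Same β [0, 2] [6] s s' := by
  have hc1 : 1 < 2 ^ w := hX.lt (by have := hX.2; omega)
  have hc0 : 0 < 2 ^ w := by omega
  have hv : v < n := h.lt v (by simp)
  have hcv : (cellE 0 (.reg 5) (.reg 7)).eval w s = s.mem (addr β 0 v (rem v).length) :=
    hX.eval_cellE hβ hI.base (by omega) (eval_reg h5) (eval_reg h7) (by omega) (by omega)
  rcases List.eq_nil_or_concat' (rem v) with hnil | ⟨l, u, hlu⟩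
  · -- back to the parent
    obtain ⟨p, tl', rfl⟩ : ∃ p tl', tl = p :: tl' := by
      cases tl with
      | nil =>
        have := h.path.1
        rw [hnil] at hgo
        simp [this] at hgo
      | cons p tl' => exact ⟨p, tl', rfl⟩
    obtain ⟨hp, hadj, hpath⟩ := h.path
    refine Ends.cond (c := 100) (fun hne => absurd (h7.trans (by simp [hnil])) hne) (fun _ => ?_)
      (by simp [Expr.cost])
    refine Ends.assign (v := p) ?_ (by simp [Expr.cost, cellE, addrE, pairE]) ?_
    · rw [eval_sub (hX.eval_cellE hβ hI.base (by omega) (eval_reg h5) (eval_const hc0) (by omega)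
        (by omega)) (eval_const hc1)]
      change par β s.mem v - 1 = p
      omega
    have hs : Same β [] [6] s ⟨Function.update s.reg 6 p, s.mem⟩ :=
      (Same.refl (s := ⟨s.reg, s.mem⟩)).assign (by simp)
    refine ⟨rem, p, tl', ⟨(hs.reg 2 (by simp)).trans h.regM, h.rows, h.marks, h.sub, h.seen, hpath,
      fun x hx => h.lt x (List.mem_cons_of_mem _ hx), ?_, fun x hx hx' _ => h.labels x hx hx' trivial⟩,
      hI.same hs (by simp) (by simp) (by simp) (by simp), by simpa using h5, by simp, by simp,
      hT.step hadj, ?_, hs.weaken (by simp) (by simp)⟩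
    · intro x hx hx'
      rcases h.onpath x hx hx' with hx'' | hx''
      · rcases List.mem_cons.1 hx'' with rfl | hx''
        · exact Or.inr hnil
        · exact Or.inl hx''
      · exact Or.inr hx''
    · simp only [pot, pathPot]
      omega
  · have hlen : (rem v).length = l.length + 1 := by simp [hlu]
    have hrow := h.rows v hv
    have hu_mem : u ∈ rem v := by simp [hlu]
    have hadj : u ∈ adj v := h.sub v hv u hu_mem
    have hu : u < n := (hT.lt hadj).2
    have hum : s.mem (addr β 0 v (rem v).length) = u := by
      have := hrow.2 l.length (by omega)
      rw [hlen, this]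
      simp [hlu]
    have hparv : par β s.mem v ≠ 0 := h.path.par_ne_zero v (by simp)
    refine Ends.cond (c := 145) (fun _ => ?_) (fun he => absurd h7 (by
      have : s.reg 7 = 0 := he
      omega)) (by simp [Expr.cost])
    refine Ends.block_assign u (hcv.trans hum) (b₂ := 120) ?_ (by simp [Expr.cost, cellE, addrE, pairE])
    refine Ends.block_store (addr β 0 v 0) l.length (hX.eval_addrE hβ (by simpa using hI.base) (by omega)
      (eval_reg (by simpa using h5)) (eval_const hc0) (by omega) (by omega)) ?_ (b₂ := 90) ?_
      (by simp [Expr.cost, addrE, pairE])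
    · rw [eval_sub (eval_reg (a := l.length + 1) (by simpa using h7.trans hlen)) (eval_const hc1)]
      omega
    simp only
    set s₁ : State := ⟨Function.update s.reg 6 u, Function.update s.mem (addr β 0 v 0) l.length⟩
      with hs₁
    have hs : Same β [0] [6] s s₁ :=
      ((Same.refl (s := ⟨s.reg, s.mem⟩)).assign (r := 6) (v := u) (by simp)).store (by omega) (by simp)
    have hI₁ : Intact β M (bit v) s₁ := hI.same hs (by simp) (by simp) (by simp) (by simp)
    have h5₁ : s₁.reg 5 = v := (hs.reg 5 (by simp)).trans h5
    have h6₁ : s₁.reg 6 = u := by simp [hs₁]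
    have hpar₁ : par β s₁.mem = par β s.mem := by
      funext x
      exact hs.arr 2 (by omega) (by simp) x 0
    have htab₁ : tab β s₁.mem = tab β s.mem := by
      funext x y
      exact hs.arr 4 (by omega) (by simp) x y
    have hrows₁ : ∀ x, x < n → Row β s₁.mem 0 x (Function.update rem v l x) := by
      intro x hx
      by_cases hxv : x = v
      · subst hxv
        rw [Function.update_self]
        exact Row.pop (hlu ▸ hrow) (by omega)
      · rw [Function.update_of_ne hxv]
        refine (h.rows x hx).congr fun y => ?_
        simp [hs₁, update_addr, hxv]
    have hsub₁ : ∀ x, x < n → ∀ y ∈ Function.update rem v l x, y ∈ adj x := by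
      intro x hx y hy
      by_cases hxv : x = v
      · subst hxv
        rw [Function.update_self] at hy
        exact h.sub x hx y (by simp [hlu, hy])
      · rw [Function.update_of_ne hxv] at hy
        exact h.sub x hx y hy
    have hseen₁ : ∀ x, x < n → ∀ y ∈ adj x, y ∈ Function.update rem v l x ∨ (x = v ∧ y = u) ∨
        (par β s.mem x ≠ 0 ∧ par β s.mem y ≠ 0) := by
      intro x hx y hy
      rcases h.seen x hx y hy with h1 | h1
      · by_cases hxv : x = v
        · subst hxv
          rw [hlu, List.mem_append, List.mem_singleton] at h1
          rw [Function.update_self]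
          tauto
        · rw [Function.update_of_ne hxv]
          exact Or.inl h1
      · exact Or.inr (Or.inr h1)
    have hsum := sum_update_rem (W := stepCost M mark) hv hlu
    have hvis : (cellE 2 (.reg 6) (.const 0)).eval w s₁ = par β s.mem u := by
      rw [hX.eval_cellE hβ hI₁.base (by omega) (eval_reg h6₁) (eval_const hc0) (by omega)
        (by omega), ← hpar₁]
      rfl
    have hmarks₁ : ∀ x y, x < n → y < n → Row β s₁.mem 1 (pr x y) (mark x y) :=
      fun x y hx hy => hs.row (h.marks x y hx hy) (by omega) (by simp)
    have hlab₁ : ∀ x, s₁.mem (addr β 5 x 0) = s.mem (addr β 5 x 0) :=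
      fun x => hs.arr 5 (by omega) (by simp) x 0
    have h2₁ : s₁.reg 2 = M := (hs.reg 2 (by simp)).trans h.regM
    have h9₁ : s₁.reg 9 = s.reg 9 := hs.reg 9 (by simp)
    clear_value s₁
    refine Ends.block_cons (b₁ := 80) (b₂ := 1) (Q := _) ?_ (by omega)
    refine Ends.cond (c := 50) (fun hne => ?_) (fun he => ?_)
      (by simp [Expr.cost, cellE, addrE, pairE])
    · -- the neighbour is known
      rw [hvis] at hne
      refine Ends.assign h5₁ (by simp [Expr.cost]) (Ends.block_nil le_rfl ?_)
      have hs₂ : Same β [] [6] s₁ ⟨Function.update s₁.reg 6 v, s₁.mem⟩ :=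
        (Same.refl (s := ⟨s₁.reg, s₁.mem⟩)).assign (by simp)
      refine ⟨Function.update rem v l, v, tl, ⟨(hs₂.reg 2 (by simp)).trans h2₁, hrows₁, hmarks₁,
        hsub₁, ?_, ?_, h.lt, ?_, ?_⟩, hI₁.same hs₂ (by simp) (by simp) (by simp) (by simp),
        by simpa using h5₁, by simp, by simpa using h9₁, ?_, ?_,
        (hs.weaken (by simp) (by simp)).trans (hs₂.weaken (by simp) (by simp))⟩
      · simp only [hpar₁]
        intro x hx y hy
        rcases hseen₁ x hx y hy with h1 | ⟨rfl, rfl⟩ | h1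
        · exact Or.inl h1
        · exact Or.inr ⟨hparv, hne⟩
        · exact Or.inr h1
      · simp only [hpar₁]; exact h.path
      · simp only [hpar₁]
        intro x hx hx'
        by_cases hxv : x = v
        · simp [hxv]
        · rw [Function.update_of_ne hxv]
          exact h.onpath x hx hx'
      · simp only [hpar₁, htab₁, hlab₁]
        exact fun x hx hx' _ => h.labels x hx hx' trivial
      -- Standing still is treated as a move from `v` to `v`; no marks are attached to this pair, so
      -- no bit is flipped.
      · intro j _
        have := hT.bit_le v j
        simp only [hT.mark_self, List.count_nil]
        omega
      · have e1 : stepCost M mark v v = 400 := by simp [stepCost, hT.mark_self]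
        have e2 : 400 ≤ stepCost M mark v u := Nat.le_add_right _ _
        simp only [pot, hsum]
        omega
    · -- a new vertex
      rw [hvis] at he
      have hune : u ∉ v :: tl := fun hm => h.path.par_ne_zero u hm he
      refine Ends.store (i := addr β 2 u 0) (v := v + 1) (hX.eval_addrE hβ hI₁.base (by omega)
        (eval_reg h6₁) (eval_const hc0) (by omega) (by omega))
        (eval_add (eval_reg h5₁) (eval_const hc1) (hX.lt (by omega)))
        (by simp [Expr.cost, addrE, pairE]) (Ends.block_nil le_rfl ?_)
      have hs₂ : Same β [2] [] s₁ ⟨s₁.reg, Function.update s₁.mem (addr β 2 u 0) (v + 1)⟩ :=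
        (Same.refl (s := ⟨s₁.reg, s₁.mem⟩)).store (by omega) (by simp)
      have hpar₂ : ∀ x, par β (Function.update s₁.mem (addr β 2 u 0) (v + 1)) x =
          if x = u then v + 1 else par β s.mem x := by
        intro x
        rw [← hpar₁]
        simp [par, update_addr]
      have hpar_ne : ∀ x, par β s.mem x ≠ 0 →
          par β (Function.update s₁.mem (addr β 2 u 0) (v + 1)) x ≠ 0 := by
        intro x hx
        rw [hpar₂]
        split_ifs
        · omega
        · exact hx
      have htab₂ : tab β (Function.update s₁.mem (addr β 2 u 0) (v + 1)) = tab β s.mem := by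
        rw [← htab₁]
        funext x y
        exact hs₂.arr 4 (by omega) (by simp) x y
      refine ⟨Function.update rem v l, u, v :: tl, ⟨h2₁,
        fun x hx => hs₂.row (hrows₁ x hx) (by omega) (by simp),
        fun x y hx hy => hs₂.row (hmarks₁ x y hx hy) (by omega) (by simp),
        hsub₁, ?_, ?_, ?_, ?_, ?_⟩, hI₁.same hs₂ (by simp) (by simp) (by simp) (by simp),
        h5₁, h6₁, h9₁, hT.step hadj, ?_,
        (hs.weaken (by simp) (by simp)).trans (hs₂.weaken (by simp) (by simp))⟩
      · intro x hx y hy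
        rcases hseen₁ x hx y hy with h1 | ⟨rfl, rfl⟩ | h1
        · exact Or.inl h1
        · refine Or.inr ⟨hpar_ne _ hparv, ?_⟩
          simp only
          rw [hpar₂, if_pos rfl]
          omega
        · exact Or.inr ⟨hpar_ne _ h1.1, hpar_ne _ h1.2⟩
      · refine ⟨by simp only; rw [hpar₂, if_pos rfl], hT.symm hadj, h.path.congr fun x hx => ?_⟩
        simp only
        rw [hpar₂, if_neg]
        rintro rfl
        exact hune hx
      · intro x hx
        rcases List.mem_cons.1 hx with rfl | hx
        · exact hu
        · exact h.lt x hx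
      · intro x hx hx'
        simp only at hx'
        rw [hpar₂] at hx'
        by_cases hxu : x = u
        · simp [hxu]
        by_cases hxv : x = v
        · simp [hxv]
        rw [if_neg hxu] at hx'
        rw [Function.update_of_ne hxv]
        rcases h.onpath x hx hx' with h1 | h1
        · exact Or.inl (List.mem_cons_of_mem _ h1)
        · exact Or.inr h1
      · intro x hx hx' hxu
        simp only at hx' ⊢
        rw [hpar₂, if_neg hxu] at hx'
        rw [htab₂]
        obtain ⟨c, hc, hc'⟩ := h.labels x hx hx' trivial
        refine ⟨c, hc, ?_⟩
        rw [← hc', ← hlab₁]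
        exact hs₂.arr 5 (by omega) (by simp) x 0
      · have e1 : stepCost M mark u v = stepCost M mark v u := by
          simp only [stepCost, hT.mark_symm u v]
        simp only [pot, pathPot, hsum, e1]
        omega

/-- The budget `b` bounds the remaining time and, since every new name costs time, also the names
still to be issued. Hence `s.reg 9 + b ≤ X` is preserved and keeps all names in range. -/
theorem walkStep_ends {w X β n M v b : ℕ} {adj : ℕ → List ℕ} {mark : ℕ → ℕ → List ℕ}
    {bit : ℕ → ℕ → ℕ} {rem : ℕ → List ℕ} {tl : List ℕ} {s : State} (hX : Roomy w X) (hβ : β ≤ X)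
    (hn : n ≤ X) (hM : 2 * M ≤ X) (hM1 : 1 ≤ M) (hT : MarkedTree n M adj mark bit)
    (h : Tour β n M adj mark bit rem (v :: tl) (fun _ => True) s) (hI : Intact β M (bit v) s)
    (h5 : s.reg 5 = v) (hb : pot n (stepCost M mark) rem (v :: tl) + 100 ≤ b)
    (hbX : s.reg 9 + b ≤ X) (hgo : (rem v).length + v ≠ 0) :
    ∃ c, Ends w walkStep s c fun s' => ∃ rem' u tl' b',
      Tour β n M adj mark bit rem' (u :: tl') (fun _ => True) s' ∧ Intact β M (bit u) s' ∧
      s'.reg 5 = u ∧ pot n (stepCost M mark) rem' (u :: tl') + 100 ≤ b' ∧ s'.reg 9 + b' ≤ X ∧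
      30 + c + b' ≤ b ∧ Same β [0, 2, 3, 4, 5] [5, 6, 7, 8, 9, 13, 14] s s' := by
  have hv : v < n := h.lt v (by simp)
  have hrem : (rem v).length ≤ pot n (stepCost M mark) rem (v :: tl) :=
    length_le_pot (fun _ _ => by unfold stepCost; omega) hv
  obtain ⟨p, hp⟩ : ∃ p, pot n (stepCost M mark) rem (v :: tl) = p := ⟨_, rfl⟩
  rw [hp] at hb hrem
  have hs : Same β [] [7] s ⟨Function.update s.reg 7 (rem v).length, s.mem⟩ :=
    (Same.refl (s := ⟨s.reg, s.mem⟩)).assign (by simp)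
  have hI₁ := hI.same hs (by simp) (by simp) (by simp) (by simp)
  have hT₁ := h.same (hs.weaken (ts' := [3, 4]) (by simp) (List.Subset.refl _)) (by simp)
    (Extends.refl _) hI.table
  obtain ⟨t₁, s₁, e₁, ht₁, rem', u, tl', g1, g2, g3, g4, g5, g6, g7, g8⟩ :=
    choose_ends hX hβ hn hT hT₁ hI₁
    (by simpa using h5) (by simp) (by omega) hgo
  rw [hp] at g7
  have hu : u < n := g1.lt u (by simp)
  obtain ⟨q, hq⟩ : ∃ q, pot n (stepCost M mark) rem' (u :: tl') = q := ⟨_, rfl⟩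
  rw [hq] at g7
  unfold stepCost at g7
  obtain ⟨k, hk⟩ : ∃ k, (mark v u).length * (204 * Nat.log 2 (2 * M) + 150) = k := ⟨_, rfl⟩
  have hkD : (mark v u).length * Nat.log 2 (2 * M) ≤ k := by
    rw [← hk]
    exact Nat.mul_le_mul_left _ (by omega)
  have hkl : (mark v u).length ≤ k := by
    rw [← hk]
    exact Nat.le_mul_of_pos_right _ (by omega)
  rw [hk] at g7
  have h9 : s₁.reg 9 = s.reg 9 := by simpa using g5
  refine ⟨20 + (150 + (k + 120)), ?_⟩
  refine Ends.block_assign (rem v).length ?_ (b₂ := 150 + (k + 120)) ?_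
    (by simp [Expr.cost, cellE, addrE, pairE])
  · rw [hX.eval_cellE hβ hI.base (by omega) (eval_reg h5) (eval_const (hX.lt (a := 0) (by omega)))
      (by omega) (by omega)]
    exact (h.rows v hv).1
  refine Ends.block_cons (b₁ := 150) (b₂ := k + 120) ⟨t₁, s₁, e₁, ht₁, ?_⟩ le_rfl
  refine (move_ends hX hβ hM hM1 hn hT g1 g2 hu hv g3 g4 g6 (by omega) (by omega)).mono
    (by omega) ?_
  rintro s' ⟨k1, k2, k3, k4, k5⟩
  -- 320 = 30 for the loop test, 20 for the length, 150 for `choose` and 120 for the move without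
  -- its flips; the flips cost `k`. The 400 in `stepCost` covers this.
  exact ⟨rem', u, tl', b - (320 + k), k1, k2, k3, by omega, by omega, by omega,
    ((hs.weaken (by simp) (by simp)).trans (g8.weaken (by simp) (by simp))).trans k5⟩

theorem Path.par_zero {p : ℕ → ℕ} {adj : ℕ → List ℕ} {st : List ℕ} (h : Path p adj st) :
    p 0 = 1 := by
  induction st with
  | nil => exact h.elim
  | cons a l ih =>
    cases l with
    | nil => exact h.2
    | cons b l => exact ih h.2.2

/-- After the walk, the labels of all vertices are known. -/
theorem walk_ends {w X β n M b : ℕ} {adj : ℕ → List ℕ} {mark : ℕ → ℕ → List ℕ}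
    {bit : ℕ → ℕ → ℕ} {s : State} (hX : Roomy w X) (hβ : β ≤ X) (hn : n ≤ X) (hn0 : 0 < n)
    (hM : 2 * M ≤ X) (hM1 : 1 ≤ M) (hT : MarkedTree n M adj mark bit)
    (hconn : ∀ A : ℕ → Prop, A 0 → (∀ x y, A x → y ∈ adj x → A y) → ∀ x, x < n → A x)
    (h0 : s.reg 0 = β) (h2 : s.reg 2 = M) (h9 : s.reg 9 = 0)
    (hrows : ∀ x, x < n → Row β s.mem 0 x (adj x))
    (hmarks : ∀ x y, x < n → y < n → Row β s.mem 1 (pr x y) (mark x y))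
    (hz : ∀ t, 2 ≤ t → t < 8 → ∀ x y, s.mem (addr β t x y) = 0)
    (hb : pot n (stepCost M mark) adj [0] + 200 ≤ b) (hbX : b ≤ X) :
    Ends w walk s b fun s' => (∀ x y, x < n → y < n →
        (s'.mem (addr β 5 x 0) = s'.mem (addr β 5 y 0) ↔ ∀ j, j < M → bit x j = bit y j)) ∧
      (∀ x, x < n → s'.mem (addr β 5 x 0) ≤ X) ∧
      Same β [0, 2, 3, 4, 5] [5, 6, 7, 8, 9, 13, 14] s s' := by
  have hc1 : 1 < 2 ^ w := hX.lt (by have := hX.2; omega)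
  have hc0 : 0 < 2 ^ w := by omega
  refine Ends.block_assign 0 (eval_const hc0) (b₂ := b - 2) ?_ (by simp [Expr.cost]; omega)
  refine Ends.block_store (addr β 2 0 0) 1 (hX.eval_addrE hβ (by simpa using h0) (by omega)
    (eval_const hc0) (eval_const hc0) (by omega) (by omega)) (eval_const hc1) (b₂ := b - 30) ?_
    (by simp [Expr.cost, addrE, pairE]; omega)
  refine Ends.block_cons (b₁ := b - 40) (b₂ := 10) ?_ (by omega)
  simp only
  set s₁ : State := ⟨Function.update s.reg 5 0, Function.update s.mem (addr β 2 0 0) 1⟩ with hs₁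
  have hs : Same β [2] [5] s s₁ :=
    ((Same.refl (s := ⟨s.reg, s.mem⟩)).assign (r := 5) (v := 0) (by simp)).store (by omega) (by simp)
  have hpar : ∀ x, par β s₁.mem x = if x = 0 then 1 else 0 := by
    intro x
    simp [par, hs₁, update_addr, hz 2 (by omega) (by omega)]
  have htab : tab β s₁.mem = fun _ _ => 0 := by
    funext x y
    exact (hs.arr 4 (by omega) (by simp) x y).trans (hz 4 (by omega) (by omega) x y)
  have hcur : cur β s₁.mem = fun _ => 0 := by
    funext x
    exact (hs.arr 3 (by omega) (by simp) x 0).trans (hz 3 (by omega) (by omega) x 0)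
  -- Untouched memory is already an intact heap for the zero vector, which is the vector of the
  -- vertex 0.
  have hheap : Heap (fun _ _ => 0) M (fun _ => 0) (bit 0) :=
    ⟨fun _ _ _ => ⟨rfl, fun _ => ⟨rfl, rfl⟩⟩, fun j _ => (hT.bit_zero j).symm⟩
  have hI : Intact β M (bit 0) s₁ := by
    refine ⟨(hs.reg 0 (by simp)).trans h0, ?_, ?_, ?_⟩
    · rw [htab]
      exact ⟨rfl, fun _ _ => Nat.zero_le _, fun _ h => absurd rfl h⟩
    · rw [hcur]; simp
    · rw [htab, hcur]
      exact hheap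
  have hTour : Tour β n M adj mark bit adj [0] (fun _ => True) s₁ := by
    refine ⟨(hs.reg 2 (by simp)).trans h2, fun x hx => hs.row (hrows x hx) (by omega) (by simp),
      fun x y hx hy => hs.row (hmarks x y hx hy) (by omega) (by simp), fun _ _ _ h => h,
      fun _ _ _ h => Or.inl h, ⟨rfl, by simp [hpar]⟩, by simpa using hn0, ?_, ?_⟩
    · intro x _ hx
      rw [hpar] at hx
      left
      by_contra hne
      exact hx (if_neg (by simpa using hne))
    · intro x _ hx _
      rw [hpar] at hx
      have hx0 : x = 0 := by
        by_contra hne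
        exact hx (if_neg hne)
      subst hx0
      rw [htab]
      exact ⟨_, hheap, (hs.arr 5 (by omega) (by simp) 0 0).trans (hz 5 (by omega) (by omega) 0 0)⟩
  have h9₁ : s₁.reg 9 = 0 := (hs.reg 9 (by simp)).trans h9
  have h5₁ : s₁.reg 5 = 0 := by simp [hs₁]
  have hsw : Same β [0, 2, 3, 4, 5] [5, 6, 7, 8, 9, 13, 14] s s₁ := hs.weaken (by simp) (by simp)
  clear_value s₁
  have heval : ∀ {s : State} {v : ℕ} {l : List ℕ}, s.reg 0 = β → s.reg 5 = v → v < n →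
      Row β s.mem 0 v l → l.length ≤ X →
      (Expr.op .add (cellE 0 (.reg 5) (.const 0)) (.reg 5)).eval w s = l.length + v := by
    intro s v l h0 h5 hv hrow hl
    refine eval_add ?_ (eval_reg h5) (hX.lt (by omega))
    rw [hX.eval_cellE hβ h0 (by omega) (eval_reg h5) (eval_const hc0) (by omega) (by omega)]
    exact hrow.1
  refine (Ends.loop (Q := fun s' => (∀ x y, x < n → y < n →
        (s'.mem (addr β 5 x 0) = s'.mem (addr β 5 y 0) ↔ ∀ j, j < M → bit x j = bit y j)) ∧
      (∀ x, x < n → s'.mem (addr β 5 x 0) ≤ X) ∧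
      Same β [0, 2, 3, 4, 5] [5, 6, 7, 8, 9, 13, 14] s s') (fun s' b' => ∃ rem v tl,
    Tour β n M adj mark bit rem (v :: tl) (fun _ => True) s' ∧ Intact β M (bit v) s' ∧
    s'.reg 5 = v ∧ pot n (stepCost M mark) rem (v :: tl) + 100 ≤ b' ∧ s'.reg 9 + b' ≤ X ∧
    Same β [0, 2, 3, 4, 5] [5, 6, 7, 8, 9, 13, 14] s s') ?_ ?_
    ⟨adj, 0, [], hTour, hI, h5₁, by omega, by omega, hsw⟩).mono le_rfl
    fun s' hs' => Ends.block_nil (by omega) hs'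
  · rintro s' b' ⟨rem, v, tl, g1, g2, g3, g4, g5, g6⟩ he
    refine ⟨by simp [Expr.cost, cellE, addrE, pairE]; omega, ?_⟩
    have hv := g1.lt v (by simp)
    have hlen : (rem v).length ≤ pot n (stepCost M mark) rem (v :: tl) :=
      length_le_pot (fun _ _ => by unfold stepCost; omega) hv
    rw [heval g2.base g3 hv (g1.rows v hv) (by omega)] at he
    obtain rfl : v = 0 := by omega
    have hnil : rem 0 = [] := List.eq_nil_of_length_eq_zero (by omega)
    -- The parent entry of 0 is 1, which encodes the predecessor 0. A longer path would therefore
    -- make 0 its own neighbour.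
    have htl : tl = [] := by
      cases tl with
      | nil => rfl
      | cons p tl =>
        obtain ⟨h1, h2, h3⟩ := g1.path
        rw [g1.path.par_zero] at h1
        exact absurd (by omega) (hT.ne h2)
    subst htl
    -- No visited vertex has neighbours left to consider, so the visited set is closed under taking
    -- neighbours, and connectedness makes it everything.
    have hall : ∀ x, x < n → x < n ∧ par β s'.mem x ≠ 0 := by
      refine hconn (fun x => x < n ∧ par β s'.mem x ≠ 0) ⟨hv, g1.path.par_ne_zero 0 (by simp)⟩ ?_
      rintro x y ⟨hx, hx'⟩ hy
      refine ⟨(hT.lt hy).2, ?_⟩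
      rcases g1.seen x hx y hy with h1 | h1
      · have : rem x = [] := by
          rcases g1.onpath x hx hx' with h2 | h2
          · rw [List.mem_singleton] at h2
            rw [h2, hnil]
          · exact h2
        rw [this] at h1
        simp at h1
      · exact h1.2
    refine ⟨fun x y hx hy => ?_, fun x hx => ?_, g6⟩
    · obtain ⟨c, hc, hc'⟩ := g1.labels x hx (hall x hx).2 trivial
      obtain ⟨d, hd, hd'⟩ := g1.labels y hy (hall y hy).2 trivial
      rw [hc', hd']
      exact hc.root_eq_iff hM1 g2.table hd
    · obtain ⟨c, hc, hc'⟩ := g1.labels x hx (hall x hx).2 trivial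
      rw [hc']
      -- For `M = 1` the root is a leaf and holds a bit rather than a name from the table.
      rcases Nat.lt_or_ge 1 M with hM' | hM'
      · rw [(hc.node 1 le_rfl hM').1]
        exact (g2.table.le _ _).trans (by omega)
      · obtain rfl : M = 1 := by omega
        have h1 := hc.leaf 0 (by omega)
        have h2 := hT.bit_le x 0
        have := hX.2
        simp only [add_zero] at h1
        omega
  · rintro s' b' ⟨rem, v, tl, g1, g2, g3, g4, g5, g6⟩ he
    have hv := g1.lt v (by simp)
    have hlen : (rem v).length ≤ pot n (stepCost M mark) rem (v :: tl) :=
      length_le_pot (fun _ _ => by unfold stepCost; omega) hv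
    rw [heval g2.base g3 hv (g1.rows v hv) (by omega)] at he
    obtain ⟨c, hc⟩ := walkStep_ends hX hβ hn hM hM1 hT g1 g2 g3 g4 g5 he
    refine ⟨c, hc.mono le_rfl ?_⟩
    rintro s'' ⟨rem', u, tl', b'', k1, k2, k3, k4, k5, k6, k7⟩
    exact ⟨b'', ⟨rem', u, tl', k1, k2, k3, k4, k5, g6.trans k7⟩,
      by simp [Expr.cost, cellE, addrE, pairE]; omega⟩

open TreeCuts

/-! ### Reading the input -/

/-- The memory holds the list `l` from the address `a` on. -/
def Holds (m : ℕ → ℕ) (a : ℕ) (l : List ℕ) : Prop := ∀ i (h : i < l.length), m (a + i) = l[i]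

theorem Holds.head {m : ℕ → ℕ} {a x : ℕ} {l : List ℕ} (h : Holds m a (x :: l)) : m a = x :=
  h 0 (by simp)

theorem Holds.tail {m : ℕ → ℕ} {a x : ℕ} {l : List ℕ} (h : Holds m a (x :: l)) :
    Holds m (a + 1) l := fun i hi => by
  have := h (i + 1) (by simpa using hi)
  rw [show a + 1 + i = a + (i + 1) by omega, this]
  rfl

theorem Holds.congr {m m' : ℕ → ℕ} {a : ℕ} {l : List ℕ} (h : Holds m a l)
    (hm : ∀ i, i < l.length → m' (a + i) = m (a + i)) : Holds m' a l :=
  fun i hi => (hm i hi).trans (h i hi)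

theorem Row.nil {β t x : ℕ} {m : ℕ → ℕ} (h : m (addr β t x 0) = 0) : Row β m t x [] :=
  ⟨h, fun k hk => absurd hk (Nat.not_lt_zero k)⟩

theorem push_same {β t x v c : ℕ} {s : State} (ht : t < 8) :
    Same β [t] [10] s ⟨Function.update s.reg 10 c, pushMem β s.mem t x v⟩ := by
  refine ⟨fun r hr => ?_, fun i hi => pushMem_of_lt hi, fun t' ht' hne y z => ?_⟩
  · simp only [List.mem_singleton] at hr
    simp [hr]
  · refine pushMem_addr_of_ne ht ht' ?_
    rintro ⟨rfl, -⟩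
    simp at hne

/-- Append the value of `y` to the row of the array `t` given by `x`. -/
def append (t : ℕ) (x y : Expr) : Prog := block [.assign 11 x, .assign 12 y, push t]

theorem append_ends {w X β t a b : ℕ} {x y : Expr} {s : State} (hX : Roomy w X) (hβ : β ≤ X)
    (ht : t < 8) (h0 : s.reg 0 = β) (hx : x.eval w s = a)
    (hy : y.eval w ⟨Function.update s.reg 11 a, s.mem⟩ = b) (ha : a ≤ 4 * X ^ 2 + X)
    (hc : s.mem (addr β t a 0) < X) :
    Ends w (append t x y) s (x.cost + y.cost + 63) fun s' =>
      s'.mem = pushMem β s.mem t a b ∧ s'.reg 10 = s.mem (addr β t a 0) + 1 ∧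
      Same β [t] [10, 11, 12] s s' := by
  refine Ends.block_assign a hx (b₂ := y.cost + 62) ?_ (by omega)
  refine Ends.block_assign b hy (b₂ := 61) ?_ (by omega)
  simp only
  have hs : Same β [t] [10, 11, 12] s
      ⟨Function.update (Function.update s.reg 11 a) 12 b, s.mem⟩ :=
    ((Same.refl (s := ⟨s.reg, s.mem⟩)).assign (by simp)).assign (by simp)
  refine Ends.block_cons ((push_ends hX hβ ht (by simpa using h0) (by simpa using ha)
    (by simpa using hc)).mono le_rfl ?_) (b₂ := 1) (by omega)
  rintro _ rfl
  refine Ends.block_nil le_rfl ⟨by simp, by simp, hs.trans ?_⟩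
  exact (push_same ht).weaken (by simp) (by simp)

/-- The first endpoint of the edge at the address in register `3`. -/
def fstE : Expr := .load (.reg 3)

/-- The second endpoint of the edge at the address in register `3`. -/
def sndE : Expr := .load (.op .add (.reg 3) (.const 1))

/-- Put the edge at the address in register `3` into the neighbour lists. -/
def readEdge : Prog := block
  [append 0 fstE sndE, append 0 sndE fstE, .assign 3 (.op .add (.reg 3) (.const 2))]

/-- Put the number in register `5` into the list of the edge at the address in register `3`. -/
def markEdge : Prog := block
  [append 1 (pairE fstE sndE) (.reg 5), append 1 (pairE sndE fstE) (.reg 5),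
   .assign 3 (.op .add (.reg 3) (.const 2))]

theorem eval_fstE {w : ℕ} {s : State} {a u : ℕ} (h3 : s.reg 3 = a) (hu : s.mem a = u) :
    fstE.eval w s = u := by
  simp [fstE, Expr.eval, h3, hu]

theorem eval_sndE {w : ℕ} {s : State} {a v : ℕ} (h3 : s.reg 3 = a) (hv : s.mem (a + 1) = v)
    (hw : a + 1 < 2 ^ w) : sndE.eval w s = v := by
  have e : (Expr.op .add (.reg 3) (.const 1)).eval w s = a + 1 :=
    eval_add (eval_reg h3) (eval_const (by omega)) hw
  rw [sndE, Expr.eval, e, hv]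

theorem readEdge_ends {w X β n a : ℕ} {s : State} {p : Fin n × Fin n} {g : ℕ → List ℕ}
    (hX : Roomy w X) (hβ : β ≤ X) (hn : n ≤ X) (h0 : s.reg 0 = β) (h3 : s.reg 3 = a)
    (ha : a + 1 < β) (hu : s.mem a = p.1) (hv : s.mem (a + 1) = p.2)
    (hrow : ∀ x, Row β s.mem 0 x (g x)) (hg : ∀ x, (g x).length + 2 < X) :
    Ends w readEdge s 180 fun s' => (∀ x, Row β s'.mem 0 x (g x ++ adjList [p] x)) ∧
      s'.reg 3 = a + 2 ∧ Same β [0] [3, 10, 11, 12] s s' := by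
  have h2 : 2 < 2 ^ w := hX.lt (by have := hX.2; omega)
  have haw : a + 1 < 2 ^ w := hX.lt (by omega)
  have hp1 := p.1.2
  have hp2 := p.2.2
  refine Ends.block_cons ((append_ends hX hβ (t := 0) (by omega) h0 (eval_fstE h3 hu)
    (eval_sndE (by simpa using h3) hv haw) (by omega)
    (by rw [(hrow _).1]; have := hg p.1; omega)).mono le_rfl ?_) (b₂ := 100)
    (by simp [Expr.cost, fstE, sndE])
  rintro s₁ ⟨m₁, -, same₁⟩
  have hrow₁ : ∀ x, Row β s₁.mem 0 x (g x ++ if x = p.1 then [(p.2 : ℕ)] else []) := by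
    intro x
    have h := (hrow x).push (t := 0) (x := p.1) (v := p.2) (by omega) (by omega)
    rw [m₁]
    simp only [true_and] at h
    split_ifs at h ⊢
    · exact h
    · simpa using h
  have r3 : s₁.reg 3 = a := (same₁.reg 3 (by simp)).trans h3
  refine Ends.block_cons ((append_ends hX hβ (t := 0) (by omega) ((same₁.reg 0 (by simp)).trans h0)
    (eval_sndE r3 ((same₁.low _ ha).trans hv) haw)
    (eval_fstE (by simpa using r3) ((same₁.low _ (by omega)).trans hu)) (by omega) ?_).mono le_rfl ?_)
    (b₂ := 10) (by simp [Expr.cost, fstE, sndE])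
  · rw [(hrow₁ _).1, List.length_append]
    have := hg p.2
    split_ifs <;> simp <;> omega
  rintro s₂ ⟨m₂, -, same₂⟩
  have same := same₁.trans same₂
  refine Ends.block_assign (a + 2) (eval_add ((same.reg 3 (by simp)).trans h3) (eval_const h2)
    (hX.lt (by have := hX.2; omega))) (b₂ := 1) ?_ (by simp [Expr.cost])
  refine Ends.block_nil le_rfl ⟨fun x => ?_, by simp,
    (same.weaken (by simp) (by simp)).assign (by simp)⟩
  have h := (hrow₁ x).push (t := 0) (x := p.2) (v := p.1) (by omega) (by omega)
  rw [← m₂] at h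
  simp only [true_and, List.append_assoc] at h
  simp only [adjList, List.flatMap_cons, List.flatMap_nil, List.append_nil]
  split_ifs at h ⊢ <;> simpa using h

/-- The mark is stored under both orientations because the walk crosses edges both ways. The uniform
bound `N` on all row lengths is what keeps the append within the address range. -/
theorem markEdge_ends {w X β n a j N : ℕ} {s : State} {p : Fin n × Fin n} {g : ℕ → ℕ → List ℕ}
    (hX : Roomy w X) (hβ : β ≤ X) (hn : n ≤ X) (h0 : s.reg 0 = β) (h3 : s.reg 3 = a)
    (h5 : s.reg 5 = j) (ha : a + 1 < β) (hu : s.mem a = p.1) (hv : s.mem (a + 1) = p.2)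
    (hrow : ∀ x y, Row β s.mem 1 (pr x y) (g x y)) (hN : ∀ z, s.mem (addr β 1 z 0) ≤ N)
    (hNX : N + 2 < X) :
    Ends w markEdge s 210 fun s' =>
      (∀ x y, Row β s'.mem 1 (pr x y) (g x y ++ markList [(p, j)] x y)) ∧
      (∀ z, s'.mem (addr β 1 z 0) ≤ N + 2) ∧
      s'.reg 3 = a + 2 ∧ Same β [1] [3, 10, 11, 12] s s' := by
  have h2 : 2 < 2 ^ w := hX.lt (by have := hX.2; omega)
  have haw : a + 1 < 2 ^ w := hX.lt (by omega)
  have hp1 := p.1.2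
  have hp2 := p.2.2
  refine Ends.block_cons ((append_ends hX hβ (t := 1) (by omega) h0
    (hX.eval_pairE (eval_fstE h3 hu) (eval_sndE h3 hv haw) (by omega) (by omega))
    (show _ = j by simpa [Expr.eval] using h5) (pr_le (by omega) (by omega))
    (by have := hN (pr p.1 p.2); omega)).mono le_rfl ?_) (b₂ := 106)
    (by simp [Expr.cost, fstE, sndE, pairE])
  rintro s₁ ⟨m₁, -, same₁⟩
  have hN₁ : ∀ z, s₁.mem (addr β 1 z 0) ≤ N + 1 := by
    intro z
    rw [m₁, pushMem_addr_zero (by omega) (by omega)]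
    have := hN z
    split_ifs <;> omega
  have r3 : s₁.reg 3 = a := (same₁.reg 3 (by simp)).trans h3
  have r5 : s₁.reg 5 = j := (same₁.reg 5 (by simp)).trans h5
  have hu₁ := (same₁.low _ (show a < β by omega)).trans hu
  have hv₁ := (same₁.low _ ha).trans hv
  refine Ends.block_cons ((append_ends hX hβ (t := 1) (by omega) ((same₁.reg 0 (by simp)).trans h0)
    (hX.eval_pairE (eval_sndE r3 hv₁ haw) (eval_fstE r3 hu₁) (by omega) (by omega))
    (show _ = j by simpa [Expr.eval] using r5) (pr_le (by omega) (by omega))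
    (by have := hN₁ (pr p.2 p.1); omega)).mono le_rfl ?_) (b₂ := 6)
    (by simp [Expr.cost, fstE, sndE, pairE])
  rintro s₂ ⟨m₂, -, same₂⟩
  have same := same₁.trans same₂
  refine Ends.block_assign (a + 2) (eval_add ((same.reg 3 (by simp)).trans h3) (eval_const h2)
    (hX.lt (by have := hX.2; omega))) (b₂ := 1) ?_ (by simp [Expr.cost])
  refine Ends.block_nil le_rfl ⟨fun x y => ?_, fun z => ?_, by simp,
    (same.weaken (by simp) (by simp)).assign (by simp)⟩
  · have h₁ := (hrow x y).push (t := 1) (x := pr p.1 p.2) (v := j) (by omega) (by omega)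
    rw [← m₁] at h₁
    have h₂ := h₁.push (t := 1) (x := pr p.2 p.1) (v := j) (by omega) (by omega)
    rw [← m₂] at h₂
    simp only [true_and, pr_inj] at h₂
    simp only [markList, List.flatMap_cons, List.flatMap_nil, List.append_nil]
    split_ifs at h₂ ⊢ <;> simpa using h₂
  · simp only
    rw [m₂, pushMem_addr_zero (by omega) (by omega)]
    have := hN₁ z
    split_ifs <;> omega

/-- Read the edges of the tree; their number is in register `4`. -/
def readEdges : Prog :=
  .loop (.reg 4) (block [readEdge, .assign 4 (.op .sub (.reg 4) (.const 1))])

/-- Read the cuts with one edge; their number is in register `4`. -/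
def readSingles : Prog := .loop (.reg 4) (block
  [.assign 5 (.op .add (.reg 5) (.const 1)), markEdge, .assign 4 (.op .sub (.reg 4) (.const 1))])

/-- Read the cuts with two edges; their number is in register `4`. -/
def readPairs : Prog := .loop (.reg 4) (block
  [.assign 5 (.op .add (.reg 5) (.const 1)), markEdge, markEdge,
   .assign 4 (.op .sub (.reg 4) (.const 1))])

theorem readEdges_ends {w X β n : ℕ} (hX : Roomy w X) (hβ : β ≤ X) (hn : n ≤ X) {tail : List ℕ}
    (E : List (Fin n × Fin n)) : ∀ (s : State) (a : ℕ) (g : ℕ → List ℕ), s.reg 0 = β →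
    s.reg 3 = a → s.reg 4 = E.length → a + 2 * E.length + tail.length ≤ β →
    Holds s.mem a (E.flatMap encodeEdge ++ tail) → (∀ x, Row β s.mem 0 x (g x)) →
    (∀ x, (g x).length + 2 * E.length < X) →
    Ends w readEdges s (200 * E.length + 2) fun s' =>
      (∀ x, Row β s'.mem 0 x (g x ++ adjList E x)) ∧ s'.reg 3 = a + 2 * E.length ∧
      Holds s'.mem (a + 2 * E.length) tail ∧ Same β [0] [3, 4, 10, 11, 12] s s' := by
  have hc1 : 1 < 2 ^ w := hX.lt (by have := hX.2; omega)
  induction E with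
  | nil =>
    intro s a g h0 h3 h4 _ hh hrow _
    refine Ends.loop_done h4 (by simp [Expr.cost]) ⟨?_, by simpa using h3, by simpa using hh, Same.refl⟩
    simpa [adjList] using hrow
  | cons p E ih =>
    intro s a g h0 h3 h4 ha hh hrow hg
    simp only [List.length_cons] at h4 ha hg
    simp only [List.flatMap_cons, encodeEdge, List.cons_append, List.nil_append] at hh
    refine Ends.loop_step (b₁ := 190) (b₂ := 200 * E.length + 2) (by simp [Expr.eval, h4]) ?_
      (by simp [Expr.cost]; omega)
    refine Ends.block_cons ((readEdge_ends hX hβ hn h0 h3 (by omega) hh.head hh.tail.head hrow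
      (fun x => by have := hg x; omega)).mono le_rfl ?_) (b₂ := 10) (by omega)
    rintro s₁ ⟨g1, g2, g3⟩
    refine Ends.block_assign E.length ?_ (b₂ := 1) ?_ (by simp [Expr.cost])
    · rw [eval_sub (eval_reg ((g3.reg 4 (by simp)).trans h4)) (eval_const hc1)]
      omega
    have same := (g3.weaken (ts' := [0]) (rs' := [3, 4, 10, 11, 12]) (by simp) (by simp)).assign
      (r := 4) (v := E.length) (by simp)
    refine Ends.block_nil le_rfl ((ih _ (a + 2) _ ((same.reg 0 (by simp)).trans h0)
      (by simpa using g2) (by simp) (by omega) ?_ g1 ?_).mono le_rfl ?_)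
    · refine hh.tail.tail.congr fun i hi => same.low _ ?_
      have : (E.flatMap encodeEdge).length = 2 * E.length := by
        simp [List.length_flatMap, encodeEdge, mul_comm]
      rw [List.length_append] at hi
      omega
    · intro x
      have := hg x
      simp only [adjList, List.flatMap_cons, List.flatMap_nil, List.append_nil, List.length_append]
      split_ifs <;> simp <;> omega
    · rintro s' ⟨k1, k2, k3, k4⟩
      refine ⟨fun x => ?_, by rw [k2, List.length_cons]; omega, ?_, same.trans k4⟩
      · have := k1 x
        simpa [adjList] using this
      · rw [List.length_cons, show a + 2 * (E.length + 1) = a + 2 + 2 * E.length by omega]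
        exact k3

theorem readSingles_ends {w X β n : ℕ} (hX : Roomy w X) (hβ : β ≤ X) (hn : n ≤ X) {tail : List ℕ}
    (L : List (Fin n × Fin n)) : ∀ (s : State) (a j N : ℕ) (g : ℕ → ℕ → List ℕ), s.reg 0 = β →
    s.reg 3 = a → s.reg 4 = L.length → s.reg 5 = j → a + 2 * L.length + tail.length ≤ β →
    Holds s.mem a (L.flatMap encodeEdge ++ tail) → (∀ x y, Row β s.mem 1 (pr x y) (g x y)) →
    (∀ z, s.mem (addr β 1 z 0) ≤ N) → N + 2 * L.length < X → j + L.length < X →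
    Ends w readSingles s (250 * L.length + 2) fun s' =>
      (∀ x y, Row β s'.mem 1 (pr x y) (g x y ++ markList (cutItems j (L.map fun p => [p])) x y)) ∧
      (∀ z, s'.mem (addr β 1 z 0) ≤ N + 2 * L.length) ∧
      s'.reg 3 = a + 2 * L.length ∧ s'.reg 5 = j + L.length ∧
      Holds s'.mem (a + 2 * L.length) tail ∧ Same β [1] [3, 4, 5, 10, 11, 12] s s' := by
  have hc1 : 1 < 2 ^ w := hX.lt (by have := hX.2; omega)
  induction L with
  | nil =>
    intro s a j N g h0 h3 h4 h5 _ hh hrow hN _ _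
    refine Ends.loop_done h4 (by simp [Expr.cost]) ⟨?_, by simpa using hN, by simpa using h3,
      by simpa using h5, by simpa using hh, Same.refl⟩
    simpa [markList, cutItems] using hrow
  | cons p L ih =>
    intro s a j N g h0 h3 h4 h5 ha hh hrow hN hNX hj
    simp only [List.length_cons] at h4 ha hNX hj
    simp only [List.flatMap_cons, encodeEdge, List.cons_append, List.nil_append] at hh
    refine Ends.loop_step (b₁ := 230) (b₂ := 250 * L.length + 2) (by simp [Expr.eval, h4]) ?_
      (by simp [Expr.cost]; omega)
    refine Ends.block_assign (j + 1) (eval_add (eval_reg h5) (eval_const hc1) (hX.lt (by omega)))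
      (b₂ := 220) ?_ (by simp [Expr.cost])
    have same₀ : Same β [1] [3, 4, 5, 10, 11, 12] s ⟨Function.update s.reg 5 (j + 1), s.mem⟩ :=
      (Same.refl (s := ⟨s.reg, s.mem⟩)).assign (by simp)
    refine Ends.block_cons ((markEdge_ends (j := j + 1) hX hβ hn ((same₀.reg 0 (by simp)).trans h0)
      (by simpa using h3) (by simp) (by omega) hh.head hh.tail.head hrow hN (by omega)).mono le_rfl ?_)
      (b₂ := 10) (by omega)
    rintro s₁ ⟨g1, g1', g2, g3⟩
    have h4₁ : s₁.reg 4 = L.length + 1 := (g3.reg 4 (by simp)).trans (by simpa using h4)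
    have h5₁ : s₁.reg 5 = j + 1 := (g3.reg 5 (by simp)).trans (by simp)
    refine Ends.block_assign L.length ?_ (b₂ := 1) ?_ (by simp [Expr.cost])
    · rw [eval_sub (eval_reg h4₁) (eval_const hc1)]
      omega
    have same := (same₀.trans (g3.weaken (ts' := [1]) (rs' := [3, 4, 5, 10, 11, 12]) (by simp)
      (by simp))).assign (r := 4) (v := L.length) (by simp)
    refine Ends.block_nil le_rfl ((ih _ (a + 2) (j + 1) (N + 2) _ ((same.reg 0 (by simp)).trans h0)
      (by simpa using g2) (by simp) (by simpa using h5₁) (by omega) ?_ g1 g1' (by omega)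
      (by omega)).mono le_rfl ?_)
    · refine hh.tail.tail.congr fun i hi => same.low _ ?_
      have : (L.flatMap encodeEdge).length = 2 * L.length := by
        simp [List.length_flatMap, encodeEdge, mul_comm]
      rw [List.length_append] at hi
      omega
    · rintro s' ⟨k1, k1', k2, k2', k3, k4⟩
      have e : a + 2 * (L.length + 1) = a + 2 + 2 * L.length := by omega
      refine ⟨fun x y => ?_, fun z => ?_, by rw [k2, List.length_cons]; omega,
        by rw [k2', List.length_cons]; omega, ?_, same.trans k4⟩
      · have := k1 x y
        simpa [markList, cutItems] using this
      · have := k1' z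
        rw [List.length_cons]
        omega
      · rw [List.length_cons, e]
        exact k3

theorem readPairs_ends {w X β n : ℕ} (hX : Roomy w X) (hβ : β ≤ X) (hn : n ≤ X)
    (L : List ((Fin n × Fin n) × (Fin n × Fin n))) : ∀ (s : State) (a j N : ℕ) (g : ℕ → ℕ → List ℕ),
    s.reg 0 = β → s.reg 3 = a → s.reg 4 = L.length → s.reg 5 = j → a + 4 * L.length ≤ β →
    Holds s.mem a (L.flatMap fun q => encodeEdge q.1 ++ encodeEdge q.2) →
    (∀ x y, Row β s.mem 1 (pr x y) (g x y)) →
    (∀ z, s.mem (addr β 1 z 0) ≤ N) → N + 4 * L.length < X → j + L.length < X →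
    Ends w readPairs s (460 * L.length + 2) fun s' =>
      (∀ x y, Row β s'.mem 1 (pr x y)
        (g x y ++ markList (cutItems j (L.map fun q => [q.1, q.2])) x y)) ∧
      Same β [1] [3, 4, 5, 10, 11, 12] s s' := by
  have hc1 : 1 < 2 ^ w := hX.lt (by have := hX.2; omega)
  induction L with
  | nil =>
    intro s a j N g h0 h3 h4 h5 _ hh hrow hN _ _
    refine Ends.loop_done h4 (by simp [Expr.cost]) ⟨?_, Same.refl⟩
    simpa [markList, cutItems] using hrow
  | cons p L ih =>
    intro s a j N g h0 h3 h4 h5 ha hh hrow hN hNX hj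
    simp only [List.length_cons] at h4 ha hNX hj
    simp only [List.flatMap_cons, encodeEdge, List.cons_append, List.nil_append] at hh
    refine Ends.loop_step (b₁ := 440) (b₂ := 460 * L.length + 2) (by simp [Expr.eval, h4]) ?_
      (by simp [Expr.cost]; omega)
    refine Ends.block_assign (j + 1) (eval_add (eval_reg h5) (eval_const hc1) (hX.lt (by omega)))
      (b₂ := 430) ?_ (by simp [Expr.cost])
    have same₀ : Same β [1] [3, 4, 5, 10, 11, 12] s ⟨Function.update s.reg 5 (j + 1), s.mem⟩ :=
      (Same.refl (s := ⟨s.reg, s.mem⟩)).assign (by simp)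
    refine Ends.block_cons ((markEdge_ends (j := j + 1) hX hβ hn ((same₀.reg 0 (by simp)).trans h0)
      (by simpa using h3) (by simp) (by omega) hh.head hh.tail.head hrow hN (by omega)).mono le_rfl ?_)
      (b₂ := 220) (by omega)
    rintro s₁ ⟨g1, g1', g2, g3⟩
    have same₁ := same₀.trans (g3.weaken (ts' := [1]) (rs' := [3, 4, 5, 10, 11, 12]) (by simp)
      (by simp))
    refine Ends.block_cons ((markEdge_ends (p := p.2) (j := j + 1) hX hβ hn
      ((same₁.reg 0 (by simp)).trans h0) g2 ((g3.reg 5 (by simp)).trans (by simp)) (by omega)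
      ((same₁.low _ (by omega)).trans hh.tail.tail.head)
      ((same₁.low _ (by omega)).trans hh.tail.tail.tail.head) g1 g1' (by omega)).mono le_rfl ?_)
      (b₂ := 10) (by omega)
    rintro s₂ ⟨l1, l1', l2, l3⟩
    have h4₂ : s₂.reg 4 = L.length + 1 :=
      ((l3.reg 4 (by simp)).trans (g3.reg 4 (by simp))).trans (by simpa using h4)
    have h5₂ : s₂.reg 5 = j + 1 := ((l3.reg 5 (by simp)).trans (g3.reg 5 (by simp))).trans (by simp)
    refine Ends.block_assign L.length ?_ (b₂ := 1) ?_ (by simp [Expr.cost])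
    · rw [eval_sub (eval_reg h4₂) (eval_const hc1)]
      omega
    have same := (same₁.trans (l3.weaken (ts' := [1]) (rs' := [3, 4, 5, 10, 11, 12]) (by simp)
      (by simp))).assign (r := 4) (v := L.length) (by simp)
    refine Ends.block_nil le_rfl ((ih _ (a + 2 + 2) (j + 1) (N + 2 + 2) _
      ((same.reg 0 (by simp)).trans h0)
      (by simpa using l2) (by simp) (by simpa using h5₂) (by omega) ?_ l1 l1' (by omega)
      (by omega)).mono le_rfl ?_)
    · refine hh.tail.tail.tail.tail.congr fun i hi => same.low _ ?_
      have : (L.flatMap fun q => encodeEdge q.1 ++ encodeEdge q.2).length = 4 * L.length := by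
        simp [List.length_flatMap, encodeEdge, mul_comm]
      simp only [encodeEdge, List.cons_append, List.nil_append] at this
      omega
    · rintro s' ⟨k1, k4⟩
      refine ⟨fun x y => ?_, same.trans k4⟩
      have := k1 x y
      simpa [markList, cutItems] using this

/-- Read the input. -/
def readInput : Prog := block
  [.assign 1 (.load (.const 0)),
   .assign 2 (.op .add (.op .add (.load (.const 1)) (.load (.const 2))) (.const 1)),
   .assign 0 (.op .mul (.const 4) (.op .add (.reg 1) (.reg 2))),
   .assign 3 (.const 3),
   .assign 4 (.op .sub (.reg 1) (.const 1)),
   readEdges,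
   .assign 4 (.load (.const 1)),
   readSingles,
   .assign 4 (.load (.const 2)),
   readPairs]

/-- The cuts as lists of edges. -/
def cutLists {n : ℕ} (L₁ : List (Fin n × Fin n)) (L₂ : List ((Fin n × Fin n) × (Fin n × Fin n))) :
    List (List (Fin n × Fin n)) :=
  L₁.map (fun p => [p]) ++ L₂.map fun q => [q.1, q.2]

theorem cutItems_append {n : ℕ} (j : ℕ) (l l' : List (List (Fin n × Fin n))) :
    cutItems j (l ++ l') = cutItems j l ++ cutItems (j + l.length) l' := by
  induction l generalizing j with
  | nil => rfl
  | cons F l ih =>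
    simp only [List.cons_append, cutItems, ih, List.append_assoc, List.length_cons]
    rw [show j + 1 + l.length = j + (l.length + 1) by omega]

/-- The base address 4(n + M) exceeds the input length 3 + 2|E| + 2|L₁| + 4|L₂|, so the arrays start
in untouched memory. The number of leaves is one more than the number of cuts: cuts are numbered
from 1, the leaf 0 stays idle, and the heap is nonempty even without cuts. -/
theorem readInput_ends {w X n : ℕ} {E L₁ : List (Fin n × Fin n)}
    {L₂ : List ((Fin n × Fin n) × (Fin n × Fin n))} (hX : Roomy w X) (hE : E.length + 1 = n)
    (hbig : 4 * (n + (L₁.length + L₂.length + 1)) ≤ X) :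
    Ends w readInput (initState (encodeInput E L₁ L₂))
      (200 * E.length + 250 * L₁.length + 460 * L₂.length + 60) fun s =>
      s.reg 0 = 4 * (n + (L₁.length + L₂.length + 1)) ∧ s.reg 1 = n ∧
      s.reg 2 = L₁.length + L₂.length + 1 ∧ s.reg 9 = 0 ∧
      (∀ x, Row (4 * (n + (L₁.length + L₂.length + 1))) s.mem 0 x (adjList E x)) ∧
      (∀ x y, Row (4 * (n + (L₁.length + L₂.length + 1))) s.mem 1 (pr x y)
        (markList (cutItems 0 (cutLists L₁ L₂)) x y)) ∧
      ∀ t, 2 ≤ t → t < 8 → ∀ x y,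
        s.mem (addr (4 * (n + (L₁.length + L₂.length + 1))) t x y) = 0 := by
  obtain ⟨M, hM⟩ : ∃ M, L₁.length + L₂.length + 1 = M := ⟨_, rfl⟩
  rw [hM] at hbig ⊢
  obtain ⟨β, hβ⟩ : ∃ β, 4 * (n + M) = β := ⟨_, rfl⟩
  rw [hβ] at hbig ⊢
  have h8 := hX.2
  have hc0 : 0 < 2 ^ w := hX.lt (by omega)
  have hc1 : 1 < 2 ^ w := hX.lt (by omega)
  have hc2 : 2 < 2 ^ w := hX.lt (by omega)
  have hlenE : (E.flatMap encodeEdge).length = 2 * E.length := by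
    simp [List.length_flatMap, encodeEdge, mul_comm]
  have hlen1 : (L₁.flatMap encodeEdge).length = 2 * L₁.length := by
    simp [List.length_flatMap, encodeEdge, mul_comm]
  have hlen2 : (L₂.flatMap fun q => encodeEdge q.1 ++ encodeEdge q.2).length = 4 * L₂.length := by
    simp [List.length_flatMap, encodeEdge, mul_comm]
  set m : ℕ → ℕ := fun i => (encodeInput E L₁ L₂).getD i 0 with hm
  have m0 : m 0 = n := by simp [hm, encodeInput]
  have m1 : m 1 = L₁.length := by simp [hm, encodeInput]
  have m2 : m 2 = L₂.length := by simp [hm, encodeInput]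
  have hlen : (encodeInput E L₁ L₂).length ≤ β := by
    simp only [encodeInput, List.length_append, hlenE, hlen1, hlen2, List.length_cons,
      List.length_nil]
    omega
  have hzero : ∀ t x y, m (addr β t x y) = 0 := by
    intro t x y
    have := le_addr β t x y
    simp only [hm]
    rw [List.getD_eq_default]
    omega
  have hholds : Holds m 3 (E.flatMap encodeEdge ++ (L₁.flatMap encodeEdge ++
      L₂.flatMap fun q => encodeEdge q.1 ++ encodeEdge q.2)) := by
    intro i hi
    have e : encodeInput E L₁ L₂ = [n, L₁.length, L₂.length] ++ (E.flatMap encodeEdge ++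
        (L₁.flatMap encodeEdge ++ L₂.flatMap fun q => encodeEdge q.1 ++ encodeEdge q.2)) := by
      simp [encodeInput]
    simp only [hm, e]
    rw [List.getD_append_right _ _ _ _ (by simp)]
    rw [List.getD_eq_getElem _ _ (by simpa using hi)]
    simp
  change Ends w readInput ⟨fun _ => 0, m⟩ _ _
  clear_value m
  refine Ends.block_assign n ?_ (b₂ := 200 * E.length + 250 * L₁.length + 460 * L₂.length + 57) ?_
    (by simp only [Expr.cost]; omega)
  · simp [Expr.eval, m0]
  refine Ends.block_assign M ?_ (b₂ := 200 * E.length + 250 * L₁.length + 460 * L₂.length + 49) ?_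
    (by simp only [Expr.cost]; omega)
  · rw [← hM]
    refine eval_add (eval_add ?_ ?_ (hX.lt (by omega))) (eval_const hc1) (hX.lt (by omega))
    · simp [Expr.eval, Nat.mod_eq_of_lt hc1, m1]
    · simp [Expr.eval, Nat.mod_eq_of_lt hc2, m2]
  refine Ends.block_assign β ?_ (b₂ := 200 * E.length + 250 * L₁.length + 460 * L₂.length + 43) ?_
    (by simp only [Expr.cost]; omega)
  · rw [← hβ]
    exact eval_mul (eval_const (hX.lt (by omega))) (eval_add (by simp [Expr.eval]) (by simp [Expr.eval])
      (hX.lt (by omega))) (hX.lt (by omega))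
  refine Ends.block_assign 3 (eval_const (hX.lt (by omega)))
    (b₂ := 200 * E.length + 250 * L₁.length + 460 * L₂.length + 41) ?_ (by simp only [Expr.cost]; omega)
  refine Ends.block_assign E.length ?_
    (b₂ := 200 * E.length + 250 * L₁.length + 460 * L₂.length + 37) ?_ (by simp only [Expr.cost]; omega)
  · rw [eval_sub (a := n) (by simp [Expr.eval]) (eval_const hc1)]
    omega
  simp only
  set s₁ : State := ⟨Function.update (Function.update (Function.update (Function.update
    (Function.update (fun _ => 0) 1 n) 2 M) 0 β) 3 3) 4 E.length, m⟩ with hs₁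
  have r0 : s₁.reg 0 = β := by simp [hs₁]
  have r1 : s₁.reg 1 = n := by simp [hs₁]
  have r2 : s₁.reg 2 = M := by simp [hs₁]
  have r3 : s₁.reg 3 = 3 := by simp [hs₁]
  have r4 : s₁.reg 4 = E.length := by simp [hs₁]
  have r5 : s₁.reg 5 = 0 := by simp [hs₁]
  have r9 : s₁.reg 9 = 0 := by simp [hs₁]
  have em : s₁.mem = m := rfl
  clear_value s₁
  refine Ends.block_cons ((readEdges_ends (tail := L₁.flatMap encodeEdge ++
      L₂.flatMap fun q => encodeEdge q.1 ++ encodeEdge q.2) hX hbig (by omega) E s₁ 3 (fun _ => []) r0 r3 r4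
    (by rw [List.length_append, hlen1, hlen2]; omega) (by rw [em]; exact hholds)
    (fun x => Row.nil (by rw [em]; exact hzero 0 x 0)) (fun x => by simp; omega)).mono le_rfl ?_)
    (b₂ := 250 * L₁.length + 460 * L₂.length + 35) (by omega)
  rintro s₂ ⟨a1, a2, a3, a4⟩
  have same₂ : Same β [0, 1] [3, 4, 5, 10, 11, 12] s₁ s₂ := a4.weaken (by simp) (by simp)
  refine Ends.block_assign L₁.length ?_ (b₂ := 250 * L₁.length + 460 * L₂.length + 30) ?_
    (by simp only [Expr.cost]; omega)
  · simp only [Expr.eval, Nat.mod_eq_of_lt hc1]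
    rw [same₂.low 1 (by omega), em, m1]
  have same₃ := same₂.assign (r := 4) (v := L₁.length) (by simp)
  refine Ends.block_cons ((readSingles_ends hX hbig (show n ≤ X by omega) L₁ _ (3 + 2 * E.length) 0 0
    (fun _ _ => []) ((same₃.reg 0 (by simp)).trans r0) (by simpa using a2) (by simp)
    (by simpa using (a4.reg 5 (by simp)).trans r5) (by rw [hlen2]; omega) a3
    (fun x y => Row.nil ((a4.arr 1 (by omega) (by simp) _ 0).trans (by rw [em]; exact hzero 1 _ 0)))
    (fun z => by rw [a4.arr 1 (by omega) (by simp) _ 0, em, hzero]) (by omega) (by omega)).mono le_rfl ?_)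
    (b₂ := 460 * L₂.length + 20) (by omega)
  rintro s₄ ⟨b1, b2, b3, b4, b5, b6⟩
  have same₄ := same₃.trans (b6.weaken (by simp) (List.Subset.refl _))
  refine Ends.block_assign L₂.length ?_ (b₂ := 460 * L₂.length + 10) ?_
    (by simp only [Expr.cost]; omega)
  · simp only [Expr.eval, Nat.mod_eq_of_lt hc2]
    rw [same₄.low 2 (by omega), em, m2]
  have same₅ := same₄.assign (r := 4) (v := L₂.length) (by simp)
  refine Ends.block_cons ((readPairs_ends hX hbig (show n ≤ X by omega) L₂ _
    (3 + 2 * E.length + 2 * L₁.length) (0 + L₁.length) (0 + 2 * L₁.length) _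
    ((same₅.reg 0 (by simp)).trans r0) (by simpa using b3) (by simp)
    (by simpa using b4) (by omega) b5 b1 b2 (by omega) (by omega)).mono le_rfl ?_)
    (b₂ := 1) (by omega)
  rintro s₆ ⟨c1, c2⟩
  have same₆ := same₅.trans (c2.weaken (by simp) (List.Subset.refl _))
  refine Ends.block_nil le_rfl ⟨(same₆.reg 0 (by simp)).trans r0, (same₆.reg 1 (by simp)).trans r1,
    (same₆.reg 2 (by simp)).trans r2, (same₆.reg 9 (by simp)).trans r9, fun x => ?_, fun x y => ?_,
    fun t ht ht' x y => ?_⟩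
  · have h := ((b6.row (s := ⟨Function.update s₂.reg 4 L₁.length, s₂.mem⟩) (a1 x) (by omega) (by simp)))
    have h' := c2.row (s := ⟨Function.update s₄.reg 4 L₂.length, s₄.mem⟩) h (by omega) (by simp)
    simpa using h'
  · have h := c1 x y
    rw [cutLists, cutItems_append]
    simpa [markList] using h
  · rw [same₆.arr t ht' (by simp; omega), em, hzero]

/-! ### Grouping the vertices by their labels -/

/-- Put every vertex into the block of its label, and list the labels that occur. -/
def group : Prog := block
  [.assign 5 (.const 0),
   .loop (.op .lt (.reg 5) (.reg 1)) (block
     [.assign 6 (cellE 5 (.reg 5) (.const 0)),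
      append 6 (.reg 6) (.reg 5),
      .cond (.op .lt (.reg 10) (.const 2)) (append 7 (.const 0) (.reg 6)) .skip,
      .assign 5 (.op .add (.reg 5) (.const 1))])]

/-- Labels serve as row indices, so no sorting is needed; this is why they had to be bounded by `X`.
The separate list of occurring labels avoids scanning the whole range of names. -/
theorem group_loop_ends {w X β n : ℕ} {lab : ℕ → ℕ} (hX : Roomy w X) (hβ : β ≤ X) (hn : n < X)
    (hlab : ∀ x, x < n → lab x ≤ X) (k : ℕ) :
    ∀ (s : State) (i : ℕ) (ls : List ℕ), i + k = n → s.reg 0 = β → s.reg 1 = n → s.reg 5 = i →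
    (∀ x, x < n → s.mem (addr β 5 x 0) = lab x) →
    (∀ l, Row β s.mem 6 l ((List.range i).filter fun x => lab x = l)) →
    Row β s.mem 7 0 ls → ls.Nodup → (∀ l, l ∈ ls ↔ ∃ x, x < i ∧ lab x = l) → ls.length ≤ i →
    Ends w (.loop (.op .lt (.reg 5) (.reg 1)) (block
     [.assign 6 (cellE 5 (.reg 5) (.const 0)),
      append 6 (.reg 6) (.reg 5),
      .cond (.op .lt (.reg 10) (.const 2)) (append 7 (.const 0) (.reg 6)) .skip,
      .assign 5 (.op .add (.reg 5) (.const 1))])) s (200 * k + 4) fun s' => ∃ ls : List ℕ,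
        (∀ l, Row β s'.mem 6 l ((List.range n).filter fun x => lab x = l)) ∧
        Row β s'.mem 7 0 ls ∧ ls.Nodup ∧ (∀ l, l ∈ ls ↔ ∃ x, x < n ∧ lab x = l) ∧ ls.length ≤ n ∧
        s'.reg 0 = β := by
  have hc1 : 1 < 2 ^ w := hX.lt (by have := hX.2; omega)
  have hc2 : 2 < 2 ^ w := hX.lt (by have := hX.2; omega)
  have hc0 : 0 < 2 ^ w := by omega
  induction k with
  | zero =>
    intro s i ls hi h0 h1 h5 _ h6 h7 hnd hmem hlen
    obtain rfl : i = n := by omega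
    refine Ends.loop_done ?_ (by simp [Expr.cost]) ⟨ls, h6, h7, hnd, hmem, hlen, h0⟩
    rw [eval_lt (eval_reg h5) (eval_reg h1), if_neg (by omega)]
  | succ k ih =>
    intro s i ls hi h0 h1 h5 hl h6 h7 hnd hmem hlen
    have hin : i < n := by omega
    have hlabi := hlab i hin
    refine Ends.loop_step (b₁ := 196) (b₂ := 200 * k + 4) ?_ ?_ (by simp only [Expr.cost]; omega)
    · rw [eval_lt (eval_reg h5) (eval_reg h1), if_pos hin]
      omega
    refine Ends.block_assign (lab i) ?_ (b₂ := 170) ?_ (by simp [Expr.cost, cellE, addrE, pairE])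
    · rw [hX.eval_cellE hβ h0 (by omega) (eval_reg h5) (eval_const hc0) (by omega) (by omega)]
      exact hl i hin
    have same₁ : Same β [6, 7] [5, 6, 10, 11, 12] s ⟨Function.update s.reg 6 (lab i), s.mem⟩ :=
      (Same.refl (s := ⟨s.reg, s.mem⟩)).assign (by simp)
    have hflen : ((List.range i).filter fun x => lab x = lab i).length ≤ i :=
      (List.length_filter_le _ _).trans (by simp)
    refine Ends.block_cons ((append_ends hX hβ (t := 6) (a := lab i) (b := i) (by omega) (by simpa using h0)
      (by simp [Expr.eval]) (by simpa [Expr.eval] using h5) (by omega)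
      (by simp only; rw [(h6 _).1]; omega)).mono le_rfl ?_)
      (b₂ := 100) (by simp [Expr.cost])
    rintro s₂ ⟨g1, g2, g3⟩
    simp only at g1 g2
    rw [(h6 _).1] at g2
    have same₂ := same₁.trans (g3.weaken (ts' := [6, 7]) (rs' := [5, 6, 10, 11, 12]) (by simp) (by simp))
    have hrange : ∀ l, (List.range (i + 1)).filter (fun x => lab x = l) =
        (List.range i).filter (fun x => lab x = l) ++ if l = lab i then [i] else [] := by
      intro l
      rw [List.range_succ, List.filter_append]
      congr 1
      by_cases h : l = lab i
      · simp [h]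
      · have h' : ¬ lab i = l := fun h' => h h'.symm
        simp [h, h']
    have h6₂ : ∀ l, Row β s₂.mem 6 l ((List.range (i + 1)).filter fun x => lab x = l) := by
      intro l
      have h := (h6 l).push (t := 6) (x := lab i) (v := i) (by omega) (by omega)
      rw [← g1] at h
      rw [hrange]
      simp only [true_and] at h
      split_ifs at h ⊢
      · exact h
      · simpa using h
    have h7₂ : Row β s₂.mem 7 0 ls :=
      g3.row (s := ⟨Function.update s.reg 6 (lab i), s.mem⟩) h7 (by omega) (by simp)
    have r6 : s₂.reg 6 = lab i := (g3.reg 6 (by simp)).trans (by simp)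
    have r5 : s₂.reg 5 = i := (g3.reg 5 (by simp)).trans (by simpa using h5)
    have r0 : s₂.reg 0 = β := (same₂.reg 0 (by simp)).trans h0
    have hempty : ((List.range i).filter fun x => lab x = lab i).length = 0 ↔ lab i ∉ ls := by
      rw [List.length_eq_zero_iff, List.filter_eq_nil_iff, hmem]
      simp
    -- Register 10 still holds the new length of the row just appended to. It is below 2 iff the row
    -- was empty before, that is, iff the label is new.
    have hcond : (Expr.op .lt (.reg 10) (.const 2)).eval w s₂ ≠ 0 ↔ lab i ∉ ls := by
      rw [eval_lt (eval_reg g2) (eval_const hc2), ← hempty]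
      split_ifs <;> omega
    have hmem' : ∀ l, (∃ x, x < i + 1 ∧ lab x = l) ↔ l ∈ ls ∨ l = lab i := by
      intro l
      rw [hmem]
      constructor
      · rintro ⟨x, hx, rfl⟩
        rcases Nat.lt_succ_iff_lt_or_eq.1 hx with h | rfl
        · exact Or.inl ⟨x, h, rfl⟩
        · exact Or.inr rfl
      · rintro (⟨x, hx, rfl⟩ | rfl)
        · exact ⟨x, by omega, rfl⟩
        · exact ⟨i, by omega, rfl⟩
    refine Ends.block_cons (b₁ := 90) (b₂ := 10) (Ends.mono (Q := fun s₃ => ∃ ls' : List ℕ,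
      Row β s₃.mem 7 0 ls' ∧ ls'.Nodup ∧ (∀ l, l ∈ ls' ↔ ∃ x, x < i + 1 ∧ lab x = l) ∧
      ls'.length ≤ i + 1 ∧ Same β [7] [10, 11, 12] s₂ s₃)
      (Ends.cond (c := 80) (fun hc => ?_) (fun hc => ?_) (by simp [Expr.cost])) le_rfl ?_) le_rfl
    · have hnew := hcond.1 hc
      refine (append_ends hX hβ (t := 7) (a := 0) (b := lab i) (by omega) r0 (eval_const hc0)
        (by simpa [Expr.eval] using r6) (by omega) (by rw [h7₂.1]; omega)).mono
        (by simp [Expr.cost]) ?_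
      rintro s₃ ⟨k1, -, k3⟩
      have h := h7₂.push (t := 7) (x := 0) (v := lab i) (by omega) (by omega)
      rw [← k1, if_pos ⟨rfl, rfl⟩] at h
      refine ⟨ls ++ [lab i], h, ?_, fun l => ?_, by simp; omega, k3⟩
      · rw [List.nodup_append]
        refine ⟨hnd, by simp, ?_⟩
        rintro a ha b hb rfl
        rw [List.mem_singleton] at hb
        exact hnew (hb ▸ ha)
      · rw [hmem', List.mem_append, List.mem_singleton]
    · have hold : lab i ∈ ls := by
        by_contra h
        exact hcond.2 h hc
      refine Ends.skip (by omega) ⟨ls, h7₂, hnd, fun l => ?_, by omega, Same.refl⟩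
      rw [hmem']
      constructor
      · exact Or.inl
      · rintro (h | rfl)
        · exact h
        · exact hold
    rintro s₃ ⟨ls', k1, k2, k3, k4, k5⟩
    have r5₃ : s₃.reg 5 = i := (k5.reg 5 (by simp)).trans r5
    refine Ends.block_assign (i + 1) (eval_add (eval_reg r5₃) (eval_const hc1) (hX.lt (by omega)))
      (b₂ := 1) ?_ (by simp [Expr.cost])
    have same₃ := (same₂.trans (k5.weaken (ts' := [6, 7]) (rs' := [5, 6, 10, 11, 12]) (by simp)
      (by simp))).assign (r := 5) (v := i + 1) (by simp)
    refine Ends.block_nil le_rfl (ih _ (i + 1) ls' (by omega) ((same₃.reg 0 (by simp)).trans h0)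
      ((same₃.reg 1 (by simp)).trans h1) (by simp)
      (fun x hx => (same₃.arr 5 (by omega) (by simp) x 0).trans (hl x hx))
      (fun l => ?_) k1 k2 k3 k4)
    exact k5.row (h6₂ l) (by omega) (by simp)

/-! ### Writing the output -/

/-- Between `s` and `s'` the list `l` is written from the address in register `3` on, and only
registers in `rs` change. -/
structure Emit (β : ℕ) (rs l : List ℕ) (s s' : State) : Prop where
  reg : ∀ r, r ∉ rs → s'.reg r = s.reg r
  arr : ∀ t x y, s'.mem (addr β t x y) = s.mem (addr β t x y)
  low : ∀ i, i < s.reg 3 → s'.mem i = s.mem i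
  out : Holds s'.mem (s.reg 3) l
  ptr : s'.reg 3 = s.reg 3 + l.length

theorem Emit.trans {β : ℕ} {rs l l' : List ℕ} {s s' s'' : State} (h : Emit β rs l s s')
    (h' : Emit β rs l' s' s'') : Emit β rs (l ++ l') s s'' := by
  have hp := h.ptr
  refine ⟨fun r hr => (h'.reg r hr).trans (h.reg r hr), fun t x y => (h'.arr t x y).trans (h.arr t x y),
    fun i hi => (h'.low i (by omega)).trans (h.low i hi), fun i hi => ?_, ?_⟩
  · rcases Nat.lt_or_ge i l.length with hil | hil
    · rw [h'.low _ (by omega), h.out i hil, List.getElem_append_left hil]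
    · rw [List.getElem_append_right hil, ← h'.out (i - l.length) (by simp at hi; omega), hp]
      congr 1
      omega
  · rw [h'.ptr, hp, List.length_append]
    omega

theorem Emit.weaken {β : ℕ} {rs rs' l : List ℕ} {s s' : State} (h : Emit β rs l s s')
    (hr : rs ⊆ rs') : Emit β rs' l s s' :=
  ⟨fun r h1 => h.reg r fun h2 => h1 (hr h2), h.arr, h.low, h.out, h.ptr⟩

theorem Emit.assign {β : ℕ} {rs l : List ℕ} {s s' : State} {r v : ℕ} (h : Emit β rs l s s')
    (hr : r ∈ rs) (h3 : r ≠ 3) : Emit β rs l s ⟨Function.update s'.reg r v, s'.mem⟩ := by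
  refine ⟨fun r' hr' => ?_, h.arr, h.low, h.out, ?_⟩
  · have : r' ≠ r := by rintro rfl; exact hr' hr
    simpa [this] using h.reg r' hr'
  · simpa [h3.symm] using h.ptr

theorem Emit.refl {β : ℕ} {rs : List ℕ} {s : State} : Emit β rs [] s s :=
  ⟨fun _ _ => rfl, fun _ _ _ => rfl, fun _ _ => rfl, fun _ hi => absurd hi (Nat.not_lt_zero _), rfl⟩

/-- Write the value of `e`. -/
def emit (e : Expr) : Prog := block [.store (.reg 3) e, .assign 3 (.op .add (.reg 3) (.const 1))]

/-- The output overwrites the input, which is no longer needed; staying below `β` leaves the arrays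
intact. -/
theorem emit_ends {w X β v : ℕ} {e : Expr} {s : State} (hX : Roomy w X) (hβ : β ≤ X)
    (h3 : s.reg 3 < β) (he : e.eval w s = v) :
    Ends w (emit e) s (e.cost + 7) (Emit β [3] [v] s) := by
  have hc1 : 1 < 2 ^ w := hX.lt (by have := hX.2; omega)
  refine Ends.block_store (s.reg 3) v rfl he (b₂ := 5) ?_ (by simp only [Expr.cost]; omega)
  refine Ends.block_assign (s.reg 3 + 1) (eval_add rfl (eval_const hc1) (hX.lt (by omega)))
    (b₂ := 1) (Ends.block_nil le_rfl ⟨fun r hr => ?_, fun t x y => ?_, fun i hi => ?_, ?_, by simp⟩)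
    (by simp [Expr.cost])
  · have : r ≠ 3 := by simpa using hr
    simp [this]
  · refine Function.update_of_ne ?_ _ _
    have := le_addr β t x y
    omega
  · exact Function.update_of_ne (by omega) _ _
  · intro i hi
    obtain rfl : i = 0 := by simpa using hi
    simp

/-- Write the elements of the block whose label is in register `5`. -/
def emitRow : Prog := .loop (.op .lt (.reg 6) (cellE 6 (.reg 5) (.const 0))) (block
  [.assign 6 (.op .add (.reg 6) (.const 1)), emit (cellE 6 (.reg 5) (.reg 6))])

theorem emitRow_ends {w X β l : ℕ} (hX : Roomy w X) (hβ : β ≤ X) (hl : l ≤ X) (rest : List ℕ) :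
    ∀ (s : State) (done : List ℕ), s.reg 0 = β → s.reg 5 = l → s.reg 6 = done.length →
    Row β s.mem 6 l (done ++ rest) → (done ++ rest).length ≤ X → s.reg 3 + rest.length ≤ β →
    Ends w emitRow s (100 * rest.length + 30) (Emit β [3, 6] rest s) := by
  have hc1 : 1 < 2 ^ w := hX.lt (by have := hX.2; omega)
  have hc0 : 0 < 2 ^ w := by omega
  induction rest with
  | nil =>
    intro s done h0 h5 h6 hrow hlen _
    rw [List.append_nil] at hrow
    refine Ends.loop_done ?_ (by simp [Expr.cost, cellE, addrE, pairE]) Emit.refl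
    rw [eval_lt (eval_reg h6) (hX.eval_cellE hβ h0 (by omega) (eval_reg h5) (eval_const hc0) (by omega)
      (by omega)), hrow.1, if_neg (by omega)]
  | cons a rest ih =>
    intro s done h0 h5 h6 hrow hlen h3
    rw [List.length_append, List.length_cons] at hlen
    rw [List.length_cons] at h3
    refine Ends.loop_step (b₁ := 50) (b₂ := 100 * rest.length + 30) ?_ ?_
      (by simp [Expr.cost, cellE, addrE, pairE]; omega)
    · rw [eval_lt (eval_reg h6) (hX.eval_cellE hβ h0 (by omega) (eval_reg h5) (eval_const hc0) (by omega)
        (by omega)), hrow.1, if_pos (by simp)]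
      omega
    refine Ends.block_assign (done.length + 1) (eval_add (eval_reg h6) (eval_const hc1) (hX.lt (by omega)))
      (b₂ := 30) ?_ (by simp [Expr.cost])
    have hs : Emit β [3, 6] [] s ⟨Function.update s.reg 6 (done.length + 1), s.mem⟩ :=
      (Emit.refl (s := ⟨s.reg, s.mem⟩)).assign (by simp) (by simp)
    refine Ends.block_cons ((emit_ends (β := β) (v := a) hX hβ (by simp; omega) ?_).mono le_rfl ?_) (b₂ := 1)
      (by simp [Expr.cost, cellE, addrE, pairE])
    · rw [hX.eval_cellE (a := l) (b := done.length + 1) hβ (by simpa using h0) (by omega)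
        (by simpa [Expr.eval] using h5) (by simp [Expr.eval]) (by omega) (by omega)]
      simp only
      rw [hrow.2 done.length (by simp)]
      simp
    intro s₁ e₁
    have e₁' := hs.trans (e₁.weaken (rs' := [3, 6]) (by simp))
    rw [List.nil_append] at e₁'
    have e3 := e₁'.ptr
    refine Ends.block_nil le_rfl ((ih s₁ (done ++ [a]) ((e₁'.reg 0 (by simp)).trans h0)
      ((e₁'.reg 5 (by simp)).trans h5) ?_ ?_ ?_ ?_).mono le_rfl ?_)
    · rw [e₁.reg 6 (by simp)]; simp
    · rw [List.append_assoc, List.singleton_append]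
      exact hrow.congr fun y => e₁'.arr 6 l y
    · simp; omega
    · simp at e3; omega
    · intro s₂ e₂
      exact e₁'.trans e₂

/-- Write the blocks. -/
def emitRows : Prog := .loop (.op .lt (.reg 4) (cellE 7 (.const 0) (.const 0))) (block
  [.assign 4 (.op .add (.reg 4) (.const 1)),
   .assign 5 (cellE 7 (.const 0) (.reg 4)),
   emit (cellE 6 (.reg 5) (.const 0)),
   .assign 6 (.const 0),
   emitRow])

theorem emitRows_ends {w X β : ℕ} {row : ℕ → List ℕ} (hX : Roomy w X) (hβ : β ≤ X)
    (hrowX : ∀ l, (row l).length ≤ X) (rest : List ℕ) :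
    ∀ (s : State) (done : List ℕ), s.reg 0 = β → s.reg 4 = done.length →
    Row β s.mem 7 0 (done ++ rest) → (∀ l, Row β s.mem 6 l (row l)) → (∀ l ∈ rest, l ≤ X) →
    (done ++ rest).length ≤ X →
    s.reg 3 + (rest.flatMap fun l => (row l).length :: row l).length ≤ β →
    Ends w emitRows s (200 * (rest.flatMap fun l => (row l).length :: row l).length + 30)
      (Emit β [3, 4, 5, 6] (rest.flatMap fun l => (row l).length :: row l) s) := by
  have hc1 : 1 < 2 ^ w := hX.lt (by have := hX.2; omega)
  have hc0 : 0 < 2 ^ w := by omega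
  induction rest with
  | nil =>
    intro s done h0 h4 h7 h6 _ hlen _
    rw [List.append_nil] at h7
    refine Ends.loop_done ?_ (by simp [Expr.cost, cellE, addrE, pairE]) Emit.refl
    rw [eval_lt (eval_reg h4) (hX.eval_cellE hβ h0 (by omega) (eval_const hc0) (eval_const hc0) (by omega)
      (by omega)), h7.1, if_neg (by omega)]
  | cons l rest ih =>
    intro s done h0 h4 h7 h6 hrest hlen h3
    have hl : l ≤ X := hrest l (by simp)
    rw [List.length_append, List.length_cons] at hlen
    have hrl := hrowX l
    simp only [List.flatMap_cons, List.length_append, List.length_cons] at h3 ⊢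
    obtain ⟨R, hR⟩ : ∃ R, (rest.flatMap fun l => (row l).length :: row l).length = R := ⟨_, rfl⟩
    rw [hR] at h3 ⊢
    refine Ends.loop_step (b₁ := 100 * (row l).length + 150) (b₂ := 200 * R + 30) ?_ ?_
      (by simp [Expr.cost, cellE, addrE, pairE]; omega)
    · rw [eval_lt (eval_reg h4) (hX.eval_cellE hβ h0 (by omega) (eval_const hc0) (eval_const hc0) (by omega)
        (by omega)), h7.1, if_pos (by simp)]
      omega
    refine Ends.block_assign (done.length + 1) (eval_add (eval_reg h4) (eval_const hc1) (hX.lt (by omega)))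
      (b₂ := 100 * (row l).length + 140) ?_ (by simp [Expr.cost]; omega)
    refine Ends.block_assign l ?_ (b₂ := 100 * (row l).length + 90) ?_
      (by simp [Expr.cost, cellE, addrE, pairE]; omega)
    · rw [hX.eval_cellE (b := done.length + 1) hβ (by simpa using h0) (by omega) (eval_const hc0)
        (by simp [Expr.eval]) (by omega) (by omega)]
      simp only
      rw [h7.2 done.length (by simp)]
      simp
    have hs₁ : Emit β [3, 4, 5, 6] [] s
        ⟨Function.update (Function.update s.reg 4 (done.length + 1)) 5 l, s.mem⟩ :=
      ((Emit.refl (s := ⟨s.reg, s.mem⟩)).assign (by simp) (by simp)).assign (by simp) (by simp)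
    refine Ends.block_cons ((emit_ends (β := β) (v := (row l).length) hX hβ (by simp; omega) ?_).mono
      le_rfl ?_) (b₂ := 100 * (row l).length + 50)
      (by simp [Expr.cost, cellE, addrE, pairE]; omega)
    · rw [hX.eval_cellE (a := l) hβ (by simpa using h0) (by omega) (by simp [Expr.eval])
        (eval_const hc0) (by omega) (by omega)]
      exact (h6 l).1
    intro s₂ e₂
    have hs₂ := hs₁.trans (e₂.weaken (rs' := [3, 4, 5, 6]) (by simp))
    rw [List.nil_append] at hs₂
    refine Ends.block_assign 0 (eval_const hc0) (b₂ := 100 * (row l).length + 40) ?_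
      (by simp [Expr.cost]; omega)
    have hs₃ := hs₂.assign (r := 6) (v := 0) (by simp) (by simp)
    have p₃ := hs₃.ptr
    simp only [List.length_singleton] at p₃
    refine Ends.block_cons ((emitRow_ends (l := l) hX hβ hl (row l) _ [] ((hs₃.reg 0 (by simp)).trans h0)
      ?_ (by simp) ((h6 l).congr fun y => hs₃.arr 6 l y) (by simpa using hrl)
      (by simp only; omega)).mono le_rfl ?_) (b₂ := 1) (by omega)
    · simp only [Function.update_apply]
      rw [if_neg (by omega), e₂.reg 5 (by simp)]
      simp
    intro s₄ e₄
    have r4 : s₄.reg 4 = done.length + 1 := by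
      rw [e₄.reg 4 (by simp)]
      simp only [Function.update_apply]
      rw [if_neg (by omega), e₂.reg 4 (by simp)]
      simp
    have hs₄ := hs₃.trans (e₄.weaken (rs' := [3, 4, 5, 6]) (by simp))
    rw [List.singleton_append] at hs₄
    have p₄ := hs₄.ptr
    rw [List.length_cons] at p₄
    refine Ends.block_nil le_rfl ((ih s₄ (done ++ [l]) ((hs₄.reg 0 (by simp)).trans h0) (by simp [r4])
      ?_ (fun x => (h6 x).congr fun y => hs₄.arr 6 x y)
      (fun x hx => hrest x (List.mem_cons_of_mem _ hx)) (by simp; omega)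
      (by rw [hR]; omega)).mono (by rw [hR]) ?_)
    · rw [List.append_assoc, List.singleton_append]
      exact h7.congr fun y => hs₄.arr 7 0 y
    · intro s₅ e₅
      exact hs₄.trans e₅

/-- Write the output. -/
def writeOutput : Prog := block
  [.assign 3 (.const 0), emit (cellE 7 (.const 0) (.const 0)), .assign 4 (.const 0), emitRows]

theorem writeOutput_ends {w X β : ℕ} {row : ℕ → List ℕ} {ls : List ℕ} {s : State} (hX : Roomy w X)
    (hβ : β ≤ X) (hrowX : ∀ l, (row l).length ≤ X) (h0 : s.reg 0 = β) (h7 : Row β s.mem 7 0 ls)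
    (h6 : ∀ l, Row β s.mem 6 l (row l)) (hls : ∀ l ∈ ls, l ≤ X) (hlen : ls.length ≤ X)
    (hout : 1 + (ls.flatMap fun l => (row l).length :: row l).length ≤ β) :
    Ends w writeOutput s (200 * (ls.flatMap fun l => (row l).length :: row l).length + 80) fun s' =>
      HasOutput s' (ls.length :: ls.flatMap fun l => (row l).length :: row l) := by
  have hc0 : 0 < 2 ^ w := hX.lt (by omega)
  obtain ⟨R, hR⟩ : ∃ R, (ls.flatMap fun l => (row l).length :: row l).length = R := ⟨_, rfl⟩
  rw [hR] at hout ⊢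
  refine Ends.block_assign 0 (eval_const hc0) (b₂ := 200 * R + 78) ?_ (by simp only [Expr.cost]; omega)
  refine Ends.block_cons ((emit_ends (β := β) (v := ls.length) hX hβ (by simp; omega) ?_).mono
    le_rfl ?_) (b₂ := 200 * R + 40) (by simp [Expr.cost, cellE, addrE, pairE]; omega)
  · rw [hX.eval_cellE hβ (by simpa using h0) (by omega) (eval_const hc0) (eval_const hc0) (by omega)
      (by omega)]
    exact h7.1
  intro s₁ e₁
  have e₂ := (e₁.weaken (rs' := [3, 4, 5, 6]) (by simp)).assign (r := 4) (v := 0) (by simp) (by simp)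
  have p₂ := e₂.ptr
  simp only [Function.update_self, List.length_singleton] at p₂
  refine Ends.block_assign 0 (eval_const hc0) (b₂ := 200 * R + 38) ?_ (by simp only [Expr.cost]; omega)
  refine Ends.block_cons ((emitRows_ends hX hβ hrowX ls _ [] ((e₂.reg 0 (by simp)).trans
    (by simpa using h0)) (by simp) (h7.congr fun y => e₂.arr 7 0 y)
    (fun l => (h6 l).congr fun y => e₂.arr 6 l y) hls (by simpa using hlen)
    (by rw [hR]; simp only; omega)).mono le_rfl ?_) (b₂ := 1) (by rw [hR]; omega)
  intro s₃ e₃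
  refine Ends.block_nil le_rfl ?_
  intro i hi
  have h := (e₂.trans e₃).out i hi
  simpa using h

theorem group_ends {w X β n : ℕ} {lab : ℕ → ℕ} {s : State} (hX : Roomy w X) (hβ : β ≤ X) (hn : n < X)
    (hlab : ∀ x, x < n → lab x ≤ X) (h0 : s.reg 0 = β) (h1 : s.reg 1 = n)
    (h5 : ∀ x, x < n → s.mem (addr β 5 x 0) = lab x)
    (hz : ∀ t, 6 ≤ t → t < 8 → ∀ x y, s.mem (addr β t x y) = 0) :
    Ends w group s (200 * n + 10) fun s' => ∃ ls : List ℕ,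
        (∀ l, Row β s'.mem 6 l ((List.range n).filter fun x => lab x = l)) ∧
        Row β s'.mem 7 0 ls ∧ ls.Nodup ∧ (∀ l, l ∈ ls ↔ ∃ x, x < n ∧ lab x = l) ∧ ls.length ≤ n ∧
        s'.reg 0 = β := by
  refine Ends.block_assign 0 (eval_const (hX.lt (by omega))) (b₂ := 200 * n + 8) ?_
    (by simp only [Expr.cost]; omega)
  refine Ends.block_cons ((group_loop_ends hX hβ hn hlab n
    ⟨Function.update s.reg 5 0, s.mem⟩ 0 [] (by omega) (by simpa using h0)
    (by simpa using h1) (by simp) h5 (fun l => ?_) (Row.nil (hz 7 (by omega) (by omega) 0 0))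
    (by simp) (by simp) (by simp)).mono (b' := 200 * n + 4) le_rfl fun s' h => Ends.block_nil (b := 1) le_rfl h) (by omega)
  simpa using Row.nil (hz 6 (by omega) (by omega) l 0)

/-- The algorithm. -/
def meetProg : Prog := block [readInput, walk, group, writeOutput]

/-- Rows of distinct labels are disjoint. This bounds the length of the output, and with it the time
for writing, linearly in the number of vertices. -/
theorem sum_length_filter_le {ls : List ℕ} (hls : ls.Nodup) (lab : ℕ → ℕ) (xs : List ℕ) :
    (ls.map fun l => (xs.filter fun x => lab x = l).length).sum ≤ xs.length := by
  induction xs with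
  | nil => simp
  | cons x xs ih =>
    have h : (ls.map fun l => ((x :: xs).filter fun x => lab x = l).length).sum =
        (ls.map fun l => (xs.filter fun x => lab x = l).length).sum + ls.count (lab x) := by
      clear ih hls
      induction ls with
      | nil => rfl
      | cons l ls ih =>
        have hl : ((x :: xs).filter fun x => lab x = l).length =
            (xs.filter fun x => lab x = l).length + if l = lab x then 1 else 0 := by
          rw [List.filter_cons]
          by_cases hl : lab x = l
          · simp [hl]
          · have hl' : ¬ l = lab x := fun h => hl h.symm
            simp [hl, hl']
        rw [List.map_cons, List.sum_cons, List.map_cons, List.sum_cons, ih, hl, List.count_cons]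
        simp only [beq_iff_eq]
        omega
    have := List.nodup_iff_count_le_one.1 hls (lab x)
    rw [h, List.length_cons]
    omega

end WordRAM

/-! ### The sides of the cuts as bit vectors -/

namespace TreeCuts

open WordRAM

section
variable {n : ℕ} {T : SimpleGraph (Fin n)}

theorem Lists.length_eq_card {α β : Type*} [DecidableEq β] {f : α → β} {L : List α} {A : Finset β}
    (h : Lists f L (A : Set β)) : L.length = A.card := by
  have e : (L.map f).toFinset = A := by
    ext b
    rw [List.mem_toFinset, h.2 b, Finset.mem_coe]
  rw [← e, List.toFinset_card_of_nodup h.1, List.length_map]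

theorem length_edges (hT : T.IsTree) {E : List (Fin n × Fin n)} (hE : Lists edgeOf E T.edgeSet) :
    E.length + 1 = n := by
  classical
  have hE' : Lists edgeOf E (T.edgeFinset : Set (Sym2 (Fin n))) := by simpa using hE
  have := hT.card_edgeFinset
  rw [hE'.length_eq_card, this, Fintype.card_fin]

/-- Used for |C₂| ≤ |E|²: the heap has at most n² leaves, so its depth is O(log n) whatever the
number of cuts. -/
theorem card_pairs_le {V : Type*} [DecidableEq V] (A : Finset V) {C : Finset (Sym2 V)}
    (h : ∀ q ∈ C, ∀ e ∈ q, e ∈ A) : C.card ≤ A.card * A.card := by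
  rw [← Finset.card_product]
  refine (Finset.card_le_card (t := (A ×ˢ A).image fun p => s(p.1, p.2)) fun q hq => ?_).trans
    Finset.card_image_le
  induction q using Sym2.ind with
  | _ a b =>
    exact Finset.mem_image.2 ⟨(a, b), Finset.mem_product.2
      ⟨h _ hq a (Sym2.mem_mk_left a b), h _ hq b (Sym2.mem_mk_right a b)⟩, rfl⟩

theorem adjList_connected (hT : T.Connected) {E : List (Fin n × Fin n)}
    (hE : Lists edgeOf E T.edgeSet) (hn : 0 < n) (A : ℕ → Prop) (h0 : A 0)
    (hA : ∀ x y, A x → y ∈ adjList E x → A y) (x : ℕ) (hx : x < n) : A x := by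
  have key : ∀ {u v : Fin n}, T.Walk u v → A u → A v := by
    intro u v p
    induction p with
    | nil => exact id
    | @cons u v z huv _ ih =>
      intro hu
      exact ih (hA _ _ hu ((mem_adjList hE).2 ⟨u.2, v.2, huv⟩))
  obtain ⟨p⟩ := hT.preconnected ⟨0, hn⟩ ⟨x, hx⟩
  exact key p h0

theorem exists_mem_of_mem_cutItems {j : ℕ} {l : List (List (Fin n × Fin n))}
    {p : (Fin n × Fin n) × ℕ} (h : p ∈ cutItems j l) : ∃ F ∈ l, p.1 ∈ F := by
  induction l generalizing j with
  | nil => simp [cutItems] at h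
  | cons F l ih =>
    simp only [cutItems, List.mem_append, List.mem_map] at h
    rcases h with ⟨q, hq, rfl⟩ | h
    · exact ⟨F, by simp, hq⟩
    · obtain ⟨G, hG, hp⟩ := ih h
      exact ⟨G, List.mem_cons_of_mem _ hG, hp⟩

theorem mem_markList {I : List ((Fin n × Fin n) × ℕ)} {x y j : ℕ} (h : j ∈ markList I x y) :
    ∃ p ∈ I, p.2 = j ∧
      ((x = p.1.1 ∧ y = p.1.2) ∨ (x = p.1.2 ∧ y = p.1.1)) := by
  obtain ⟨p, hp, h⟩ := List.mem_flatMap.1 h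
  refine ⟨p, hp, ?_⟩
  rw [List.mem_append] at h
  rcases h with h | h
  · split_ifs at h with h1
    · exact ⟨(List.mem_singleton.1 h).symm, Or.inl h1⟩
    · exact absurd h (by simp)
  · split_ifs at h with h1
    · exact ⟨(List.mem_singleton.1 h).symm, Or.inr h1⟩
    · exact absurd h (by simp)

/-- The vectors that tell on which side of the cuts a vertex lies, compared with the vertex `0`. -/
noncomputable def sideBit (m : ℕ) (S : Fin m → Set (Fin n)) (x j : ℕ) : ℕ :=
  open Classical in
  if h : x < n ∧ 0 < j ∧ j ≤ m then
    if (⟨x, h.1⟩ ∈ S ⟨j - 1, by omega⟩ ↔ ⟨0, by omega⟩ ∈ S ⟨j - 1, by omega⟩) then 0 else 1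
  else 0

theorem sideBit_le (m : ℕ) (S : Fin m → Set (Fin n)) (x j : ℕ) : sideBit m S x j ≤ 1 := by
  unfold sideBit
  split_ifs <;> omega

theorem sideBit_zero (m : ℕ) (S : Fin m → Set (Fin n)) (j : ℕ) : sideBit m S 0 j = 0 := by
  unfold sideBit
  split_ifs with h1 h2
  · rfl
  · simp at h2
  · rfl

/-- Both bits are comparisons with the side of the vertex 0, which drops out. The shift to `i + 1`
reflects the idle bit 0. -/
theorem sideBit_eq_iff {m : ℕ} {S : Fin m → Set (Fin n)} (x y : Fin n) (i : Fin m) :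
    sideBit m S x (i + 1) = sideBit m S y (i + 1) ↔ (x ∈ S i ↔ y ∈ S i) := by
  have h : ∀ z : Fin n, (z : ℕ) < n ∧ 0 < (i : ℕ) + 1 ∧ (i : ℕ) + 1 ≤ m := fun z => ⟨z.2, by omega, i.2⟩
  unfold sideBit
  rw [dif_pos (h x), dif_pos (h y)]
  simp only [Nat.add_sub_cancel, Fin.eta]
  split_ifs <;> simp <;> tauto

/-- Adjacent vertices differ in bit `i + 1` iff their edge lies in the boundary of `S i`, that is,
in the list of cut `i`. As this list has no repetition, the number of marks `i + 1` on the edge is 0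
or 1 and records exactly this. The bit 0 is constant, and no mark is 0. -/
theorem markedTree {E : List (Fin n × Fin n)} (hE : Lists edgeOf E T.edgeSet)
    {cuts : List (List (Fin n × Fin n))} (hnd : ∀ F ∈ cuts, (F.map edgeOf).Nodup)
    (hcuts : ∀ F ∈ cuts, ∀ p ∈ F, T.Adj p.1 p.2) (S : Fin cuts.length → Set (Fin n))
    (hS : ∀ i, boundary T (S i) = {e | e ∈ (cuts[i]).map edgeOf}) :
    MarkedTree n (cuts.length + 1) (adjList E) (markList (cutItems 0 cuts))
      (sideBit cuts.length S) where
  lt h := by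
    obtain ⟨hx, hy, -⟩ := (mem_adjList hE).1 h
    exact ⟨hx, hy⟩
  ne h := by
    obtain ⟨hx, hy, hadj⟩ := (mem_adjList hE).1 h
    rintro rfl
    exact hadj.ne rfl
  symm h := by
    obtain ⟨hx, hy, hadj⟩ := (mem_adjList hE).1 h
    exact (mem_adjList hE).2 ⟨hy, hx, hadj.symm⟩
  mark_self x := by
    rw [List.eq_nil_iff_forall_not_mem]
    intro j hj
    obtain ⟨p, hp, -, h⟩ := mem_markList hj
    obtain ⟨F, hF, hpF⟩ := exists_mem_of_mem_cutItems hp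
    have hne := (hcuts F hF _ hpF).ne
    refine hne (Fin.ext ?_)
    rcases h with h | h
    · rw [← h.1, ← h.2]
    · rw [← h.1, ← h.2]
  mark_lt x y j hj := by
    obtain ⟨p, hp, rfl, -⟩ := mem_markList hj
    have := mark_mem_cutItems hp
    omega
  mark_symm x y := length_markList_comm _ x y
  bit_le := sideBit_le _ S
  bit_zero := sideBit_zero _ S
  step {x y} h j hj := by
    obtain ⟨hx, hy, hadj⟩ := (mem_adjList hE).1 h
    rcases Nat.eq_zero_or_pos j with rfl | hj0
    · have hc : (markList (cutItems 0 cuts) x y).count 0 = 0 := by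
        rw [List.count_eq_zero]
        intro h0
        obtain ⟨p, hp, h2, -⟩ := mem_markList h0
        have := mark_mem_cutItems hp
        omega
      simp [hc, sideBit]
    · obtain ⟨i, rfl⟩ : ∃ i, j = i + 1 := ⟨j - 1, by omega⟩
      have hi : i < cuts.length := by omega
      have h1 := count_markList (cutItems 0 cuts) (x := ⟨x, hx⟩) (y := ⟨y, hy⟩) hadj.ne (i + 1)
      have h2 := countP_cutItems 0 i cuts hi s(⟨x, hx⟩, ⟨y, hy⟩)
      rw [show 0 + 1 + i = i + 1 by omega] at h2
      rw [h2] at h1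
      simp only at h1
      rw [h1]
      have h3 := sideBit_eq_iff (S := S) ⟨x, hx⟩ ⟨y, hy⟩ ⟨i, hi⟩
      have h4 := sideBit_le cuts.length S x (i + 1)
      have h5 := sideBit_le cuts.length S y (i + 1)
      simp only at h3
      have h6 : s((⟨x, hx⟩ : Fin n), ⟨y, hy⟩) ∈ (cuts[i]).map edgeOf ↔
          ¬ (⟨x, hx⟩ ∈ S ⟨i, hi⟩ ↔ ⟨y, hy⟩ ∈ S ⟨i, hi⟩) := by
        have : s((⟨x, hx⟩ : Fin n), ⟨y, hy⟩) ∈ boundary T (S ⟨i, hi⟩) ↔ _ := mk_mem_boundary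
        rw [hS ⟨i, hi⟩] at this
        simpa [hadj] using this
      by_cases hm : s((⟨x, hx⟩ : Fin n), ⟨y, hy⟩) ∈ (cuts[i]).map edgeOf
      · rw [List.count_eq_one_of_mem (hnd _ (List.getElem_mem hi)) hm]
        have : sideBit cuts.length S x (i + 1) ≠ sideBit cuts.length S y (i + 1) :=
          fun he => (h6.1 hm) (h3.1 he)
        omega
      · rw [List.count_eq_zero_of_not_mem hm]
        have := h3.2 (not_not.1 fun he => hm (h6.2 he))
        omega

end

/-! ### Correctness and running time of the whole algorithm -/

section
variable {n : ℕ} {T : SimpleGraph (Fin n)} {C₁ : Finset (Sym2 (Fin n))}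
  {C₂ : Finset (Sym2 (Sym2 (Fin n)))} {E L₁ : List (Fin n × Fin n)}
  {L₂ : List ((Fin n × Fin n) × (Fin n × Fin n))}

theorem setOf_mem_map_edgeOf_cutLists (h₁ : Lists edgeOf L₁ (C₁ : Set (Sym2 (Fin n))))
    (h₂ : Lists edgePairOf L₂ (C₂ : Set (Sym2 (Sym2 (Fin n))))) (A : Set (Sym2 (Fin n))) :
    (∃ F ∈ cutLists L₁ L₂, A = {e | e ∈ F.map edgeOf}) ↔
      (∃ e ∈ C₁, A = {e}) ∨ (∃ q ∈ C₂, A = {e | e ∈ q}) := by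
  have e1 : ∀ p : Fin n × Fin n, {e | e ∈ [p].map edgeOf} = ({edgeOf p} : Set (Sym2 (Fin n))) := by
    intro p
    ext e
    exact List.mem_singleton
  have e2 : ∀ q : (Fin n × Fin n) × (Fin n × Fin n),
      {e | e ∈ [q.1, q.2].map edgeOf} = {e | e ∈ edgePairOf q} := by
    intro q
    ext e
    change e ∈ [edgeOf q.1, edgeOf q.2] ↔ e ∈ s(edgeOf q.1, edgeOf q.2)
    simp
  constructor
  · rintro ⟨F, hF, rfl⟩
    rcases List.mem_append.1 hF with h | h
    · obtain ⟨p, hp, rfl⟩ := List.mem_map.1 h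
      exact Or.inl ⟨edgeOf p, (h₁.2 _).1 (List.mem_map_of_mem hp), e1 p⟩
    · obtain ⟨q, hq, rfl⟩ := List.mem_map.1 h
      exact Or.inr ⟨edgePairOf q, (h₂.2 _).1 (List.mem_map_of_mem hq), e2 q⟩
  · rintro (⟨e, he, rfl⟩ | ⟨c, hc, rfl⟩)
    · obtain ⟨p, hp, rfl⟩ := List.mem_map.1 ((h₁.2 e).2 he)
      exact ⟨[p], List.mem_append_left _ (List.mem_map_of_mem hp), (e1 p).symm⟩
    · obtain ⟨q, hq, rfl⟩ := List.mem_map.1 ((h₂.2 c).2 hc)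
      exact ⟨[q.1, q.2], List.mem_append_right _ (List.mem_map_of_mem
        (f := fun q : (Fin n × Fin n) × (Fin n × Fin n) => [q.1, q.2]) hq), (e2 q).symm⟩

theorem cutLists_valid (hC₁ : ∀ e ∈ C₁, e ∈ T.edgeSet)
    (hC₂ : ∀ q ∈ C₂, ¬ q.IsDiag ∧ ∀ e ∈ q, e ∈ T.edgeSet)
    (h₁ : Lists edgeOf L₁ (C₁ : Set (Sym2 (Fin n))))
    (h₂ : Lists edgePairOf L₂ (C₂ : Set (Sym2 (Sym2 (Fin n))))) {F : List (Fin n × Fin n)}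
    (hF : F ∈ cutLists L₁ L₂) : (F.map edgeOf).Nodup ∧ ∀ p ∈ F, T.Adj p.1 p.2 := by
  rcases List.mem_append.1 hF with h | h
  · obtain ⟨p, hp, rfl⟩ := List.mem_map.1 h
    refine ⟨List.nodup_singleton _, fun p' hp' => ?_⟩
    rw [List.mem_singleton] at hp'
    subst hp'
    exact hC₁ _ ((h₁.2 _).1 (List.mem_map_of_mem hp))
  · obtain ⟨q, hq, rfl⟩ := List.mem_map.1 h
    obtain ⟨hd, he⟩ := hC₂ _ ((h₂.2 _).1 (List.mem_map_of_mem hq))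
    have hne : edgeOf q.1 ≠ edgeOf q.2 := fun h => hd (Sym2.mk_isDiag_iff.2 h)
    refine ⟨by simpa using hne, fun p hp => ?_⟩
    have hp' : p = q.1 ∨ p = q.2 := by simpa using hp
    rcases hp' with rfl | rfl
    · exact he _ (Sym2.mem_mk_left _ _)
    · exact he _ (Sym2.mem_mk_right _ _)

theorem exists_sides (hT : T.IsTree) (hC₁ : ∀ e ∈ C₁, e ∈ T.edgeSet)
    (hC₂ : ∀ q ∈ C₂, ¬ q.IsDiag ∧ ∀ e ∈ q, e ∈ T.edgeSet)
    (h₁ : Lists edgeOf L₁ (C₁ : Set (Sym2 (Fin n))))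
    (h₂ : Lists edgePairOf L₂ (C₂ : Set (Sym2 (Sym2 (Fin n))))) :
    ∃ S : Fin (cutLists L₁ L₂).length → Set (Fin n),
      (∀ i, boundary T (S i) = {e | e ∈ ((cutLists L₁ L₂)[i]).map edgeOf}) ∧
      ∀ u v, meet T C₁ C₂ u v ↔ ∀ i, (u ∈ S i ↔ v ∈ S i) := by
  have hex : ∀ i : Fin (cutLists L₁ L₂).length, ∃ S : Set (Fin n),
      boundary T S = {e | e ∈ ((cutLists L₁ L₂)[i]).map edgeOf} := by
    intro i
    rcases (setOf_mem_map_edgeOf_cutLists h₁ h₂ _).1 ⟨_, List.getElem_mem i.2, rfl⟩ with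
      ⟨e, he, h⟩ | ⟨q, hq, h⟩
    · obtain ⟨S, hS⟩ := exists_boundary_eq_singleton hT (hC₁ e he)
      exact ⟨S, hS.trans h.symm⟩
    · induction q using Sym2.ind with
      | _ a b =>
        obtain ⟨hd, hab⟩ := hC₂ _ hq
        obtain ⟨S, hS⟩ := exists_boundary_eq_pair hT (hab a (Sym2.mem_mk_left a b))
          (hab b (Sym2.mem_mk_right a b)) fun h => hd (Sym2.mk_isDiag_iff.2 h)
        refine ⟨S, hS.trans (Eq.trans ?_ h.symm)⟩
        ext e
        exact Sym2.mem_iff.symm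
  choose S hS using hex
  refine ⟨S, hS, meet_rel hT _ S hS fun A => ?_⟩
  rw [← setOf_mem_map_edgeOf_cutLists h₁ h₂]
  constructor
  · rintro ⟨i, hi⟩
    exact ⟨_, List.getElem_mem i.2, hi⟩
  · rintro ⟨F, hF, hA⟩
    obtain ⟨i, hi, rfl⟩ := List.mem_iff_getElem.1 hF
    exact ⟨⟨i, hi⟩, hA⟩

theorem length_cutItems_cutLists (L₁ : List (Fin n × Fin n))
    (L₂ : List ((Fin n × Fin n) × (Fin n × Fin n))) :
    (cutItems 0 (cutLists L₁ L₂)).length = L₁.length + 2 * L₂.length := by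
  have h : ∀ (j : ℕ) (l : List (List (Fin n × Fin n))),
      (cutItems j l).length = (l.map List.length).sum := by
    intro j l
    induction l generalizing j with
    | nil => rfl
    | cons F l ih => simp [cutItems, ih]
  rw [h, cutLists]
  simp [Function.comp_def, mul_comm]

/-- Each edge occurs in two neighbour lists, with twice its step cost in each. This gives 4 · 400
units per edge and a factor 4 on the flips, whose marks sum to at most the number of items. -/
theorem pot_le (hE : Lists edgeOf E T.edgeSet) (I : List ((Fin n × Fin n) × ℕ)) (M : ℕ) :
    pot n (stepCost M (markList I)) (adjList E) [0] ≤
      1600 * E.length + 4 * I.length * (204 * Nat.log 2 (2 * M) + 150) := by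
  obtain ⟨K, hK⟩ : ∃ K, 204 * Nat.log 2 (2 * M) + 150 = K := ⟨_, rfl⟩
  have h1 := sum_adjList E fun x y => 2 * stepCost M (markList I) x y
  unfold pot pathPot
  rw [h1, add_zero, hK]
  have h2 : (E.map fun p => 2 * stepCost M (markList I) p.1 p.2 + 2 * stepCost M (markList I) p.2 p.1) =
      E.map fun p => 1600 + (markList I p.1 p.2).length * (4 * K) := by
    refine List.map_congr_left fun p _ => ?_
    unfold stepCost
    rw [hK, length_markList_comm I p.2 p.1]
    ring
  rw [h2, List.sum_map_add, List.sum_map_mul_right]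
  have h3 := Nat.mul_le_mul_right (4 * K) (sum_markList_le hE I)
  simp only [List.map_const', List.sum_replicate, smul_eq_mul]
  nlinarith

theorem listsPartition_filter {r : Setoid (Fin n)} {lab : ℕ → ℕ} {ls : List ℕ}
    (hr : ∀ u v : Fin n, r u v ↔ lab u = lab v) (hls : ls.Nodup)
    (hmem : ∀ l, l ∈ ls ↔ ∃ x, x < n ∧ lab x = l) :
    ListsPartition (ls.map fun l => (List.finRange n).filter fun v : Fin n => lab v = l) r := by
  have hset : ∀ l, {v : Fin n | v ∈ (List.finRange n).filter fun v : Fin n => lab v = l} =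
      {v : Fin n | lab v = l} := by
    intro l
    ext v
    change v ∈ (List.finRange n).filter _ ↔ lab v = l
    simp
  refine ⟨fun b hb => ?_, ?_, fun A => ?_⟩
  · obtain ⟨l, -, rfl⟩ := List.mem_map.1 hb
    exact (List.nodup_finRange n).filter _
  · rw [List.map_map, List.nodup_map_iff_inj_on hls]
    intro l hl l' _ h
    simp only [Function.comp_def, hset] at h
    obtain ⟨x, hx, rfl⟩ := (hmem l).1 hl
    have : (⟨x, hx⟩ : Fin n) ∈ {v : Fin n | lab v = l'} := by
      rw [← h]
      exact rfl
    exact this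
  · rw [List.map_map]
    constructor
    · intro h
      obtain ⟨l, hl, rfl⟩ := List.mem_map.1 h
      obtain ⟨x, hx, rfl⟩ := (hmem l).1 hl
      refine ⟨⟨x, hx⟩, ?_⟩
      simp only [Function.comp_def, hset]
      ext v
      exact (hr v ⟨x, hx⟩).symm
    · rintro ⟨y, rfl⟩
      refine List.mem_map.2 ⟨lab y, (hmem _).2 ⟨y, y.2, rfl⟩, ?_⟩
      simp only [Function.comp_def, hset]
      ext v
      exact (hr v y).symm

theorem meetProg_ends {w : ℕ} (hT : T.IsTree) (hC₁ : ∀ e ∈ C₁, e ∈ T.edgeSet)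
    (hC₂ : ∀ q ∈ C₂, ¬ q.IsDiag ∧ ∀ e ∈ q, e ∈ T.edgeSet) (hE : Lists edgeOf E T.edgeSet)
    (h₁ : Lists edgeOf L₁ (C₁ : Set (Sym2 (Fin n))))
    (h₂ : Lists edgePairOf L₂ (C₂ : Set (Sym2 (Sym2 (Fin n)))))
    (hw : 81 * (Nat.log 2 n + 1) ≤ w) :
    Ends w meetProg (initState (encodeInput E L₁ L₂))
      (10000 * (n + C₁.card + C₂.card) * (Nat.log 2 n + 1)) fun s => ∃ B,
        HasOutput s (encodeOutput B) ∧ ListsPartition B (meet T C₁ C₂) := by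
  classical
  have hEn := length_edges hT hE
  have hE' : Lists edgeOf E (T.edgeFinset : Set (Sym2 (Fin n))) := by simpa using hE
  have hEc := hE'.length_eq_card
  have hc₁ := h₁.length_eq_card
  have hc₂ := h₂.length_eq_card
  have hle₁ : L₁.length ≤ E.length := by
    rw [hc₁, hEc]
    exact Finset.card_le_card fun e he => SimpleGraph.mem_edgeFinset.2 (hC₁ e he)
  have hle₂ : L₂.length ≤ E.length * E.length := by
    rw [hc₂, hEc]
    exact card_pairs_le _ fun q hq e he => SimpleGraph.mem_edgeFinset.2 ((hC₂ q hq).2 e he)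
  rw [← hc₁, ← hc₂]
  obtain ⟨Λ, hΛ⟩ : ∃ Λ, Nat.log 2 n + 1 = Λ := ⟨_, rfl⟩
  have hnΛ : n < 2 ^ Λ := hΛ ▸ Nat.lt_pow_succ_log_self (by omega) n
  rw [hΛ] at hw ⊢
  have hΛ1 : 1 ≤ Λ := by omega
  obtain ⟨M, hM⟩ : ∃ M, L₁.length + L₂.length + 1 = M := ⟨_, rfl⟩
  have hcut : (cutLists L₁ L₂).length + 1 = M := by simp [cutLists, ← hM]
  have hMn : M ≤ n * n := by rw [← hEn, ← hM]; nlinarith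
  obtain ⟨D, hD⟩ : ∃ D, Nat.log 2 (2 * M) = D := ⟨_, rfl⟩
  -- From M ≤ n² and n < 2^Λ one gets 2M < 2^(1 + 2Λ).
  have hDΛ : D ≤ 3 * Λ := by
    have : D < 1 + 2 * Λ := by
      rw [← hD]
      refine Nat.log_lt_of_lt_pow (by omega) ?_
      have : n * n < 2 ^ Λ * 2 ^ Λ := Nat.mul_lt_mul'' hnΛ hnΛ
      rw [pow_add, mul_comm 2 Λ, pow_mul]
      nlinarith
    omega
  obtain ⟨N, hN⟩ : ∃ N, n + L₁.length + L₂.length = N := ⟨_, rfl⟩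
  rw [hN]
  have hpot := pot_le hE (cutItems 0 (cutLists L₁ L₂)) M
  rw [length_cutItems_cutLists, hD] at hpot
  obtain ⟨p, hp⟩ : ∃ p, pot n (stepCost M (markList (cutItems 0 (cutLists L₁ L₂)))) (adjList E) [0] = p :=
    ⟨_, rfl⟩
  rw [hp] at hpot
  -- With D ≤ 3Λ a flip costs at most (3 · 204 + 150)Λ = 762Λ; the pairs give the factor 8, and 8 ·
  -- 762 is below 8000.
  have hp' : p ≤ 8000 * (N * Λ) := by
    have e1 : 204 * D + 150 ≤ 762 * Λ := by omega
    have e2 : 4 * (L₁.length + 2 * L₂.length) * (204 * D + 150) ≤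
        8 * (L₁.length + L₂.length) * (762 * Λ) := Nat.mul_le_mul (by omega) e1
    have e3 : 1600 * E.length ≤ 1600 * n * Λ := by nlinarith
    rw [← hN]
    nlinarith
  have hNΛ : N ≤ N * Λ := Nat.le_mul_of_pos_right _ hΛ1
  have hN1 : 1 ≤ N := by omega
  -- the bound on the numbers that occur
  obtain ⟨X, hXdef⟩ : ∃ X, 2 ^ (18 * Λ) = X := ⟨_, rfl⟩
  have hX : Roomy w X := by
    constructor
    · rw [← hXdef, ← pow_mul, show 512 = 2 ^ 9 by norm_num, ← pow_add]
      exact Nat.pow_le_pow_right (by omega) (by omega)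
    · rw [← hXdef, show 8 = 2 ^ 3 by norm_num]
      exact Nat.pow_le_pow_right (by omega) (by omega)
  have hNX : 10000 * (N * Λ) ≤ X := by
    have e1 : N ≤ 2 * (2 ^ Λ * 2 ^ Λ) := by
      have : n * n < 2 ^ Λ * 2 ^ Λ := Nat.mul_lt_mul'' hnΛ hnΛ
      have : n ≤ n * n := Nat.le_mul_self n
      omega
    have e2 : Λ ≤ 2 ^ Λ := Nat.lt_two_pow_self.le
    have e3 : N * Λ ≤ 2 * (2 ^ Λ * 2 ^ Λ) * 2 ^ Λ := Nat.mul_le_mul e1 e2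
    have e4 : 2 ^ 14 * (2 * (2 ^ Λ * 2 ^ Λ) * 2 ^ Λ) ≤ X := by
      have : 2 ^ 14 * (2 * (2 ^ Λ * 2 ^ Λ) * 2 ^ Λ) = 2 ^ (15 + 3 * Λ) := by ring
      rw [this, ← hXdef]
      exact Nat.pow_le_pow_right (by omega) (by omega)
    omega
  have hn0 : 0 < n := by omega
  obtain ⟨S, hS, hmeet⟩ := exists_sides hT hC₁ hC₂ h₁ h₂
  have hMT := markedTree hE (fun F hF => (cutLists_valid hC₁ hC₂ h₁ h₂ hF).1)
    (fun F hF => (cutLists_valid hC₁ hC₂ h₁ h₂ hF).2) S hS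
  rw [hcut] at hMT
  obtain ⟨β, hβ⟩ : ∃ β, 4 * (n + M) = β := ⟨_, rfl⟩
  have hβX : β ≤ X := by omega
  have hread := readInput_ends (w := w) (X := X) hX hEn (by rw [hM]; omega)
  rw [hM, hβ] at hread
  refine Ends.block_cons (hread.mono le_rfl ?_) (b₂ := p + 200 + (200 * n + 10 + (400 * n + 80 + 1))) ?_
  swap
  · have : 10000 * N * Λ = 10000 * (N * Λ) := by ring
    omega
  rintro s₁ ⟨r0, r1, r2, r9, a0, a1, az⟩
  refine Ends.block_cons ((walk_ends (b := p + 200) hX hβX (by omega) hn0 (by omega) (by omega) hMT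
    (adjList_connected hT.connected hE hn0) r0 r2 r9 (fun x _ => a0 x) (fun x y _ _ => a1 x y) az
    (by rw [hp]) (by omega)).mono le_rfl ?_) le_rfl
  rintro s₂ ⟨b1, b2, b3⟩
  obtain ⟨lab, hlab⟩ : ∃ lab : ℕ → ℕ, lab = fun x => s₂.mem (addr β 5 x 0) := ⟨_, rfl⟩
  have hlab' : ∀ x, s₂.mem (addr β 5 x 0) = lab x := fun x => by rw [hlab]
  simp only [hlab'] at b1 b2
  refine Ends.block_cons ((group_ends (lab := lab) hX hβX (by omega) b2 ((b3.reg 0 (by simp)).trans r0)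
    ((b3.reg 1 (by simp)).trans r1) (fun x _ => hlab' x) (fun t h6 h8 x y => ?_)).mono le_rfl ?_) le_rfl
  · rw [b3.arr t h8 (by simp; omega)]
    exact az t (by omega) h8 x y
  rintro s₃ ⟨ls, d6, d7, hnd, hmem, hlen, d0⟩
  have hsum : (ls.flatMap fun l => ((List.range n).filter fun x => lab x = l).length ::
      (List.range n).filter fun x => lab x = l).length ≤ n + n := by
    rw [List.length_flatMap]
    simp only [List.length_cons]
    rw [List.sum_map_add]
    have := sum_length_filter_le hnd lab (List.range n)
    rw [List.length_range] at this
    simp only [List.map_const', List.sum_replicate, smul_eq_mul, mul_one]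
    omega
  refine Ends.block_cons ((writeOutput_ends hX hβX (fun l => ((List.length_filter_le _ _).trans
    (by simp; omega))) d0 d7 d6 (fun l hl => ?_) (by omega) (by omega)).mono (b' := 400 * n + 80)
    (by omega) ?_) le_rfl
  · obtain ⟨x, hx, rfl⟩ := (hmem l).1 hl
    exact b2 x hx
  intro s₄ hout
  refine Ends.block_nil le_rfl ⟨_, ?_, listsPartition_filter (lab := lab) (fun u v => ?_) hnd hmem⟩
  · have hmap : ∀ l, (((List.finRange n).filter fun v : Fin n => lab v = l).map
        fun v : Fin n => (v : ℕ)) =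
        (List.range n).filter fun x => lab x = l := by
      intro l
      rw [← List.map_coe_finRange_eq_range, List.filter_map]
      rfl
    have hlen' : ∀ l, ((List.finRange n).filter fun v : Fin n => lab v = l).length =
        ((List.range n).filter fun x => lab x = l).length := by
      intro l
      rw [← hmap, List.length_map]
    unfold encodeOutput
    rw [List.length_map, List.flatMap_map]
    simp only [List.map_id', List.bind_eq_flatMap, List.pure_def, ← List.map_eq_flatMap, hmap, hlen']
    exact hout
  · rw [hmeet, b1 u v u.2 v.2]
    constructor
    · intro h j hj
      rcases Nat.eq_zero_or_pos j with rfl | hj0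
      · simp [sideBit]
      · obtain ⟨i, rfl⟩ : ∃ i, j = i + 1 := ⟨j - 1, by omega⟩
        exact (sideBit_eq_iff u v ⟨i, by omega⟩).2 (h ⟨i, by omega⟩)
    · intro h i
      exact (sideBit_eq_iff u v i).1 (h (i + 1) (by have := i.2; omega))

end

/-! ### The iterated logarithm -/

/-- The infimum of the empty set is 0, so it must be shown that iterating the logarithm does reach
1. For x > 2 Bernoulli's inequality gives x ≤ 2^(x - 1), so each application lowers the value by at
least 1 until it is at most 2. -/
theorem one_le_logStar {x : ℝ} (hx : 1 < x) : 1 ≤ logStar x := by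
  have hex : ∀ (N : ℕ) (x : ℝ), x ≤ N + 1 → ∃ i, (Real.logb 2)^[i] x ≤ 1 := by
    intro N
    induction N with
    | zero => exact fun x hx => ⟨0, by simpa using hx⟩
    | succ N ih =>
      intro x hx
      rcases le_or_gt x 2 with h2 | h2
      · rcases le_or_gt x 1 with h1 | h1
        · exact ⟨0, h1⟩
        · refine ⟨1, ?_⟩
          change Real.logb 2 x ≤ 1
          rw [Real.logb_le_iff_le_rpow (by norm_num) (by linarith)]
          simpa using h2
      · have hb := one_add_mul_self_le_rpow_one_add (s := 1) (by norm_num) (p := x - 1) (by linarith)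
        have hl : Real.logb 2 x ≤ x - 1 := by
          rw [Real.logb_le_iff_le_rpow (by norm_num) (by linarith)]
          norm_num at hb
          exact hb
        push_cast at hx
        obtain ⟨i, hi⟩ := ih (Real.logb 2 x) (by linarith)
        exact ⟨i + 1, hi⟩
  obtain ⟨N, hN⟩ := exists_nat_ge x
  have hne : {i : ℕ | (Real.logb 2)^[i] x ≤ 1}.Nonempty := hex N x (by linarith)
  have hmem := Nat.sInf_mem hne
  rw [Nat.one_le_iff_ne_zero]
  intro h0
  have h1 : (Real.logb 2)^[logStar x] x ≤ 1 := hmem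
  rw [h0] at h1
  exact absurd hx (not_lt.2 h1)

/-- For n ≥ 2 both the logarithm and `logStar` are at least 1, so the claimed factor dominates a
single logarithm. For smaller n the maximum with 1 takes over. -/
theorem natLog_add_one_le {n : ℕ} :
    ((Nat.log 2 n + 1 : ℕ) : ℝ) ≤ 2 * max 1 (Real.logb 2 (n : ℝ) ^ 2 * (logStar (n : ℝ) : ℝ)) := by
  rcases Nat.lt_or_ge n 2 with h | h
  · have h0 : Nat.log 2 n = 0 := Nat.log_of_lt h
    rw [h0]
    have := le_max_left 1 (Real.logb 2 (n : ℝ) ^ 2 * (logStar (n : ℝ) : ℝ))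
    norm_num
    linarith
  · have hn : (2 : ℝ) ≤ n := by exact_mod_cast h
    have h1 : (1 : ℝ) ≤ logStar (n : ℝ) := by exact_mod_cast one_le_logStar (by linarith)
    have h2 : (Nat.log 2 n : ℝ) ≤ Real.logb 2 n := by exact_mod_cast Real.natLog_le_logb n 2
    have h3 : 1 ≤ Real.logb 2 (n : ℝ) := by
      rw [Real.le_logb_iff_rpow_le (by norm_num) (by linarith)]
      simpa using hn
    have h4 := le_max_right 1 (Real.logb 2 (n : ℝ) ^ 2 * (logStar (n : ℝ) : ℝ))
    have h5 : Real.logb 2 (n : ℝ) ≤ Real.logb 2 (n : ℝ) ^ 2 * (logStar (n : ℝ) : ℝ) := by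
      nlinarith [mul_le_mul h3 h1 (by norm_num) (by linarith), sq_nonneg (Real.logb 2 (n : ℝ))]
    push_cast
    linarith

end TreeCuts

theorem mainTheorem8 :
    ∃ (P : WordRAM.Prog) (k : ℕ) (C : ℝ),
      ∀ (n : ℕ) (T : SimpleGraph (Fin n))
        (C₁ : Finset (Sym2 (Fin n))) (C₂ : Finset (Sym2 (Sym2 (Fin n))))
        (E L₁ : List (Fin n × Fin n)) (L₂ : List ((Fin n × Fin n) × (Fin n × Fin n))) (w : ℕ),
        T.IsTree →
        (∀ e ∈ C₁, e ∈ T.edgeSet) →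
        (∀ q ∈ C₂, ¬ q.IsDiag ∧ ∀ e ∈ q, e ∈ T.edgeSet) →
        TreeCuts.Lists TreeCuts.edgeOf E T.edgeSet →
        TreeCuts.Lists TreeCuts.edgeOf L₁ (C₁ : Set (Sym2 (Fin n))) →
        TreeCuts.Lists TreeCuts.edgePairOf L₂ (C₂ : Set (Sym2 (Sym2 (Fin n)))) →
        k * (Nat.log 2 n + 1) ≤ w →
        ∃ (t : ℕ) (s : WordRAM.State) (B : List (List (Fin n))),
          WordRAM.Exec w P (WordRAM.initState (TreeCuts.encodeInput E L₁ L₂)) t s ∧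
          WordRAM.HasOutput s (TreeCuts.encodeOutput B) ∧
          TreeCuts.ListsPartition B (TreeCuts.meet T C₁ C₂) ∧
          (t : ℝ) ≤ C * (((n : ℝ) + (C₁.card : ℝ) + (C₂.card : ℝ)) *
            max 1 (Real.logb 2 (n : ℝ) ^ 2 * (TreeCuts.logStar (n : ℝ) : ℝ))) := by
  -- 20000 is the constant 10000 of `meetProg_ends` times the 2 of `natLog_add_one_le`.
  refine ⟨WordRAM.meetProg, 81, 20000, ?_⟩
  intro n T C₁ C₂ E L₁ L₂ w hT hC₁ hC₂ hE h₁ h₂ hw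
  obtain ⟨t, s, hexec, ht, B, hB, hpart⟩ := TreeCuts.meetProg_ends hT hC₁ hC₂ hE h₁ h₂ hw
  refine ⟨t, s, B, hexec, hB, hpart, ?_⟩
  have hlog := TreeCuts.natLog_add_one_le (n := n)
  have ht' : (t : ℝ) ≤ 10000 * (n + C₁.card + C₂.card) * ((Nat.log 2 n + 1 : ℕ) : ℝ) := by
    exact_mod_cast ht
  refine ht'.trans ?_
  calc (10000 : ℝ) * (n + C₁.card + C₂.card) * ((Nat.log 2 n + 1 : ℕ) : ℝ)
      ≤ 10000 * (n + C₁.card + C₂.card) *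
        (2 * max 1 (Real.logb 2 (n : ℝ) ^ 2 * (TreeCuts.logStar (n : ℝ) : ℝ))) :=
        mul_le_mul_of_nonneg_left hlog (by positivity)
    _ = _ := by ring
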